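/- Let $\Sigma\subseteq\{1,\dots,m\}^{\mathbb Z}$ be a two-sided subshift of finite type given by a transition matrix, with left shift $T:\Sigma\to\Sigma$, and assume that $T$ is topologically transitive. Let $\mu$ be a Gibbs measure for a Hölder continuous potential $\varphi$ on $\Sigma$: a $T$-invariant probability measure for which there are constants $P\in\mathbb R$ and $C>0$ with $$C^{-1}\le \frac{\mu[x_0,\dots,x_{n-1}]}{e^{S_n\varphi(x)-nP}}\le C\qquad\text{for all } n\ge 0,\ x\in\Sigma .$$ Let $W^s_{loc}(x)=\{y: y_n=x_n\ \forall n\ge 0\}$ and $W^u_{loc}(x)=\{y: y_n=x_n\ \forall n\le 0\}$. Let $d\ge 1$ and let $E$ be a continuous vector bundle of rank $d$ over $\Sigma$; it is trivial, and we identify it with $\Sigma\times\mathbb R^d$. Let $M$ be a linear cocycle on $E$ over $T$, given by $M(x)\in GL_d(\mathbb R)$ and with iterates $M^n(x)$, $n\in\mathbb Z$. Assume that $M$ is *locally constant* in some trivialization: there is a continuous $L:\Sigma\to GL_d(\mathbb R)$ such that $L(Tx)M(x)L(x)^{-1}$ depends only on $(x_0,x_1)$ (in particular, it may depend only on $x_0$).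 In this trivialization the identity is an invariant stable and unstable holonomy; on $E$ it is $H_{x\to y}=L(y)^{-1}L(x)$, for $y\in W^s_{loc}(x)$ or $y\in W^u_{loc}(x)$. Assume that $M$ is *strongly irreducible*: there do not exist integers $0<k<d$ and $N>0$ and, for each $x\in\Sigma$, distinct $k$-dimensional subspaces $V_1(x),\dots,V_N(x)$ of $E(x)$, depending continuously on $x$, such that $M(x)\{V_1(x),\dots,V_N(x)\}=\{V_1(Tx),\dots,V_N(Tx)\}$ for all $x$, and $H_{x\to y}\{V_1(x),\dots,V_N(x)\}=\{V_1(y),\dots,V_N(y)\}$ for all $x$ and all $y\in W^u_{loc}(x)\cup W^s_{loc}(x)$. Let $\lambda_1\ge\dots\ge\lambda_d$ be the Lyapunov exponents of $M$ with respect to $\mu$, i.e., for every $i$, $\frac1n\log\|\Lambda^iM^n(x)\|\to\lambda_1+\dots+\lambda_i$ as $n\to+\infty$ for $\mu$-almost every $x$. Assume that the top exponent is simple: $\lambda_j<\lambda_1$ for all $j>1$. Let $T_{\mathbb P}(x,[v])=(Tx,[M(x)v])$ on $\mathbb P(E)=\Sigma\times\mathbb P(\mathbb R^d)$. A *$u$-state*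 is a probability measure $\nu$ on $\mathbb P(E)$ that projects to $\mu$ and whose fiberwise disintegration $\nu=\mu\otimes\nu_x$ is $\mu$-almost surely invariant under unstable holonomy: there is a set $S$ of full $\mu$-measure such that $(H_{x\to y})_*\nu_x=\nu_y$ for all $x,y\in S$ with $y\in W^u_{loc}(x)$. An *invariant $u$-state* is a $u$-state that is $T_{\mathbb P}$-invariant. Then there is a measurable map $x\mapsto v_1(x)\in E(x)\setminus\{0\}$ such that, for $\mu$-almost every $x$, the line $\mathbb R v_1(x)$ is the Oseledets subspace for the top exponent, $$\mathbb R v_1(x)=\{0\}\cup\Big\{v\ne0:\ \tfrac1n\log\|M^n(x)v\|\to\lambda_1 \text{ as } n\to+\infty \text{ and as } n\to-\infty\Big\},$$ and $T_{\mathbb P}$ has exactly one invariant $u$-state, namely $\mu\otimes\delta_{[v_1]}$, the image of $\mu$ under $x\mapsto(x,[v_1(x)])$. -/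

import Mathlib

open MeasureTheory ProbabilityTheory Filter Topology
open scoped LinearAlgebra.Projectivization

noncomputable section

namespace SFTCocycle

/-! ### Subshifts of finite type -/

/-- The two-sided subshift of finite type on the alphabet `Fin m` with transition matrix `A`,
with the topology and the Borel sigma-algebra inherited from the product `ℤ → Fin m`. -/
abbrev SFT {m : ℕ} (A : Fin m → Fin m → Prop) : Type :=
  {x : ℤ → Fin m // ∀ i, A (x i) (x (i + 1))}

section Shift

variable {m : ℕ} {A : Fin m → Fin m → Prop}

/-- The left shift, as a bijection of the subshift: `(shift A x)_i = x_{i+1}`. -/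
def shift (A : Fin m → Fin m → Prop) : SFT A ≃ SFT A where
  toFun x := ⟨fun i => x.1 (i + 1), fun i => x.2 (i + 1)⟩
  invFun x := ⟨fun i => x.1 (i - 1), fun i => by
    have h := x.2 (i - 1)
    rwa [show i - 1 + 1 = i + 1 - 1 by ring] at h⟩
  left_inv x := by ext i; simp
  right_inv x := by ext i; simp

/-- Topological transitivity of the shift. -/
def IsTransitive (A : Fin m → Fin m → Prop) : Prop :=
  ∀ U V : Set (SFT A), IsOpen U → U.Nonempty → IsOpen V → V.Nonempty →
    ∃ n : ℕ, ((shift A)^[n] '' U ∩ V).Nonempty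

/-- The local stable set `{y | y_n = x_n for all n ≥ 0}`. -/
def Wsloc (x : SFT A) : Set (SFT A) := {y | ∀ n : ℤ, 0 ≤ n → y.1 n = x.1 n}

/-- The local unstable set `{y | y_n = x_n for all n ≤ 0}`. -/
def Wuloc (x : SFT A) : Set (SFT A) := {y | ∀ n : ℤ, n ≤ 0 → y.1 n = x.1 n}

/-- The cylinder `[x_0, …, x_{n-1}]`. -/
def cylinder (x : SFT A) (n : ℕ) : Set (SFT A) :=
  {y | ∀ i : ℤ, 0 ≤ i → i < n → y.1 i = x.1 i}

/-- Hölder continuity of a function on the subshift (with respect to the usual distances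
`θ ^ min {|i| : x_i ≠ y_i}`): its variations on symmetric cylinders decay exponentially. -/
def IsHolder (φ : SFT A → ℝ) : Prop :=
  ∃ C θ : ℝ, 0 < θ ∧ θ < 1 ∧ ∀ (n : ℕ) (x y : SFT A),
    (∀ i : ℤ, |i| ≤ n → x.1 i = y.1 i) → |φ x - φ y| ≤ C * θ ^ n

/-- `μ` is a Gibbs measure for the shift, for some Hölder continuous potential. -/
structure IsGibbs (μ : Measure (SFT A)) : Prop where
  isProbabilityMeasure : IsProbabilityMeasure μ
  invariant : MeasurePreserving (shift A) μ μ
  gibbs : ∃ φ : SFT A → ℝ, IsHolder φ ∧ ∃ P C : ℝ, 0 < C ∧ ∀ (n : ℕ) (x : SFT A),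
    C⁻¹ ≤ μ.real (cylinder x n) / Real.exp (birkhoffSum (shift A) φ n x - n * P) ∧
    μ.real (cylinder x n) / Real.exp (birkhoffSum (shift A) φ n x - n * P) ≤ C

end Shift

/-! ### Linear cocycles -/

/-- The fiber `ℝ^d`, with its Euclidean norm. -/
abbrev Vec (d : ℕ) : Type := EuclideanSpace ℝ (Fin d)

/-- The topological group `GL_d(ℝ)`, as the group of invertible operators of `ℝ^d`. -/
abbrev GLd (d : ℕ) : Type := (Vec d →L[ℝ] Vec d)ˣ

/-- The projective space `P(ℝ^d)`. -/
abbrev Proj (d : ℕ) : Type := ℙ ℝ (Vec d)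

/-- The quotient topology on projective space. -/
instance (d : ℕ) : TopologicalSpace (Proj d) :=
  TopologicalSpace.coinduced (Projectivization.mk' ℝ) inferInstance

instance (d : ℕ) : MeasurableSpace (Proj d) := borel (Proj d)

instance (d : ℕ) : BorelSpace (Proj d) := ⟨rfl⟩

section Cocycle

variable {m d : ℕ} {A : Fin m → Fin m → Prop}

/-- The iterates of the cocycle `M` in positive time, `M^n(x) = M(T^{n-1} x) ⋯ M(x)`. -/
def iterNat (M : SFT A → GLd d) : ℕ → SFT A → GLd d
  | 0, _ => 1
  | n + 1, x => M ((shift A)^[n] x) * iterNat M n x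

/-- The iterates of the cocycle `M` in all integer times, with `M^{-n}(x) = M^n(T^{-n} x)⁻¹`. -/
def iter (M : SFT A → GLd d) : ℤ → SFT A → GLd d
  | Int.ofNat n, x => iterNat M n x
  | Int.negSucc n, x => (iterNat M (n + 1) ((shift A).symm^[n + 1] x))⁻¹

/-- The norm of the exterior power `Λ^{i+1} g` (for `i : Fin d` starting from `0`), i.e. the
product of the `i + 1` largest singular values of `g`. -/
def exteriorNorm (i : Fin d) (g : GLd d) : ℝ :=
  ∏ j ∈ Finset.Iic i, (g.1 : Vec d →ₗ[ℝ] Vec d).singularValues j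

/-- `lam 0 ≥ lam 1 ≥ ⋯ ≥ lam (d-1)` are the Lyapunov exponents of `M` with respect to `μ`, counted
with multiplicity: `log ‖Λ^i M^n(x)‖ / n` converges almost surely to the sum of the first `i` of
them. -/
def IsLyapunovSpectrum (μ : Measure (SFT A)) (M : SFT A → GLd d) (lam : Fin d → ℝ) : Prop :=
  ∀ᵐ x ∂μ, ∀ i : Fin d,
    Tendsto (fun n : ℕ => Real.log (exteriorNorm i (iterNat M n x)) / n) atTop
      (𝓝 (∑ j ∈ Finset.Iic i, lam j))

/-- The Oseledets subspace at `x` for the exponent `l`: the zero vector, and the nonzero vectors `v`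
such that `log ‖M^n(x) v‖ / n → l` when `n → +∞` and when `n → -∞`. -/
def oseledets (M : SFT A → GLd d) (l : ℝ) (x : SFT A) : Set (Vec d) :=
  {v | v = 0 ∨
    (Tendsto (fun n : ℤ => Real.log ‖(iter M n x).1 v‖ / n) atTop (𝓝 l) ∧
     Tendsto (fun n : ℤ => Real.log ‖(iter M n x).1 v‖ / n) atBot (𝓝 l))}

/-- `M` is locally constant in the trivialization `L` of the trivial bundle: in the coordinates
`(x, v) ↦ (x, L(x) v)` it depends only on the symbols `x_0` and `x_1`, which means that the
identity, in these coordinates, is an invariant holonomy along both local stable and local unstable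
sets. -/
def IsLocallyConstantIn (M L : SFT A → GLd d) : Prop :=
  Continuous L ∧ ∃ B : Fin m → Fin m → GLd d,
    ∀ x, L (shift A x) * M x * (L x)⁻¹ = B (x.1 0) (x.1 1)

/-- The identity holonomy in the trivialization `L`, as a map from the fiber at `x` to the fiber
at `y`. It is used for `y` in the local stable or local unstable set of `x`. -/
def trivHolonomy (L : SFT A → GLd d) (x y : SFT A) : GLd d := (L y)⁻¹ * L x

/-- The image of a linear subspace under an invertible operator. -/
def mapSubspace (g : GLd d) (W : Submodule ℝ (Vec d)) : Submodule ℝ (Vec d) :=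
  W.map (g.1 : Vec d →ₗ[ℝ] Vec d)

/-- The distance on the Grassmannian of subspaces of a given dimension, namely the norm of the
orthogonal projection from `U` to the orthogonal complement of `W`. -/
def grassDist (U W : Submodule ℝ (Vec d)) : ℝ :=
  ‖(Wᗮ).starProjection ∘L U.starProjection‖

/-- `M`, with stable holonomy `Hs` and unstable holonomy `Hu`, is *not* strongly irreducible: there
is a continuous family of `N > 0` distinct subspaces `V_1(x), …, V_N(x)` of the same dimension
`0 < k < d` which, as a whole, is invariant under the cocycle and under the holonomies. -/
def NotStronglyIrreducible (M : SFT A → GLd d) (Hs Hu : SFT A → SFT A → GLd d) : Prop :=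
  ∃ (k N : ℕ) (V : Fin N → SFT A → Submodule ℝ (Vec d)),
    0 < k ∧ k < d ∧ 0 < N ∧
    (∀ i x, Module.finrank ℝ (V i x) = k) ∧
    (∀ x, Function.Injective fun i => V i x) ∧
    (∀ i x, Tendsto (fun y => grassDist (V i y) (V i x)) (𝓝 x) (𝓝 0)) ∧
    (∀ x, mapSubspace (M x) '' (Set.range fun i => V i x) = Set.range fun i => V i (shift A x)) ∧
    (∀ x, ∀ y ∈ Wuloc x,
      mapSubspace (Hu x y) '' (Set.range fun i => V i x) = Set.range fun i => V i y) ∧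
    (∀ x, ∀ y ∈ Wsloc x,
      mapSubspace (Hs x y) '' (Set.range fun i => V i x) = Set.range fun i => V i y)

def StronglyIrreducible (M : SFT A → GLd d) (Hs Hu : SFT A → SFT A → GLd d) : Prop :=
  ¬ NotStronglyIrreducible M Hs Hu

/-- The projective action `[v] ↦ [g v]` of an invertible operator. -/
def projMap (g : GLd d) : Proj d → Proj d :=
  Projectivization.map (g.1 : Vec d →ₗ[ℝ] Vec d)
    (ContinuousLinearEquiv.unitsEquiv ℝ (Vec d) g).injective

/-- The fibered map `T_P (x, [v]) = (T x, [M(x) v])` on the projective bundle. -/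
def projFibered (M : SFT A → GLd d) (p : SFT A × Proj d) : SFT A × Proj d :=
  (shift A p.1, projMap (M p.1) p.2)

/-- `ν` is a `u`-state for the unstable holonomy `Hu`: it is a probability measure on the projective
bundle which projects to `μ`, and the measures `ν_x` in its disintegration `ν = μ ⊗ ν_x` are
`μ`-almost surely invariant under the unstable holonomy. -/
def IsUState (μ : Measure (SFT A)) (Hu : SFT A → SFT A → GLd d)
    (ν : Measure (SFT A × Proj d)) : Prop :=
  IsProbabilityMeasure ν ∧ ν.map Prod.fst = μ ∧
  ∃ κ : Kernel (SFT A) (Proj d), IsMarkovKernel κ ∧ ν = μ ⊗ₘ κ ∧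
    ∃ S : Set (SFT A), S ∈ ae μ ∧
      ∀ x ∈ S, ∀ y ∈ S, y ∈ Wuloc x → (κ x).map (projMap (Hu x y)) = κ y

/-- An invariant `u`-state: a `u`-state which is invariant under the fibered projective map. -/
def IsInvariantUState (μ : Measure (SFT A)) (M : SFT A → GLd d) (Hu : SFT A → SFT A → GLd d)
    (ν : Measure (SFT A × Proj d)) : Prop :=
  IsUState μ Hu ν ∧ MeasurePreserving (projFibered M) ν ν

end Cocycle

end SFTCocycle

end

/-!
Two vectors which both grow at rate `λ₁` in the past span parallelograms of zero area, because `M^n`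
expands areas at a rate smaller than `2 λ₁`. So there is almost surely at most one such line.
There is one, since a Krylov–Bogolyubov limit on the projective bundle has mean expansion `λ₁`, and
by Birkhoff's theorem it charges only lines which grow at rate `λ₁` in the past and in the future.

In the trivialization which makes the cocycle locally constant, the conditional measures of a
`u`-state depend only on the past, so by the quasi-Bernoulli property of `μ` the `u`-state is
dominated by a product of a measure on the lines and a measure on the futures, cylinder by cylinder.
The subspaces of minimal dimension whose conditional mass on such cylinders is maximal form a finite
family; it is invariant, hence excluded by strong irreducibility, so no proper subspace has mass. In
particular the subspace of the vectors which grow more slowly than `λ₁` in the future, which depends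
only on the future, is not charged. An invariant `u`-state therefore has mean expansion `λ₁`, and it
lives on the line above.
-/

noncomputable section

namespace SFTCocycle

/-! ### Birkhoff averages -/

section Birkhoff

variable {α : Type*} {T S : α → α} {g : α → ℝ} {K c : ℝ}

/-- The maximal function `max (0, S_1 g, …, S_n g)` of the Birkhoff sums of `g`, in the recursive
form used in Garsia's proof of the maximal ergodic theorem. -/
def birkhoffMax (T : α → α) (g : α → ℝ) : ℕ → α → ℝ
  | 0, _ => 0
  | n + 1, x => max 0 (g x + birkhoffMax T g n (T x))

lemma birkhoffMax_nonneg (n : ℕ) (x : α) : 0 ≤ birkhoffMax T g n x := by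
  cases n with
  | zero => exact le_rfl
  | succ n => exact le_max_left _ _

lemma birkhoffMax_le_succ (n : ℕ) (x : α) : birkhoffMax T g n x ≤ birkhoffMax T g (n + 1) x := by
  induction n generalizing x with
  | zero => exact le_max_left _ _
  | succ n ih => exact max_le_max le_rfl (add_le_add le_rfl (ih (T x)))

lemma birkhoffSum_le_birkhoffMax (n : ℕ) (x : α) :
    birkhoffSum T g n x ≤ birkhoffMax T g n x := by
  induction n generalizing x with
  | zero => exact le_rfl
  | succ n ih =>
    rw [birkhoffSum_succ']
    exact (add_le_add le_rfl (ih (T x))).trans (le_max_right _ _)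

lemma exists_birkhoffSum_eq_birkhoffMax (n : ℕ) (x : α) :
    ∃ k, birkhoffSum T g k x = birkhoffMax T g n x := by
  induction n generalizing x with
  | zero => exact ⟨0, rfl⟩
  | succ n ih =>
    rcases max_choice 0 (g x + birkhoffMax T g n (T x)) with h | h
    · exact ⟨0, h.symm⟩
    · obtain ⟨k, hk⟩ := ih (T x)
      exact ⟨k + 1, by rw [birkhoffSum_succ', hk]; exact h.symm⟩

lemma setOf_exists_birkhoffSum_pos :
    {x | ∃ n, 0 < birkhoffSum T g n x} = ⋃ n, {x | 0 < birkhoffMax T g n x} := by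
  ext x
  simp only [Set.mem_iUnion, Set.mem_ofPred_eq]
  constructor
  · rintro ⟨n, hn⟩
    exact ⟨n, hn.trans_le (birkhoffSum_le_birkhoffMax n x)⟩
  · rintro ⟨n, hn⟩
    obtain ⟨k, hk⟩ := exists_birkhoffSum_eq_birkhoffMax (T := T) (g := g) n x
    exact ⟨k, hk ▸ hn⟩

lemma birkhoffMax_sub_le_indicator (n : ℕ) (x : α) :
    birkhoffMax T g n x - birkhoffMax T g n (T x) ≤
      {x | 0 < birkhoffMax T g n x}.indicator g x := by
  rcases (birkhoffMax_nonneg (T := T) (g := g) n x).eq_or_lt with h | h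
  · rw [Set.indicator_of_notMem (by simp [← h]), ← h, zero_sub, neg_nonpos]
    exact birkhoffMax_nonneg n (T x)
  · rw [Set.indicator_of_mem (by exact h)]
    cases n with
    | zero => exact absurd h (lt_irrefl _)
    | succ n =>
      have hx : birkhoffMax T g (n + 1) x = g x + birkhoffMax T g n (T x) :=
        max_eq_right_of_lt ((lt_max_iff.1 h).resolve_left (lt_irrefl _))
      linarith [birkhoffMax_le_succ (T := T) (g := g) n (T x)]

lemma abs_birkhoffSum_le (hg : ∀ x, |g x| ≤ K) (n : ℕ) (x : α) : |birkhoffSum T g n x| ≤ n * K :=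
  (Finset.abs_sum_le_sum_abs _ _).trans <|
    (Finset.sum_le_card_nsmul _ _ K fun _ _ => hg _).trans_eq (by simp)

lemma abs_birkhoffAverage_le (hg : ∀ x, |g x| ≤ K) (n : ℕ) (x : α) :
    |birkhoffAverage ℝ T g n x| ≤ K := by
  rw [birkhoffAverage, smul_eq_mul, abs_mul, abs_inv, Nat.abs_cast]
  rcases n.eq_zero_or_pos with rfl | hn
  · simpa using (abs_nonneg _).trans (hg x)
  · rw [inv_mul_le_iff₀ (by exact_mod_cast hn)]
    exact abs_birkhoffSum_le hg n x

lemma birkhoffSum_birkhoffSum_comm (n N : ℕ) (x : α) :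
    birkhoffSum T (birkhoffSum T g N) n x = birkhoffSum T (birkhoffSum T g n) N x := by
  simp only [birkhoffSum, ← Function.iterate_add_apply]
  rw [Finset.sum_comm]
  simp only [add_comm]

lemma abs_birkhoffSum_iterate_sub_le (hg : ∀ x, |g x| ≤ K) (n j : ℕ) (x : α) :
    |birkhoffSum T g n (T^[j] x) - birkhoffSum T g n x| ≤ 2 * j * K := by
  have hadd : birkhoffSum T g j x + birkhoffSum T g n (T^[j] x) =
      birkhoffSum T g n x + birkhoffSum T g j (T^[n] x) := by
    rw [← birkhoffSum_add, ← birkhoffSum_add, add_comm]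
  calc |birkhoffSum T g n (T^[j] x) - birkhoffSum T g n x|
      = |birkhoffSum T g j (T^[n] x) - birkhoffSum T g j x| := by congr 1; linarith
    _ ≤ |birkhoffSum T g j (T^[n] x)| + |birkhoffSum T g j x| := abs_sub _ _
    _ ≤ 2 * j * K := by
      linarith [abs_birkhoffSum_le (T := T) hg j x, abs_birkhoffSum_le (T := T) hg j (T^[n] x)]

lemma abs_birkhoffSum_birkhoffAverage_sub_le (hg : ∀ x, |g x| ≤ K) (n : ℕ) {N : ℕ} (hN : N ≠ 0)
    (x : α) :
    |birkhoffSum T (birkhoffAverage ℝ T g N) n x - birkhoffSum T g n x| ≤ 2 * N * K := by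
  have hN' : (0 : ℝ) < N := by positivity
  have hK : 0 ≤ K := (abs_nonneg _).trans (hg x)
  have hsum : birkhoffSum T (birkhoffAverage ℝ T g N) n x - birkhoffSum T g n x =
      (N : ℝ)⁻¹ * ∑ j ∈ Finset.range N, (birkhoffSum T g n (T^[j] x) - birkhoffSum T g n x) := by
    have hcomm := birkhoffSum_birkhoffSum_comm (T := T) (g := g) n N x
    simp only [birkhoffSum, birkhoffAverage, smul_eq_mul, ← Finset.mul_sum,
      Finset.sum_sub_distrib, Finset.sum_const, Finset.card_range, nsmul_eq_mul] at hcomm ⊢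
    rw [hcomm]
    field_simp
  rw [hsum, abs_mul, abs_inv, Nat.abs_cast, inv_mul_le_iff₀ hN']
  calc |∑ j ∈ Finset.range N, (birkhoffSum T g n (T^[j] x) - birkhoffSum T g n x)|
      ≤ ∑ j ∈ Finset.range N, |birkhoffSum T g n (T^[j] x) - birkhoffSum T g n x| :=
        Finset.abs_sum_le_sum_abs _ _
    _ ≤ ∑ _j ∈ Finset.range N, 2 * (N : ℝ) * K := Finset.sum_le_sum fun j hj =>
        (abs_birkhoffSum_iterate_sub_le hg n j x).trans (by
          have : j ≤ N := (Finset.mem_range.1 hj).le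
          gcongr)
    _ = N * (2 * N * K) := by simp

lemma abs_birkhoffAverage_sub_le (hg : ∀ x, |g x| ≤ K) (c : ℝ) {n N : ℕ} (hn : n ≠ 0)
    (hN : N ≠ 0) (x : α) :
    |birkhoffAverage ℝ T g n x - c| ≤
      birkhoffAverage ℝ T (fun x => |birkhoffAverage ℝ T g N x - c|) n x + 2 * N * K / n := by
  have hn' : (0 : ℝ) < n := by positivity
  have havg : |birkhoffSum T (birkhoffAverage ℝ T g N) n x - n * c| ≤
      birkhoffSum T (fun x => |birkhoffAverage ℝ T g N x - c|) n x := by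
    have : birkhoffSum T (birkhoffAverage ℝ T g N) n x - n * c =
        ∑ j ∈ Finset.range n, (birkhoffAverage ℝ T g N (T^[j] x) - c) := by
      simp [birkhoffSum, Finset.sum_sub_distrib]
    rw [this]
    exact Finset.abs_sum_le_sum_abs _ _
  have htri := abs_sub_le (birkhoffSum T g n x) (birkhoffSum T (birkhoffAverage ℝ T g N) n x)
    (n * c)
  rw [abs_sub_comm (birkhoffSum T g n x) (birkhoffSum T (birkhoffAverage ℝ T g N) n x)] at htri
  have hle := htri.trans (add_le_add (abs_birkhoffSum_birkhoffAverage_sub_le hg n hN x) havg)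
  calc |birkhoffAverage ℝ T g n x - c| = |birkhoffSum T g n x - n * c| / n := by
        rw [← abs_of_pos hn', ← abs_div, abs_of_pos hn', birkhoffAverage, smul_eq_mul]
        congr 1
        field_simp
    _ ≤ (2 * N * K + birkhoffSum T (fun x => |birkhoffAverage ℝ T g N x - c|) n x) / n := by
        gcongr
    _ = _ := by rw [birkhoffAverage, smul_eq_mul]; ring

lemma birkhoffSum_iterate_leftInverse (hTS : Function.LeftInverse T S) (n : ℕ) (x : α) :
    birkhoffSum T g n (S^[n] x) = birkhoffSum S (g ∘ S) n x := by
  induction n with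
  | zero => rfl
  | succ n ih =>
    rw [birkhoffSum_succ' T g, birkhoffSum_succ S (g ∘ S), ← ih, Function.iterate_succ_apply' S n x,
      hTS, add_comm]
    rfl

lemma birkhoffSum_sub_const (n : ℕ) (c : ℝ) (x : α) :
    birkhoffSum T (fun x => g x - c) n x = birkhoffSum T g n x - n * c := by
  simp [birkhoffSum, Finset.sum_sub_distrib]

variable [MeasurableSpace α] {μ : Measure α}

lemma measurePreserving_of_leftInverse (hT : MeasurePreserving T μ μ) (hS : Measurable S)
    (hST : Function.LeftInverse S T) : MeasurePreserving S μ μ := by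
  refine ⟨hS, ?_⟩
  conv_lhs => rw [← hT.map_eq]
  rw [Measure.map_map hS hT.measurable, hST.comp_eq_id, Measure.map_id]

lemma measurable_birkhoffAverage (hT : Measurable T) (hg : Measurable g) (n : ℕ) :
    Measurable (birkhoffAverage ℝ T g n) :=
  (Finset.measurable_sum _ fun k _ => hg.comp (hT.iterate k)).const_smul (n : ℝ)⁻¹

lemma integrable_birkhoffMax (hT : MeasurePreserving T μ μ) (hg : Integrable g μ) (n : ℕ) :
    Integrable (birkhoffMax T g n) μ := by
  induction n with
  | zero => exact integrable_zero _ _ _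
  | succ n ih => exact (integrable_zero _ _ _).sup (hg.add (hT.integrable_comp_of_integrable ih))

/-- **The maximal ergodic theorem** -/
theorem setIntegral_exists_birkhoffSum_pos_nonneg (hT : MeasurePreserving T μ μ)
    (hg : Integrable g μ) : 0 ≤ ∫ x in {x | ∃ n, 0 < birkhoffSum T g n x}, g x ∂μ := by
  have hInt := integrable_birkhoffMax hT hg
  have hmeas : ∀ n, NullMeasurableSet {x | 0 < birkhoffMax T g n x} μ := fun n =>
    nullMeasurableSet_lt aemeasurable_const (hInt n).aemeasurable
  have hmono : Monotone fun n => {x | 0 < birkhoffMax T g n x} :=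
    monotone_nat_of_le_succ fun n x (hx : 0 < _) => hx.trans_le (birkhoffMax_le_succ n x)
  rw [setOf_exists_birkhoffSum_pos]
  refine ge_of_tendsto' (tendsto_setIntegral_of_monotone₀ hmeas hmono hg.integrableOn) fun n => ?_
  have hcomp : Integrable (fun x => birkhoffMax T g n (T x)) μ :=
    hT.integrable_comp_of_integrable (hInt n)
  have hzero : ∫ x, (birkhoffMax T g n x - birkhoffMax T g n (T x)) ∂μ = 0 := by
    have hmap := integral_map hT.aemeasurable (hT.map_eq.symm ▸ (hInt n).aestronglyMeasurable)
    rw [hT.map_eq] at hmap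
    rw [integral_sub (hInt n) hcomp, hmap, sub_self]
  refine hzero.symm.le.trans ?_
  rw [← integral_indicator₀ (hmeas n)]
  exact integral_mono ((hInt n).sub hcomp) (hg.indicator₀ (hmeas n))
    (birkhoffMax_sub_le_indicator n)

theorem le_integral_of_ae_exists_lt_birkhoffSum [IsProbabilityMeasure μ]
    (hT : MeasurePreserving T μ μ) (hg : Integrable g μ)
    (h : ∀ᵐ x ∂μ, ∃ n : ℕ, n * c < birkhoffSum T g n x) : c ≤ ∫ x, g x ∂μ := by
  have hmax := setIntegral_exists_birkhoffSum_pos_nonneg hT (hg.sub (integrable_const c))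
  simp only [Pi.sub_def, birkhoffSum_sub_const, sub_pos] at hmax
  rw [setIntegral_congr_set (t := Set.univ) (eventuallyEq_univ.2 h), setIntegral_univ,
    integral_sub hg (integrable_const c)] at hmax
  simpa using hmax

theorem measure_exists_lt_birkhoffSum_le [IsFiniteMeasure μ] (hT : MeasurePreserving T μ μ)
    (hg : Integrable g μ) (hg0 : ∀ x, 0 ≤ g x) (hc : 0 < c) :
    μ {x | ∃ n : ℕ, n * c < birkhoffSum T g n x} ≤ ENNReal.ofReal ((∫ x, g x ∂μ) / c) := by
  have hmax := setIntegral_exists_birkhoffSum_pos_nonneg hT (hg.sub (integrable_const c))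
  simp only [Pi.sub_def, birkhoffSum_sub_const, sub_pos] at hmax
  rw [integral_sub hg.integrableOn (integrable_const c).integrableOn, setIntegral_const,
    smul_eq_mul, sub_nonneg] at hmax
  rw [← ofReal_measureReal]
  exact ENNReal.ofReal_le_ofReal ((le_div_iff₀ hc).2
    (hmax.trans (setIntegral_le_integral hg (ae_of_all _ hg0))))

lemma integrable_of_abs_le [IsFiniteMeasure μ] (hg : Measurable g) (hK : ∀ x, |g x| ≤ K) :
    Integrable g μ :=
  Integrable.of_bound hg.aestronglyMeasurable K (ae_of_all _ hK)

lemma integral_birkhoffAverage (hT : MeasurePreserving T μ μ) (hg : Integrable g μ) {n : ℕ}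
    (hn : n ≠ 0) : ∫ x, birkhoffAverage ℝ T g n x ∂μ = ∫ x, g x ∂μ := by
  have hterm : ∀ k, ∫ x, g (T^[k] x) ∂μ = ∫ x, g x ∂μ := fun k => by
    have hmap := integral_map (hT.iterate k).aemeasurable
      ((hT.iterate k).map_eq.symm ▸ hg.aestronglyMeasurable)
    rw [(hT.iterate k).map_eq] at hmap
    exact hmap.symm
  have hn' : (n : ℝ) ≠ 0 := by exact_mod_cast hn
  simp only [birkhoffAverage, birkhoffSum]
  have hi : ∀ k, Integrable (fun x => g (T^[k] x)) μ := fun k =>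
    (hT.iterate k).integrable_comp_of_integrable hg
  rw [integral_smul, integral_finsetSum _ fun k _ => hi k]
  simp [hterm, hn']

lemma measure_not_eventually_abs_birkhoffAverage_sub_le [IsFiniteMeasure μ]
    (hT : MeasurePreserving T μ μ) (hg : Measurable g) (hgK : ∀ x, |g x| ≤ K) {ε : ℝ}
    (hε : 0 < ε) {N : ℕ} (hN : N ≠ 0) :
    μ {x | ¬ ∀ᶠ n in atTop, |birkhoffAverage ℝ T g n x - c| ≤ 2 * ε} ≤
      ENNReal.ofReal ((∫ x, |birkhoffAverage ℝ T g N x - c| ∂μ) / ε) := by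
  have hInt : Integrable (fun x => |birkhoffAverage ℝ T g N x - c|) μ :=
    ((integrable_of_abs_le (measurable_birkhoffAverage hT.measurable hg N)
      (abs_birkhoffAverage_le hgK N)).sub (integrable_const c)).abs
  refine (measure_mono fun x hx => ?_).trans
    (measure_exists_lt_birkhoffSum_le hT hInt (fun _ => abs_nonneg _) hε)
  by_contra! hle
  simp only [Set.mem_ofPred_eq, not_exists, not_lt] at hle
  refine hx ?_
  have hsmall : Tendsto (fun n : ℕ => 2 * N * K / n) atTop (𝓝 0) :=
    tendsto_const_div_atTop_nhds_zero_nat _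
  filter_upwards [hsmall.eventually_le_const hε, eventually_ne_atTop 0] with n hn hn0
  have havg : birkhoffAverage ℝ T (fun x => |birkhoffAverage ℝ T g N x - c|) n x ≤ ε := by
    rw [birkhoffAverage, smul_eq_mul, inv_mul_le_iff₀ (by positivity)]
    exact hle n
  linarith [abs_birkhoffAverage_sub_le (T := T) hgK c hn0 hN x]

theorem ae_tendsto_birkhoffAverage_of_tendsto_integral [IsFiniteMeasure μ]
    (hT : MeasurePreserving T μ μ) (hg : Measurable g) (hgK : ∀ x, |g x| ≤ K)
    (h : Tendsto (fun n => ∫ x, |birkhoffAverage ℝ T g n x - c| ∂μ) atTop (𝓝 0)) :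
    ∀ᵐ x ∂μ, Tendsto (fun n => birkhoffAverage ℝ T g n x) atTop (𝓝 c) := by
  have hclose : ∀ ε : ℝ, 0 < ε →
      ∀ᵐ x ∂μ, ∀ᶠ n in atTop, |birkhoffAverage ℝ T g n x - c| ≤ 2 * ε := fun ε hε => by
    have hlim := ENNReal.tendsto_ofReal (h.div_const ε)
    rw [zero_div, ENNReal.ofReal_zero] at hlim
    refine ae_iff.2 (le_antisymm (ge_of_tendsto hlim ?_) zero_le)
    filter_upwards [eventually_ne_atTop 0] with N hN
    exact measure_not_eventually_abs_birkhoffAverage_sub_le hT hg hgK hε hN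
  have hall : ∀ᵐ x ∂μ, ∀ k : ℕ, ∀ᶠ n in atTop,
      |birkhoffAverage ℝ T g n x - c| ≤ 2 * (1 / (k + 1)) :=
    ae_all_iff.2 fun k => hclose _ (by positivity)
  filter_upwards [hall] with x hx
  rw [Metric.tendsto_nhds]
  intro ε hε
  obtain ⟨k, hk⟩ := exists_nat_one_div_lt (half_pos hε)
  filter_upwards [hx k] with n hn
  rw [Real.dist_eq]
  linarith

lemma tendsto_integral_abs_birkhoffAverage_sub [IsProbabilityMeasure μ]
    (hT : MeasurePreserving T μ μ) (hg : Measurable g) (hgK : ∀ x, |g x| ≤ K)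
    (hInt : c ≤ ∫ x, g x ∂μ)
    (hle : ∀ᵐ x ∂μ, ∀ a > c, ∀ᶠ n in atTop, birkhoffAverage ℝ T g n x ≤ a) :
    Tendsto (fun n => ∫ x, |birkhoffAverage ℝ T g n x - c| ∂μ) atTop (𝓝 0) := by
  have hm := measurable_birkhoffAverage hT.measurable hg
  have hi : ∀ n, Integrable (fun x => birkhoffAverage ℝ T g n x - c) μ := fun n =>
    (integrable_of_abs_le (hm n) (abs_birkhoffAverage_le hgK n)).sub (integrable_const c)
  have hpos : Tendsto (fun n => ∫ x, (birkhoffAverage ℝ T g n x - c)⁺ ∂μ) atTop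
      (𝓝 (∫ _, (0 : ℝ) ∂μ)) := by
    refine tendsto_integral_of_dominated_convergence (fun _ => K + |c|)
      (fun n => (hi n).pos_part.aestronglyMeasurable) (integrable_const _)
      (fun n => ae_of_all _ fun x => ?_) ?_
    · rw [Real.norm_eq_abs, abs_of_nonneg (posPart_nonneg _)]
      exact (max_le (le_abs_self _) (abs_nonneg _)).trans
        ((abs_sub _ _).trans (add_le_add (abs_birkhoffAverage_le hgK n x) le_rfl))
    · filter_upwards [hle] with x hx
      refine tendsto_order.2 ⟨fun a ha => Eventually.of_forall fun n =>
        ha.trans_le (posPart_nonneg _), fun a ha => ?_⟩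
      filter_upwards [hx (c + a / 2) (by linarith)] with n hn
      exact max_lt (by linarith) ha
  have hlim := hpos.const_mul 2
  rw [integral_zero, mul_zero] at hlim
  refine squeeze_zero' (Eventually.of_forall fun n => integral_nonneg fun x => abs_nonneg _) ?_ hlim
  filter_upwards [eventually_ne_atTop 0] with n hn
  have hmean : 0 ≤ ∫ x, (birkhoffAverage ℝ T g n x - c) ∂μ := by
    rw [integral_sub (integrable_of_abs_le (hm n) (abs_birkhoffAverage_le hgK n))
      (integrable_const c), integral_birkhoffAverage hT (integrable_of_abs_le hg hgK) hn]
    simpa using hInt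
  have habs : ∀ t : ℝ, |t| = 2 * t⁺ - t := fun t => by
    rcases le_total 0 t with h | h
    · rw [abs_of_nonneg h, posPart_of_nonneg h]; ring
    · rw [abs_of_nonpos h, posPart_of_nonpos h]; ring
  simp only [habs]
  have hipos : Integrable (fun x => (birkhoffAverage ℝ T g n x - c)⁺) μ := (hi n).pos_part
  rw [integral_sub (hipos.const_mul 2) (hi n), integral_const_mul]
  exact sub_le_self _ hmean

/-- A form of Birkhoff's theorem which needs no ergodicity: an almost sure upper bound of the upper
limit by the mean is enough. -/
theorem ae_tendsto_birkhoffAverage_of_eventually_le [IsProbabilityMeasure μ]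
    (hT : MeasurePreserving T μ μ) (hg : Measurable g) (hgK : ∀ x, |g x| ≤ K)
    (hInt : c ≤ ∫ x, g x ∂μ)
    (hle : ∀ᵐ x ∂μ, ∀ a > c, ∀ᶠ n in atTop, birkhoffAverage ℝ T g n x ≤ a) :
    ∀ᵐ x ∂μ, Tendsto (fun n => birkhoffAverage ℝ T g n x) atTop (𝓝 c) :=
  ae_tendsto_birkhoffAverage_of_tendsto_integral hT hg hgK
    (tendsto_integral_abs_birkhoffAverage_sub hT hg hgK hInt hle)

theorem ae_tendsto_birkhoffAverage_iterate_leftInverse [IsProbabilityMeasure μ]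
    (hT : MeasurePreserving T μ μ) (hS : MeasurePreserving S μ μ)
    (hTS : Function.LeftInverse T S) (hg : Measurable g) (hgK : ∀ x, |g x| ≤ K)
    (hInt : c ≤ ∫ x, g x ∂μ)
    (hle : ∀ᵐ x ∂μ, ∀ a > c, ∀ᶠ n in atTop, birkhoffAverage ℝ T g n x ≤ a) :
    ∀ᵐ x ∂μ, Tendsto (fun n => birkhoffAverage ℝ T g n (S^[n] x)) atTop (𝓝 c) := by
  have havg : ∀ n x, birkhoffAverage ℝ T g n (S^[n] x) = birkhoffAverage ℝ S (g ∘ S) n x :=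
    fun n x => by rw [birkhoffAverage, birkhoffAverage, birkhoffSum_iterate_leftInverse hTS]
  have hmean : ∀ n, ∫ x, |birkhoffAverage ℝ S (g ∘ S) n x - c| ∂μ =
      ∫ x, |birkhoffAverage ℝ T g n x - c| ∂μ := fun n => by
    have hmap := integral_map (hS.iterate n).aemeasurable (μ := μ)
      (((measurable_birkhoffAverage hT.measurable hg n).sub_const c).abs.aestronglyMeasurable)
    rw [(hS.iterate n).map_eq] at hmap
    simp only [hmap, havg]
  simp only [havg]
  refine ae_tendsto_birkhoffAverage_of_tendsto_integral hS (hg.comp hS.measurable)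
    (fun x => hgK (S x)) ?_
  simp only [hmean]
  exact tendsto_integral_abs_birkhoffAverage_sub hT hg hgK hInt hle

end Birkhoff

section GramDet

variable {E : Type*} [NormedAddCommGroup E] [InnerProductSpace ℝ E] {u v : E}

/-- The Gram determinant of two vectors: the square of the area of the parallelogram they span. -/
def gramDet (u v : E) : ℝ := ‖u‖ ^ 2 * ‖v‖ ^ 2 - inner ℝ u v ^ 2

lemma gramDet_le (u v : E) : gramDet u v ≤ ‖u‖ ^ 2 * ‖v‖ ^ 2 :=
  sub_le_self _ (sq_nonneg _)

lemma gramDet_nonneg (u v : E) : 0 ≤ gramDet u v := by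
  rw [gramDet, ← mul_pow, sub_nonneg]
  exact sq_le_sq.2 ((abs_real_inner_le_norm u v).trans (le_abs_self _))

lemma mem_span_singleton_of_gramDet_eq_zero (hu : u ≠ 0) (h : gramDet u v = 0) :
    v ∈ Submodule.span ℝ {u} := by
  have _ : ‖u‖ ^ 2 ≠ 0 := by positivity
  refine Submodule.mem_span_singleton.2 ⟨inner ℝ u v / ‖u‖ ^ 2, ?_⟩
  rw [← sub_eq_zero, ← norm_eq_zero, ← sq_eq_zero_iff, norm_sub_sq_real, norm_smul, mul_pow,
    Real.norm_eq_abs, sq_abs, real_inner_smul_left]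
  unfold gramDet at h
  field_simp
  linear_combination h

lemma lagrange_identity {ι : Type*} [Fintype ι] (s a b : ι → ℝ) :
    ∑ i, ∑ j, s i * s j * (a i * b j - a j * b i) ^ 2 =
      2 * ((∑ i, s i * a i ^ 2) * (∑ i, s i * b i ^ 2) - (∑ i, s i * (a i * b i)) ^ 2) := by
  have hterm : ∀ i j, s i * s j * (a i * b j - a j * b i) ^ 2 =
      (s i * a i ^ 2) * (s j * b j ^ 2) + (s i * b i ^ 2) * (s j * a j ^ 2)
        - 2 * ((s i * (a i * b i)) * (s j * (a j * b j))) := fun i j => by ring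
  simp only [hterm, Finset.sum_sub_distrib, Finset.sum_add_distrib, ← Finset.mul_sum,
    ← Finset.sum_mul]
  ring

lemma two_mul_gramDet_eq_sum {ι : Type*} [Fintype ι] (b : OrthonormalBasis ι ℝ E) (u v : E) :
    2 * gramDet u v = ∑ i, ∑ j, (b.repr u i * b.repr v j - b.repr u j * b.repr v i) ^ 2 := by
  have h := lagrange_identity (fun _ : ι => 1) (b.repr u) (b.repr v)
  simp only [one_mul] at h
  rw [h, gramDet, ← b.repr.norm_map u, ← b.repr.norm_map v, ← b.repr.inner_map_map u v,
    EuclideanSpace.real_norm_sq_eq, EuclideanSpace.real_norm_sq_eq, PiLp.inner_apply]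
  simp [mul_comm]

end GramDet

section SingularValues

variable {E F : Type*} [NormedAddCommGroup E] [InnerProductSpace ℝ E] [FiniteDimensional ℝ E]
  [NormedAddCommGroup F] [InnerProductSpace ℝ F] [FiniteDimensional ℝ F]

open Module

lemma exists_orthonormalBasis_inner_map (T : E →ₗ[ℝ] F) :
    ∃ b : OrthonormalBasis (Fin (finrank ℝ E)) ℝ E, ∀ u v : E,
      inner ℝ (T u) (T v) =
        ∑ i : Fin (finrank ℝ E), T.singularValues i ^ 2 * (b.repr u i * b.repr v i) := by
  set b := T.isSymmetric_adjoint_comp_self.eigenvectorBasis rfl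
  refine ⟨b, fun u v => ?_⟩
  rw [show inner ℝ (T u) (T v) = inner ℝ u ((LinearMap.adjoint T ∘ₗ T) v) by
    rw [LinearMap.comp_apply, LinearMap.adjoint_inner_right], ← b.repr.inner_map_map,
    PiLp.inner_apply]
  refine Finset.sum_congr rfl fun i _ => ?_
  rw [T.isSymmetric_adjoint_comp_self.eigenvectorBasis_apply_self_apply rfl,
    T.sq_singularValues_fin rfl]
  simp only [RCLike.inner_apply, conj_trivial, RCLike.ofReal_real_eq_id, id_eq]
  ring

lemma singularValues_mul_le (T : E →ₗ[ℝ] F) {i j : ℕ} (hij : i ≠ j) :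
    T.singularValues i * T.singularValues j ≤ T.singularValues 0 * T.singularValues 1 := by
  have hanti := T.singularValues_antitone
  wlog h : i < j generalizing i j
  · rw [mul_comm]
    exact this hij.symm (by omega)
  · exact mul_le_mul (hanti i.zero_le) (hanti (by omega)) (T.singularValues_nonneg _)
      (T.singularValues_nonneg _)

lemma gramDet_map_le (T : E →ₗ[ℝ] F) (u v : E) :
    gramDet (T u) (T v) ≤ (T.singularValues 0 * T.singularValues 1) ^ 2 * gramDet u v := by
  obtain ⟨b, hb⟩ := exists_orthonormalBasis_inner_map T
  have hmap : 2 * gramDet (T u) (T v) = ∑ i : Fin (finrank ℝ E), ∑ j : Fin (finrank ℝ E),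
      T.singularValues i ^ 2 * T.singularValues j ^ 2 *
      (b.repr u i * b.repr v j - b.repr u j * b.repr v i) ^ 2 := by
    rw [lagrange_identity (fun i : Fin (finrank ℝ E) => T.singularValues i ^ 2), gramDet,
      ← real_inner_self_eq_norm_sq, ← real_inner_self_eq_norm_sq, hb, hb, hb]
    simp only [sq]
  suffices h : 2 * gramDet (T u) (T v) ≤
      (T.singularValues 0 * T.singularValues 1) ^ 2 * (2 * gramDet u v) by linarith
  rw [hmap, two_mul_gramDet_eq_sum b, Finset.mul_sum]
  refine Finset.sum_le_sum fun i _ => ?_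
  rw [Finset.mul_sum]
  refine Finset.sum_le_sum fun j _ => ?_
  rcases eq_or_ne i j with rfl | hij
  · simp
  · refine mul_le_mul_of_nonneg_right ?_ (sq_nonneg _)
    rw [← mul_pow]
    exact pow_le_pow_left₀ (mul_nonneg (T.singularValues_nonneg _) (T.singularValues_nonneg _))
      (singularValues_mul_le T (Fin.val_ne_of_ne hij)) 2

lemma norm_map_le_singularValues_zero (T : E →ₗ[ℝ] F) (v : E) :
    ‖T v‖ ≤ T.singularValues 0 * ‖v‖ := by
  obtain ⟨b, hb⟩ := exists_orthonormalBasis_inner_map T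
  refine le_of_sq_le_sq ?_ (mul_nonneg (T.singularValues_nonneg 0) (norm_nonneg _))
  rw [← real_inner_self_eq_norm_sq, hb, mul_pow, ← b.repr.norm_map v,
    EuclideanSpace.real_norm_sq_eq, Finset.mul_sum]
  refine Finset.sum_le_sum fun i _ => ?_
  rw [← sq (b.repr v i)]
  exact mul_le_mul_of_nonneg_right (pow_le_pow_left₀ (T.singularValues_nonneg _)
    (T.singularValues_antitone (Nat.zero_le _)) 2) (sq_nonneg _)

lemma exists_norm_map_eq_singularValues_zero [Nontrivial E] (T : E →ₗ[ℝ] F) :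
    ∃ r : E, ‖r‖ = 1 ∧ ‖T r‖ = T.singularValues 0 := by
  obtain ⟨b, hb⟩ := exists_orthonormalBasis_inner_map T
  let i₀ : Fin (finrank ℝ E) := ⟨0, finrank_pos⟩
  refine ⟨b i₀, b.orthonormal.1 i₀, ?_⟩
  rw [← sq_eq_sq₀ (norm_nonneg _) (T.singularValues_nonneg 0), ← real_inner_self_eq_norm_sq, hb]
  simp [i₀]

lemma singularValues_zero_eq_opNorm [Nontrivial E] (g : E →L[ℝ] F) :
    (g : E →ₗ[ℝ] F).singularValues 0 = ‖g‖ := by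
  obtain ⟨r, hr, hgr⟩ := exists_norm_map_eq_singularValues_zero (g : E →ₗ[ℝ] F)
  refine le_antisymm ?_ (g.opNorm_le_bound (LinearMap.singularValues_nonneg _ 0)
    (norm_map_le_singularValues_zero (g : E →ₗ[ℝ] F)))
  rw [← hgr]
  simpa [hr] using g.le_opNorm r

end SingularValues

section ExteriorNorm

variable {d : ℕ}

lemma exteriorNorm_nonneg (i : Fin d) (g : GLd d) : 0 ≤ exteriorNorm i g :=
  Finset.prod_nonneg fun _ _ => LinearMap.singularValues_nonneg _ _

variable [NeZero d]

lemma exteriorNorm_zero (g : GLd d) : exteriorNorm 0 g = ‖g.1‖ := by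
  have hIic : Finset.Iic (0 : Fin d) = {0} := by ext i; simp
  rw [exteriorNorm, hIic, Finset.prod_singleton, Fin.val_zero, singularValues_zero_eq_opNorm]

lemma Iic_eq_pair {i : Fin d} (hi : (i : ℕ) = 1) : Finset.Iic i = {0, i} := by
  ext j
  simp only [Finset.mem_Iic, Finset.mem_insert, Finset.mem_singleton, Fin.ext_iff, Fin.le_def, hi,
    Fin.val_zero]
  omega

lemma zero_ne_of_val_eq_one {i : Fin d} (hi : (i : ℕ) = 1) : 0 ≠ i := by
  rintro rfl
  simp at hi

lemma gramDet_map_le_exteriorNorm {i : Fin d} (hi : (i : ℕ) = 1) (g : GLd d) (u v : Vec d) :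
    gramDet (g.1 u) (g.1 v) ≤ exteriorNorm i g ^ 2 * gramDet u v := by
  rw [exteriorNorm, Iic_eq_pair hi, Finset.prod_pair (zero_ne_of_val_eq_one hi), hi, Fin.val_zero]
  exact gramDet_map_le (g.1 : Vec d →ₗ[ℝ] Vec d) u v

lemma gramDet_eq_zero_of_dim_le_one (hd : d ≤ 1) (u v : Vec d) : gramDet u v = 0 := by
  obtain rfl : d = 1 := le_antisymm hd NeZero.one_le
  simp [gramDet, EuclideanSpace.norm_sq_eq, PiLp.inner_apply]
  ring

end ExteriorNorm

/-! ### Growth rates along the cocycle -/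

section ExpRate

variable {E F : Type*} [NormedAddCommGroup E] [NormedAddCommGroup F]

/-- The sequence of vectors `w` has exponential growth rate `l`. -/
def HasExpRate (w : ℕ → E) (l : ℝ) : Prop :=
  Tendsto (fun n : ℕ => Real.log ‖w n‖ / n) atTop (𝓝 l)

lemma abs_log_sub_log_le {a b K : ℝ} (ha : 0 ≤ a) (hb : 0 ≤ b) (hab : a ≤ K * b)
    (hba : b ≤ K * a) : |Real.log a - Real.log b| ≤ |Real.log K| := by
  rcases ha.eq_or_lt with rfl | ha
  · rw [hb.antisymm' (by simpa using hba), sub_self, abs_zero]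
    exact abs_nonneg _
  rcases hb.eq_or_lt with rfl | hb
  · exact absurd hab (by simpa using ha)
  have hK : 0 < K := pos_of_mul_pos_left (ha.trans_le hab) hb.le
  have hlog := Real.log_le_log ha hab
  have hlog' := Real.log_le_log hb hba
  rw [Real.log_mul hK.ne' hb.ne'] at hlog
  rw [Real.log_mul hK.ne' ha.ne'] at hlog'
  exact abs_le.2 ⟨by linarith [le_abs_self (Real.log K)], by linarith [le_abs_self (Real.log K)]⟩

lemma HasExpRate.of_comparable {w : ℕ → E} {z : ℕ → F} {K l : ℝ} (hw : HasExpRate w l)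
    (hwz : ∀ n, ‖w n‖ ≤ K * ‖z n‖) (hzw : ∀ n, ‖z n‖ ≤ K * ‖w n‖) : HasExpRate z l := by
  have hdiff : Tendsto (fun n : ℕ => Real.log ‖z n‖ / n - Real.log ‖w n‖ / n) atTop (𝓝 0) := by
    refine squeeze_zero_norm (fun n => ?_) (tendsto_const_div_atTop_nhds_zero_nat |Real.log K|)
    rw [← sub_div, Real.norm_eq_abs, abs_div, Nat.abs_cast]
    exact div_le_div_of_nonneg_right
      (abs_log_sub_log_le (norm_nonneg _) (norm_nonneg _) (hzw n) (hwz n)) n.cast_nonneg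
  simpa [HasExpRate] using Tendsto.add hw hdiff

lemma HasExpRate.const_smul [NormedSpace ℝ E] {w : ℕ → E} {l : ℝ} (hw : HasExpRate w l) {c : ℝ}
    (hc : c ≠ 0) : HasExpRate (fun n => c • w n) l := by
  refine hw.of_comparable (K := max ‖c‖ ‖c‖⁻¹) (fun n => ?_) fun n => ?_
  · rw [norm_smul, ← mul_assoc]
    refine le_mul_of_one_le_left (norm_nonneg _) ?_
    calc 1 = ‖c‖⁻¹ * ‖c‖ := (inv_mul_cancel₀ (norm_ne_zero_iff.2 hc)).symm
      _ ≤ max ‖c‖ ‖c‖⁻¹ * ‖c‖ := by gcongr; exact le_max_right _ _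
  · rw [norm_smul]
    gcongr
    exact le_max_left _ _

lemma HasExpRate.eventually_norm_le {w : ℕ → E} {l a : ℝ} (hw : HasExpRate w l) (ha : l < a) :
    ∀ᶠ n : ℕ in atTop, ‖w n‖ ≤ Real.exp (n * a) := by
  filter_upwards [hw.eventually_lt_const ha, eventually_gt_atTop 0] with n hn hn0
  rw [div_lt_iff₀ (by exact_mod_cast hn0), mul_comm] at hn
  exact (Real.le_exp_log _).trans (Real.exp_le_exp.2 hn.le)

lemma HasExpRate.le_of_norm_le {w : ℕ → E} {l K c : ℝ} (hw : HasExpRate w l) (hw0 : ∀ n, w n ≠ 0)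
    (h : ∀ n : ℕ, ‖w n‖ ≤ K * Real.exp (n * c)) : l ≤ c := by
  have hK : 0 < K :=
    pos_of_mul_pos_left ((norm_pos_iff.2 (hw0 0)).trans_le (h 0)) (Real.exp_pos _).le
  have hlim : Tendsto (fun n : ℕ => Real.log K / n + c) atTop (𝓝 c) := by
    simpa using (tendsto_const_div_atTop_nhds_zero_nat (Real.log K)).add_const c
  refine le_of_tendsto_of_tendsto hw hlim ?_
  filter_upwards [eventually_gt_atTop 0] with n hn
  have hlog := Real.log_le_log (norm_pos_iff.2 (hw0 n)) (h n)
  rw [Real.log_mul hK.ne' (Real.exp_pos _).ne', Real.log_exp] at hlog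
  rw [div_add' _ _ _ (by positivity)]
  gcongr
  linarith

lemma HasExpRate.of_succ {w : ℕ → E} {l : ℝ} (h : HasExpRate (fun n => w (n + 1)) l) :
    HasExpRate w l := by
  refine (tendsto_add_atTop_iff_nat 1).1 ?_
  have hmul := h.mul (tendsto_natCast_div_add_atTop (1 : ℝ))
  rw [mul_one] at hmul
  refine hmul.congr' ?_
  filter_upwards [eventually_ne_atTop 0] with n hn
  rw [Nat.cast_add_one, div_mul_div_cancel₀ (by exact_mod_cast hn)]

end ExpRate

section Shift

variable {m : ℕ} {A : Fin m → Fin m → Prop}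

lemma isClosed_setOf_allowed (A : Fin m → Fin m → Prop) :
    IsClosed {x : ℤ → Fin m | ∀ i, A (x i) (x (i + 1))} := by
  have hInter : {x : ℤ → Fin m | ∀ i, A (x i) (x (i + 1))} =
      ⋂ i : ℤ, (fun x : ℤ → Fin m => (x i, x (i + 1))) ⁻¹' {p | A p.1 p.2} := by
    ext x; simp
  rw [hInter]
  exact isClosed_iInter fun i => (isClosed_discrete _).preimage (by fun_prop)

instance : CompactSpace (SFT A) :=
  isCompact_iff_compactSpace.1 (isClosed_setOf_allowed A).isCompact

instance : SecondCountableTopology (SFT A) :=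
  Topology.IsEmbedding.subtypeVal.secondCountableTopology

instance : TopologicalSpace.MetrizableSpace (SFT A) :=
  Topology.IsEmbedding.subtypeVal.metrizableSpace

lemma continuous_coord (i : ℤ) : Continuous fun x : SFT A => x.1 i :=
  (continuous_apply i).comp continuous_subtype_val

lemma continuous_shift : Continuous (shift A) :=
  Continuous.subtype_mk (continuous_pi fun i => continuous_coord (i + 1)) _

lemma continuous_shift_symm : Continuous (shift A).symm :=
  Continuous.subtype_mk (continuous_pi fun i => continuous_coord (i - 1)) _

lemma shift_iterate_apply (n : ℕ) (x : SFT A) (i : ℤ) :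
    ((shift A)^[n] x).1 i = x.1 (i + n) := by
  induction n generalizing x with
  | zero => simp
  | succ n ih =>
    rw [Function.iterate_succ_apply, ih, Nat.cast_succ, ← add_assoc]
    rfl

lemma shift_symm_iterate_apply (n : ℕ) (x : SFT A) (i : ℤ) :
    ((shift A).symm^[n] x).1 i = x.1 (i - n) := by
  induction n generalizing x with
  | zero => simp
  | succ n ih =>
    rw [Function.iterate_succ_apply, ih, Nat.cast_succ, ← sub_sub]
    rfl

lemma shift_iterate_symm_iterate (n : ℕ) (x : SFT A) :
    (shift A)^[n] ((shift A).symm^[n] x) = x :=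
  Function.LeftInverse.iterate (shift A).apply_symm_apply n x

lemma measurePreserving_shift_symm {μ : Measure (SFT A)} (hT : MeasurePreserving (shift A) μ μ) :
    MeasurePreserving (shift A).symm μ μ :=
  measurePreserving_of_leftInverse hT continuous_shift_symm.measurable (shift A).symm_apply_apply

end Shift

section Cocycle

variable {m d : ℕ} {A : Fin m → Fin m → Prop} {M N L : SFT A → GLd d}

lemma iterNat_succ (n : ℕ) (x : SFT A) :
    iterNat M (n + 1) x = M ((shift A)^[n] x) * iterNat M n x := rfl

lemma iter_neg_natCast (n : ℕ) (x : SFT A) :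
    iter M (-n) x = (iterNat M n ((shift A).symm^[n] x))⁻¹ := by
  cases n with
  | zero => exact inv_one.symm
  | succ n => rfl

lemma iter_neg_succ_shift (n : ℕ) (x : SFT A) :
    iter M (-(n + 1 : ℕ)) (shift A x) * M x = iter M (-n) x := by
  rw [iter_neg_natCast, iter_neg_natCast, iterNat_succ, Function.iterate_succ_apply,
    Equiv.symm_apply_apply, shift_iterate_symm_iterate, mul_inv_rev, inv_mul_cancel_right]

lemma continuous_iterNat (hM : Continuous M) (n : ℕ) : Continuous (iterNat M n) := by
  induction n with
  | zero => exact continuous_const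
  | succ n ih => exact (hM.comp (continuous_shift.iterate n)).mul ih

lemma iterNat_conj (hN : ∀ x, N x = L (shift A x) * M x * (L x)⁻¹) (n : ℕ) (x : SFT A) :
    iterNat N n x = L ((shift A)^[n] x) * iterNat M n x * (L x)⁻¹ := by
  induction n with
  | zero => simp [iterNat]
  | succ n ih =>
    rw [iterNat_succ, iterNat_succ, ih, hN, Function.iterate_succ_apply']
    group

lemma iter_neg_conj (hN : ∀ x, N x = L (shift A x) * M x * (L x)⁻¹) (n : ℕ) (x : SFT A) :
    iter N (-n) x = L ((shift A).symm^[n] x) * iter M (-n) x * (L x)⁻¹ := by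
  rw [iter_neg_natCast, iter_neg_natCast, iterNat_conj hN, shift_iterate_symm_iterate]
  group

lemma units_mul_apply (g h : GLd d) (v : Vec d) : (g * h).1 v = g.1 (h.1 v) := rfl

lemma units_inv_apply_apply (g : GLd d) (v : Vec d) : g⁻¹.1 (g.1 v) = v := by
  rw [← units_mul_apply, inv_mul_cancel]; rfl

lemma units_apply_inv_apply (g : GLd d) (v : Vec d) : g.1 (g⁻¹.1 v) = v := by
  rw [← units_mul_apply, mul_inv_cancel]; rfl

lemma units_apply_ne_zero (g : GLd d) {v : Vec d} (hv : v ≠ 0) : g.1 v ≠ 0 := fun h =>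
  hv (by rw [← units_inv_apply_apply g v, h, map_zero])

lemma norm_units_apply_pos (g : GLd d) {v : Vec d} (hv : v ≠ 0) : 0 < ‖g.1 v‖ :=
  norm_pos_iff.2 (units_apply_ne_zero g hv)

lemma norm_units_pos [NeZero d] (g : GLd d) : 0 < ‖g.1‖ := norm_pos_iff.2 g.ne_zero

lemma exists_norm_units_le {X : Type*} [TopologicalSpace X] [CompactSpace X] {L : X → GLd d}
    (hL : Continuous L) : ∃ K : ℝ, 1 ≤ K ∧ ∀ x, ‖(L x).1‖ ≤ K ∧ ‖((L x)⁻¹).1‖ ≤ K := by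
  obtain ⟨K₁, h₁⟩ := isCompact_univ.exists_bound_of_continuousOn
    (Units.continuous_val.comp hL).continuousOn
  obtain ⟨K₂, h₂⟩ := isCompact_univ.exists_bound_of_continuousOn
    (Units.continuous_val.comp hL.inv).continuousOn
  exact ⟨max 1 (max K₁ K₂), le_max_left _ _, fun x =>
    ⟨(h₁ x trivial).trans ((le_max_left _ _).trans (le_max_right _ _)),
      (h₂ x trivial).trans ((le_max_right _ _).trans (le_max_right _ _))⟩⟩

lemma norm_units_apply_le {K : ℝ} {g : GLd d} (hg : ‖g.1‖ ≤ K) (v : Vec d) :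
    ‖g.1 v‖ ≤ K * ‖v‖ :=
  g.1.le_of_opNorm_le hg v

lemma norm_le_units_apply {K : ℝ} {g : GLd d} (hg : ‖g⁻¹.1‖ ≤ K) (v : Vec d) :
    ‖v‖ ≤ K * ‖g.1 v‖ := by
  simpa only [units_inv_apply_apply] using norm_units_apply_le hg (g.1 v)

/-- The vector `v` in the fiber at `x` grows at rate `l` in the future. -/
def FwdGrowth (M : SFT A → GLd d) (l : ℝ) (x : SFT A) (v : Vec d) : Prop :=
  HasExpRate (fun n : ℕ => (iter M n x).1 v) l

/-- The vector `v` in the fiber at `x` grows at rate `l` in the past, i.e., `‖M^{-n}(x) v‖` is of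
order `exp (-n l)`. -/
def BwdGrowth (M : SFT A → GLd d) (l : ℝ) (x : SFT A) (v : Vec d) : Prop :=
  HasExpRate (fun n : ℕ => (iter M (-n) x).1 v) (-l)

variable {l : ℝ} {x : SFT A} {v : Vec d}

lemma FwdGrowth.smul (h : FwdGrowth M l x v) {c : ℝ} (hc : c ≠ 0) : FwdGrowth M l x (c • v) := by
  simpa only [FwdGrowth, map_smul] using HasExpRate.const_smul h hc

lemma BwdGrowth.smul (h : BwdGrowth M l x v) {c : ℝ} (hc : c ≠ 0) : BwdGrowth M l x (c • v) := by
  simpa only [BwdGrowth, map_smul] using HasExpRate.const_smul h hc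

lemma tendsto_intCast_iff (f : ℤ → ℝ) :
    (Tendsto f atTop (𝓝 l) ↔ Tendsto (fun n : ℕ => f n) atTop (𝓝 l)) ∧
      (Tendsto f atBot (𝓝 l) ↔ Tendsto (fun n : ℕ => f (-n)) atTop (𝓝 l)) := by
  have hTop : ∀ g : ℤ → ℝ, Tendsto g atTop (𝓝 l) ↔ Tendsto (fun n : ℕ => g n) atTop (𝓝 l) :=
    fun g => by rw [← Nat.map_cast_int_atTop, tendsto_map'_iff]; rfl
  refine ⟨hTop f, ?_⟩
  rw [← hTop fun n => f (-n), ← map_neg_atTop, tendsto_map'_iff]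
  rfl

lemma mem_oseledets_iff :
    v ∈ oseledets M l x ↔ v = 0 ∨ (FwdGrowth M l x v ∧ BwdGrowth M l x v) := by
  have hneg : ∀ f : ℕ → ℝ, Tendsto (fun n : ℕ => f n / ((-(n : ℤ) : ℤ) : ℝ)) atTop (𝓝 l) ↔
      Tendsto (fun n : ℕ => f n / n) atTop (𝓝 (-l)) := fun f => by
    rw [← tendsto_neg_iff]
    simp [div_neg]
  simp only [oseledets, Set.mem_ofPred_eq, tendsto_intCast_iff, hneg]
  rfl

lemma bwdGrowth_conj (hL : Continuous L) (hN : ∀ x, N x = L (shift A x) * M x * (L x)⁻¹) :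
    BwdGrowth N l x ((L x).1 v) ↔ BwdGrowth M l x v := by
  obtain ⟨K, -, hK⟩ := exists_norm_units_le hL
  have hconj : ∀ n : ℕ, (iter N (-n) x).1 ((L x).1 v) =
      (L ((shift A).symm^[n] x)).1 ((iter M (-n) x).1 v) := fun n => by
    rw [iter_neg_conj hN, units_mul_apply, units_inv_apply_apply, units_mul_apply]
  simp only [BwdGrowth, hconj]
  exact ⟨fun h => h.of_comparable (fun n => norm_units_apply_le (hK _).1 _)
      fun n => norm_le_units_apply (hK _).2 _,
    fun h => h.of_comparable (fun n => norm_le_units_apply (hK _).2 _)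
      fun n => norm_units_apply_le (hK _).1 _⟩

lemma BwdGrowth.shift (h : BwdGrowth M l x v) : BwdGrowth M l (shift A x) ((M x).1 v) :=
  HasExpRate.of_succ <| by
    simp only [← units_mul_apply, iter_neg_succ_shift]
    exact h

end Cocycle

/-! ### The projective bundle -/

section ProjectiveSpace

variable {d : ℕ}

lemma isOpenQuotientMap_mk' :
    IsOpenQuotientMap (Projectivization.mk' ℝ : {v : Vec d // v ≠ 0} → Proj d) := by
  have hq : IsQuotientMap (Projectivization.mk' ℝ : {v : Vec d // v ≠ 0} → Proj d) :=
    ⟨⟨rfl⟩, fun p => ⟨⟨p.rep, p.rep_nonzero⟩, p.mk_rep⟩⟩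
  refine ⟨hq.surjective, hq.continuous, fun U hU => ?_⟩
  rw [← hq.isOpen_preimage]
  have : Projectivization.mk' ℝ ⁻¹' (Projectivization.mk' ℝ '' U) =
      ⋃ c : ℝˣ, (fun v : {v : Vec d // v ≠ 0} =>
        (⟨c • v.1, (smul_ne_zero_iff_ne c).2 v.2⟩ : {v : Vec d // v ≠ 0})) ⁻¹' U := by
    ext v
    simp only [Set.mem_preimage, Set.mem_image, Set.mem_iUnion]
    constructor
    · rintro ⟨w, hw, h⟩
      obtain ⟨c, hc⟩ := (Projectivization.mk_eq_mk_iff ℝ _ _ w.2 v.2).1 h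
      exact ⟨c, by convert hw⟩
    · rintro ⟨c, hc⟩
      exact ⟨_, hc, (Projectivization.mk_eq_mk_iff ℝ _ _ _ v.2).2 ⟨c, rfl⟩⟩
  rw [this]
  refine isOpen_iUnion fun c => hU.preimage ?_
  exact Continuous.subtype_mk (continuous_subtype_val.const_smul (c : ℝ)) _

instance : SecondCountableTopology (Proj d) :=
  isOpenQuotientMap_mk'.isQuotientMap.secondCountableTopology isOpenQuotientMap_mk'.isOpenMap

instance : CompactSpace (Proj d) := by
  have hne : ∀ v : Metric.sphere (0 : Vec d) 1, v.1 ≠ 0 := fun v =>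
    ne_zero_of_mem_unit_sphere v
  let π : Metric.sphere (0 : Vec d) 1 → Proj d := fun v => Projectivization.mk ℝ v.1 (hne v)
  have hπ : Continuous π :=
    isOpenQuotientMap_mk'.continuous.comp (continuous_subtype_val.subtype_mk hne)
  refine isCompact_univ_iff.1 ?_
  convert isCompact_range hπ
  refine (Set.range_eq_univ.2 fun p => ?_).symm
  induction p using Projectivization.ind with
  | h v hv =>
    refine ⟨⟨‖v‖⁻¹ • v, by simp [norm_smul, hv]⟩, ?_⟩
    exact (Projectivization.mk_eq_mk_iff' ℝ _ _ _ _).2 ⟨‖v‖⁻¹, rfl⟩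

/-- The `i`-th column of the matrix of the orthogonal projection to the line `p`. -/
def lineVec (i : Fin d) (p : Proj d) : Vec d := (p.rep i / ‖p.rep‖ ^ 2) • p.rep

lemma lineVec_mk (i : Fin d) (v : Vec d) (hv : v ≠ 0) :
    lineVec i (Projectivization.mk ℝ v hv) = (v i / ‖v‖ ^ 2) • v := by
  obtain ⟨c, hc⟩ := Projectivization.exists_smul_eq_mk_rep ℝ v hv
  have hc0 : (c : ℝ) ≠ 0 := c.ne_zero
  rw [lineVec, ← hc, Units.smul_def, norm_smul, smul_smul, PiLp.smul_apply, smul_eq_mul, mul_pow,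
    Real.norm_eq_abs, sq_abs]
  congr 1
  field_simp

lemma continuous_lineVec (i : Fin d) : Continuous (lineVec i) := by
  rw [isOpenQuotientMap_mk'.isQuotientMap.continuous_iff]
  have hcomp : lineVec i ∘ Projectivization.mk' ℝ =
      fun v : {v : Vec d // v ≠ 0} => (v.1 i / ‖v.1‖ ^ 2) • v.1 := funext fun v =>
    lineVec_mk i v.1 v.2
  rw [hcomp]
  have hcoord : Continuous fun v : {v : Vec d // v ≠ 0} => v.1 i := by fun_prop
  exact (hcoord.div (by fun_prop) fun v => pow_ne_zero 2 (norm_ne_zero_iff.2 v.2)).smul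
    continuous_subtype_val

lemma exists_lineVec_ne_zero (p : Proj d) : ∃ i, lineVec i p ≠ 0 := by
  obtain ⟨i, hi⟩ : ∃ i, p.rep i ≠ 0 := by
    by_contra! h
    exact p.rep_nonzero (PiLp.ext h)
  exact ⟨i, smul_ne_zero (div_ne_zero hi (pow_ne_zero 2 (norm_ne_zero_iff.2 p.rep_nonzero)))
    p.rep_nonzero⟩

lemma mk_lineVec {i : Fin d} {p : Proj d} (h : lineVec i p ≠ 0) :
    Projectivization.mk ℝ (lineVec i p) h = p := by
  conv_rhs => rw [← p.mk_rep]
  exact (Projectivization.mk_eq_mk_iff' ℝ _ _ _ _).2 ⟨_, rfl⟩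

instance : T2Space (Proj d) := by
  refine T2Space.of_injective_continuous (f := fun p (i : Fin d) => lineVec i p) (fun p q h => ?_)
    (continuous_pi continuous_lineVec)
  obtain ⟨i, hi⟩ := exists_lineVec_ne_zero p
  have hpq : lineVec i p = lineVec i q := congrFun h i
  rw [← mk_lineVec hi, ← mk_lineVec (p := q) (hpq ▸ hi)]
  congr 1

instance : PolishSpace (Proj d) := by
  let := TopologicalSpace.metrizableSpaceMetric (Proj d)
  infer_instance

lemma eq_of_gramDet_rep_eq_zero {p q : Proj d} (h : gramDet p.rep q.rep = 0) : p = q := by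
  obtain ⟨c, hc⟩ := Submodule.mem_span_singleton.1
    (mem_span_singleton_of_gramDet_eq_zero p.rep_nonzero h)
  rw [← p.mk_rep, ← q.mk_rep, eq_comm]
  exact (Projectivization.mk_eq_mk_iff' ℝ _ _ _ _).2 ⟨c, hc⟩

end ProjectiveSpace

section Projective

variable {m d : ℕ} {A : Fin m → Fin m → Prop}

lemma projMap_mk (g : GLd d) (v : Vec d) (hv : v ≠ 0) :
    projMap g (Projectivization.mk ℝ v hv) =
      Projectivization.mk ℝ (g.1 v) (units_apply_ne_zero g hv) := rfl

lemma projMap_mul (g h : GLd d) (p : Proj d) : projMap (g * h) p = projMap g (projMap h p) := by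
  induction p using Projectivization.ind with
  | h v hv => rfl

lemma projMap_one (p : Proj d) : projMap (1 : GLd d) p = p := by
  induction p using Projectivization.ind with
  | h v hv => rfl

lemma projMap_inv_projMap (g : GLd d) (p : Proj d) : projMap g⁻¹ (projMap g p) = p := by
  rw [← projMap_mul, inv_mul_cancel, projMap_one]

lemma projMap_projMap_inv (g : GLd d) (p : Proj d) : projMap g (projMap g⁻¹ p) = p := by
  rw [← projMap_mul, mul_inv_cancel, projMap_one]

lemma continuous_projMap_prod {X : Type*} [TopologicalSpace X] {M : X → GLd d}
    (hM : Continuous M) : Continuous fun p : X × Proj d => projMap (M p.1) p.2 := by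
  have hq := (IsOpenQuotientMap.id (X := X)).prodMap (isOpenQuotientMap_mk' (d := d))
  rw [hq.isQuotientMap.continuous_iff]
  have : ((fun p : X × Proj d => projMap (M p.1) p.2) ∘
      Prod.map id (Projectivization.mk' ℝ)) =
      Projectivization.mk' ℝ ∘ fun p : X × {v : Vec d // v ≠ 0} =>
        ⟨(M p.1).1 p.2.1, units_apply_ne_zero _ p.2.2⟩ := rfl
  rw [this]
  refine isOpenQuotientMap_mk'.continuous.comp (Continuous.subtype_mk ?_ _)
  exact (Units.continuous_val.comp (hM.comp continuous_fst)).clm_apply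
    (continuous_subtype_val.comp continuous_snd)

lemma measurable_projMap_prod {M : SFT A → GLd d} (hM : Continuous M) :
    Measurable fun p : SFT A × Proj d => projMap (M p.1) p.2 :=
  (continuous_projMap_prod hM).measurable

lemma measurable_projFibered {M : SFT A → GLd d} (hM : Continuous M) :
    Measurable (projFibered M) :=
  (continuous_shift.measurable.comp measurable_fst).prodMk (measurable_projMap_prod hM)

/-- The logarithmic expansion of `g` along a line. -/
def logExp (g : GLd d) (p : Proj d) : ℝ := Real.log (‖g.1 p.rep‖ / ‖p.rep‖)

lemma logExp_mk (g : GLd d) (v : Vec d) (hv : v ≠ 0) :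
    logExp g (Projectivization.mk ℝ v hv) = Real.log (‖g.1 v‖ / ‖v‖) := by
  obtain ⟨c, hc⟩ := Projectivization.exists_smul_eq_mk_rep ℝ v hv
  have hc0 : ‖(c : ℝ)‖ ≠ 0 := norm_ne_zero_iff.2 c.ne_zero
  rw [logExp, ← hc, Units.smul_def, map_smul, norm_smul, norm_smul, mul_div_mul_left _ _ hc0]

lemma logExp_mul (g h : GLd d) (p : Proj d) :
    logExp (g * h) p = logExp g (projMap h p) + logExp h p := by
  induction p using Projectivization.ind with
  | h v hv =>
    rw [projMap_mk, logExp_mk, logExp_mk, logExp_mk, ← Real.log_mul]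
    · congr 1
      have := (norm_units_apply_pos h hv).ne'
      have := (norm_pos_iff.2 hv).ne'
      rw [units_mul_apply]
      field_simp
    · exact (div_pos (norm_units_apply_pos _ (units_apply_ne_zero h hv))
        (norm_units_apply_pos h hv)).ne'
    · exact (div_pos (norm_units_apply_pos _ hv) (norm_pos_iff.2 hv)).ne'

lemma logExp_one (p : Proj d) : logExp (1 : GLd d) p = 0 := by
  have := logExp_mul (1 : GLd d) 1 p
  rw [mul_one, projMap_one] at this
  linarith

lemma continuous_logExp_prod {X : Type*} [TopologicalSpace X] {M : X → GLd d}
    (hM : Continuous M) : Continuous fun p : X × Proj d => logExp (M p.1) p.2 := by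
  have hq := (IsOpenQuotientMap.id (X := X)).prodMap (isOpenQuotientMap_mk' (d := d))
  rw [hq.isQuotientMap.continuous_iff]
  have : ((fun p : X × Proj d => logExp (M p.1) p.2) ∘
      Prod.map id (Projectivization.mk' ℝ)) = fun p : X × {v : Vec d // v ≠ 0} =>
        Real.log (‖(M p.1).1 p.2.1‖ / ‖p.2.1‖) := by
    ext p; exact logExp_mk _ _ p.2.2
  rw [this]
  refine Continuous.log (Continuous.div ?_ ?_ ?_) ?_
  · exact ((Units.continuous_val.comp (hM.comp continuous_fst)).clm_apply
      (continuous_subtype_val.comp continuous_snd)).norm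
  · exact (continuous_subtype_val.comp continuous_snd).norm
  · exact fun p => (norm_pos_iff.2 p.2.2).ne'
  · exact fun p => (div_pos (norm_units_apply_pos _ p.2.2) (norm_pos_iff.2 p.2.2)).ne'

lemma logExp_le {K : ℝ} (g : GLd d) (hg : ‖g.1‖ ≤ K) (p : Proj d) : logExp g p ≤ Real.log K := by
  have hp := norm_pos_iff.2 p.rep_nonzero
  refine Real.log_le_log (div_pos (norm_units_apply_pos _ p.rep_nonzero) hp) ?_
  rw [div_le_iff₀ hp]
  exact (g.1.le_opNorm _).trans (by gcongr)

lemma abs_logExp_le {K : ℝ} (g : GLd d) (hg : ‖g.1‖ ≤ K) (hg' : ‖g⁻¹.1‖ ≤ K) (p : Proj d) :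
    |logExp g p| ≤ Real.log K := by
  have h1 := logExp_mul g⁻¹ g p
  rw [inv_mul_cancel, logExp_one] at h1
  have := logExp_le g hg p
  have := logExp_le g⁻¹ hg' (projMap g p)
  rw [abs_le]
  constructor <;> linarith

variable {M : SFT A → GLd d}

/-- The logarithmic expansion of the cocycle, as a function on the projective bundle. -/
def logExpFibered (M : SFT A → GLd d) (q : SFT A × Proj d) : ℝ := logExp (M q.1) q.2

lemma projFibered_iterate (n : ℕ) (q : SFT A × Proj d) :
    (projFibered M)^[n] q = ((shift A)^[n] q.1, projMap (iterNat M n q.1) q.2) := by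
  induction n with
  | zero => simp [iterNat, projMap_one]
  | succ n ih =>
    rw [Function.iterate_succ_apply', ih, iterNat_succ, projMap_mul,
      Function.iterate_succ_apply' (shift A)]
    rfl

lemma birkhoffSum_logExpFibered (n : ℕ) (q : SFT A × Proj d) :
    birkhoffSum (projFibered M) (logExpFibered M) n q = logExp (iterNat M n q.1) q.2 := by
  induction n with
  | zero => simp [iterNat, logExp_one]
  | succ n ih =>
    rw [birkhoffSum_succ, ih, projFibered_iterate, iterNat_succ, logExp_mul, add_comm]
    rfl

/-- The inverse of the fibered projective map. -/
def projFiberedInv (M : SFT A → GLd d) (q : SFT A × Proj d) : SFT A × Proj d :=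
  ((shift A).symm q.1, projMap (M ((shift A).symm q.1))⁻¹ q.2)

lemma projFibered_projFiberedInv (M : SFT A → GLd d) :
    Function.LeftInverse (projFibered M) (projFiberedInv M) := fun q => by
  simp [projFibered, projFiberedInv, projMap_projMap_inv]

lemma projFiberedInv_projFibered (M : SFT A → GLd d) :
    Function.LeftInverse (projFiberedInv M) (projFibered M) := fun q => by
  simp [projFibered, projFiberedInv, projMap_inv_projMap]

lemma projFiberedInv_iterate (n : ℕ) (q : SFT A × Proj d) :
    (projFiberedInv M)^[n] q = ((shift A).symm^[n] q.1, projMap (iter M (-n) q.1) q.2) := by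
  have h := (projFiberedInv_projFibered M).iterate n
    ((shift A).symm^[n] q.1, projMap (iter M (-n) q.1) q.2)
  rw [projFibered_iterate] at h
  simp only [iter_neg_natCast, shift_iterate_symm_iterate, projMap_projMap_inv] at h
  rw [iter_neg_natCast]
  exact h

lemma birkhoffSum_logExpFibered_backward (n : ℕ) (q : SFT A × Proj d) :
    birkhoffSum (projFibered M) (logExpFibered M) n ((projFiberedInv M)^[n] q) =
      -logExp (iter M (-n) q.1) q.2 := by
  rw [projFiberedInv_iterate, birkhoffSum_logExpFibered, eq_neg_iff_add_eq_zero, ← logExp_mul,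
    iter_neg_natCast, mul_inv_cancel, logExp_one]

lemma measurable_projFiberedInv (hM : Continuous M) : Measurable (projFiberedInv M) := by
  refine (continuous_shift_symm.measurable.comp measurable_fst).prodMk ?_
  exact (measurable_projMap_prod hM.inv).comp
    ((continuous_shift_symm.measurable.comp measurable_fst).prodMk measurable_snd)

lemma measurable_logExpFibered (hM : Continuous M) : Measurable (logExpFibered M) :=
  (continuous_logExp_prod hM).measurable

lemma exists_abs_logExpFibered_le (hM : Continuous M) : ∃ K, ∀ q, |logExpFibered M q| ≤ K := by
  obtain ⟨K, -, hK⟩ := exists_norm_units_le hM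
  exact ⟨Real.log K, fun q => abs_logExp_le _ (hK _).1 (hK _).2 _⟩

lemma hasExpRate_rep_iff (g : ℕ → GLd d) (p : Proj d) (l : ℝ) :
    HasExpRate (fun n => (g n).1 p.rep) l ↔
      Tendsto (fun n : ℕ => logExp (g n) p / n) atTop (𝓝 l) := by
  have hlog : ∀ n : ℕ, Real.log ‖(g n).1 p.rep‖ / n =
      logExp (g n) p / n + Real.log ‖p.rep‖ / n := fun n => by
    rw [logExp, Real.log_div (norm_units_apply_pos _ p.rep_nonzero).ne'
      (norm_ne_zero_iff.2 p.rep_nonzero)]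
    ring
  have hz := tendsto_const_div_atTop_nhds_zero_nat (Real.log ‖p.rep‖)
  simp only [HasExpRate, hlog]
  exact ⟨fun h => by simpa using h.sub hz, fun h => by simpa using h.add hz⟩

lemma eventually_birkhoffAverage_logExpFibered_le {l : ℝ} {q : SFT A × Proj d}
    (h : HasExpRate (fun n => (iterNat M n q.1).1) l) {a : ℝ} (ha : l < a) :
    ∀ᶠ n in atTop, birkhoffAverage ℝ (projFibered M) (logExpFibered M) n q ≤ a := by
  filter_upwards [h.eventually_norm_le ha, eventually_gt_atTop 0] with n hn hn0
  rw [birkhoffAverage, birkhoffSum_logExpFibered, smul_eq_mul, inv_mul_le_iff₀ (by positivity)]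
  exact (logExp_le _ hn _).trans_eq (Real.log_exp _)

theorem ae_growth_of_le_integral (hM : Continuous M) {ν : Measure (SFT A × Proj d)}
    [IsProbabilityMeasure ν] (hν : MeasurePreserving (projFibered M) ν ν) {l : ℝ}
    (hInt : l ≤ ∫ q, logExpFibered M q ∂ν)
    (hl : ∀ᵐ q ∂ν, HasExpRate (fun n => (iterNat M n q.1).1) l) :
    ∀ᵐ q ∂ν, FwdGrowth M l q.1 q.2.rep ∧ BwdGrowth M l q.1 q.2.rep := by
  obtain ⟨K, hK⟩ := exists_abs_logExpFibered_le hM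
  have hle : ∀ᵐ q ∂ν, ∀ a > l, ∀ᶠ n in atTop,
      birkhoffAverage ℝ (projFibered M) (logExpFibered M) n q ≤ a := by
    filter_upwards [hl] with q hq a ha using eventually_birkhoffAverage_logExpFibered_le hq ha
  have hfwd := ae_tendsto_birkhoffAverage_of_eventually_le hν (measurable_logExpFibered hM) hK
    hInt hle
  have hbwd := ae_tendsto_birkhoffAverage_iterate_leftInverse hν
    (measurePreserving_of_leftInverse hν (measurable_projFiberedInv hM)
      (projFiberedInv_projFibered M))
    (projFibered_projFiberedInv M) (measurable_logExpFibered hM) hK hInt hle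
  filter_upwards [hfwd, hbwd] with q hq hq'
  simp only [birkhoffAverage, birkhoffSum_logExpFibered, smul_eq_mul, inv_mul_eq_div] at hq
  simp only [birkhoffAverage, birkhoffSum_logExpFibered_backward, smul_eq_mul,
    inv_mul_eq_div] at hq'
  exact ⟨(hasExpRate_rep_iff _ _ _).2 hq,
    (hasExpRate_rep_iff _ _ _).2 (by simpa only [neg_div, neg_neg] using hq'.neg)⟩

end Projective

/-! ### The line of growth rate `λ₁` in the past -/

section Selection

lemma exists_measurable_argmax {X ι : Type*} [MeasurableSpace X] [Finite ι] [Nonempty ι]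
    [MeasurableSpace ι] {f : ι → X → ℝ} (hf : ∀ i, Measurable (f i)) :
    ∃ r : X → ι, Measurable r ∧ ∀ x i, f i x ≤ f (r x) x := by
  let S : X → Set (ι × ι) := fun x => {p | f p.1 x ≤ f p.2 x}
  have hS : Measurable S := measurable_set_iff.2 fun p =>
    measurableSet_setOfPred.1 (measurableSet_le (hf p.1) (hf p.2))
  have hsel : ∀ s : Set (ι × ι), ∃ j, (∃ x, S x = s) → ∀ i, (i, j) ∈ s := fun s => by
    by_cases hs : ∃ x, S x = s
    · obtain ⟨x, rfl⟩ := hs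
      obtain ⟨j, hj⟩ := Finite.exists_max fun i => f i x
      exact ⟨j, fun _ => hj⟩
    · exact ⟨Classical.arbitrary ι, fun h => absurd h hs⟩
  choose r hr using hsel
  exact ⟨r ∘ S, (measurable_of_finite r).comp hS, fun x i => hr (S x) ⟨x, rfl⟩ i⟩

end Selection

section Recurrence

variable {X : Type*} [MeasurableSpace X] {μ : Measure X} {S : X → X} {E : ℕ → Set X}

lemma ae_frequently_iterate_mem [IsFiniteMeasure μ] (hS : MeasurePreserving S μ μ)
    (hE : ∀ n, MeasurableSet (E n)) (h : ∀ᵐ x ∂μ, ∀ᶠ n in atTop, x ∈ E n) :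
    ∀ᵐ x ∂μ, ∃ᶠ n in atTop, S^[n] x ∈ E n := by
  have hlim : Tendsto (fun n => μ (E n)ᶜ) atTop (𝓝 0) := by
    have := tendsto_measure_of_ae_tendsto_indicator_of_isFiniteMeasure (μ := μ) (A := ∅) atTop
      MeasurableSet.empty (fun n => (hE n).compl) (by
        filter_upwards [h] with x hx
        filter_upwards [hx] with n hn
        exact iff_of_false (not_not.2 hn) (Set.notMem_empty x))
    simpa using this
  have hafter : ∀ k : ℕ, ∀ᵐ x ∂μ, ∃ n ≥ k, S^[n] x ∈ E n := fun k => by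
    refine le_antisymm (ge_of_tendsto hlim ?_) zero_le
    filter_upwards [eventually_ge_atTop k] with n hn
    rw [← (hS.iterate n).measure_preimage (hE n).compl.nullMeasurableSet]
    exact measure_mono fun x hx hxn => hx ⟨n, hn, hxn⟩
  filter_upwards [ae_all_iff.2 hafter] with x hx using frequently_atTop.2 hx

end Recurrence

section BackwardUniqueness

variable {m d : ℕ} {A : Fin m → Fin m → Prop} {μ : Measure (SFT A)} {M : SFT A → GLd d}

/-- The points at which `g` expands squared areas by a factor at most `C`. -/
def areaExpansionLe {X : Type*} (g : X → GLd d) (C : ℝ) : Set X :=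
  {x | ∀ u v : Vec d, gramDet ((g x).1 u) ((g x).1 v) ≤ C * gramDet u v}

lemma isClosed_areaExpansionLe {X : Type*} [TopologicalSpace X] {g : X → GLd d}
    (hg : Continuous g) (C : ℝ) : IsClosed (areaExpansionLe g C) := by
  have : Continuous fun x => (g x).1 := Units.continuous_val.comp hg
  simp only [areaExpansionLe, Set.ofPred_forall, gramDet]
  exact isClosed_iInter fun u => isClosed_iInter fun v =>
    isClosed_le (by fun_prop) continuous_const

lemma exists_areaExpansion_rate [NeZero d] {lam : Fin d → ℝ} (hlam : IsLyapunovSpectrum μ M lam)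
    (hsimple : ∀ j : Fin d, j ≠ 0 → lam j < lam 0) :
    ∃ γ < lam 0, ∀ᵐ x ∂μ, ∀ᶠ n : ℕ in atTop,
      x ∈ areaExpansionLe (iterNat M n) (Real.exp (n * γ) ^ 4) := by
  by_cases hd : d ≤ 1
  · refine ⟨lam 0 - 1, by linarith, ae_of_all _ fun x => Eventually.of_forall fun n u v => ?_⟩
    rw [gramDet_eq_zero_of_dim_le_one hd, gramDet_eq_zero_of_dim_le_one hd, mul_zero]
  let i : Fin d := ⟨1, not_le.1 hd⟩
  have hi : (i : ℕ) = 1 := rfl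
  refine ⟨(3 * lam 0 + lam i) / 4, by linarith [hsimple i (zero_ne_of_val_eq_one hi).symm], ?_⟩
  filter_upwards [hlam] with x hx
  have hlim := hx i
  rw [Iic_eq_pair hi, Finset.sum_pair (zero_ne_of_val_eq_one hi)] at hlim
  have hγ : lam 0 + lam i < 2 * ((3 * lam 0 + lam i) / 4) := by
    linarith [hsimple i (zero_ne_of_val_eq_one hi).symm]
  filter_upwards [hlim.eventually_lt_const hγ, eventually_gt_atTop 0] with n hn hn0 u v
  rw [div_lt_iff₀ (by exact_mod_cast hn0)] at hn
  refine (gramDet_map_le_exteriorNorm hi _ u v).trans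
    (mul_le_mul_of_nonneg_right ?_ (gramDet_nonneg u v))
  calc exteriorNorm i (iterNat M n x) ^ 2
      ≤ Real.exp (2 * ((3 * lam 0 + lam i) / 4) * n) ^ 2 := by
        gcongr
        · exact exteriorNorm_nonneg _ _
        · exact (Real.le_exp_log _).trans (Real.exp_le_exp.2 hn.le)
    _ = Real.exp (n * ((3 * lam 0 + lam i) / 4)) ^ 4 := by
        rw [← Real.exp_nat_mul, ← Real.exp_nat_mul]
        ring_nf

/-- The parallelogram spanned by two vectors of backward growth rate `l` is the image by `M^n` of a
parallelogram of squared area at most `exp (-4 n (l - ε))`. -/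
lemma gramDet_eq_zero_of_bwdGrowth {l γ : ℝ} (hγ : γ < l) {x : SFT A}
    (harea : ∃ᶠ n : ℕ in atTop, (shift A).symm^[n] x ∈
      areaExpansionLe (iterNat M n) (Real.exp (n * γ) ^ 4))
    {u v : Vec d} (hu : BwdGrowth M l x u) (hv : BwdGrowth M l x v) : gramDet u v = 0 := by
  obtain ⟨c, hγc, hcl⟩ := exists_between hγ
  have hlim : Tendsto (fun n : ℕ => Real.exp (n * (γ - c)) ^ 4) atTop (𝓝 0) := by
    have hexp := Real.tendsto_exp_atBot.comp
      (tendsto_natCast_atTop_atTop.atTop_mul_const_of_neg (sub_neg.2 hγc))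
    simpa using hexp.pow 4
  refine le_antisymm (ge_of_tendsto_of_frequently hlim ?_) (gramDet_nonneg u v)
  refine (harea.and_eventually ((HasExpRate.eventually_norm_le hu (neg_lt_neg hcl)).and
    (HasExpRate.eventually_norm_le hv (neg_lt_neg hcl)))).mono ?_
  rintro n ⟨hn, hnu, hnv⟩
  set g := iterNat M n ((shift A).symm^[n] x) with hg
  rw [iter_neg_natCast, ← hg] at hnu hnv
  calc gramDet u v = gramDet (g.1 (g⁻¹.1 u)) (g.1 (g⁻¹.1 v)) := by
        rw [units_apply_inv_apply, units_apply_inv_apply]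
    _ ≤ Real.exp (n * γ) ^ 4 * gramDet (g⁻¹.1 u) (g⁻¹.1 v) := hn _ _
    _ ≤ Real.exp (n * γ) ^ 4 * (Real.exp (n * -c) ^ 2 * Real.exp (n * -c) ^ 2) := by
        gcongr
        exact (gramDet_le _ _).trans (by gcongr)
    _ = Real.exp (n * (γ - c)) ^ 4 := by
        rw [← pow_add, ← mul_pow, ← Real.exp_add, ← mul_add, sub_eq_add_neg]

theorem ae_gramDet_eq_zero_of_bwdGrowth [IsFiniteMeasure μ] (hT : MeasurePreserving (shift A) μ μ)
    (hM : Continuous M) {l γ : ℝ} (hγ : γ < l)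
    (harea : ∀ᵐ x ∂μ, ∀ᶠ n : ℕ in atTop,
      x ∈ areaExpansionLe (iterNat M n) (Real.exp (n * γ) ^ 4)) :
    ∀ᵐ x ∂μ, ∀ u v : Vec d, BwdGrowth M l x u → BwdGrowth M l x v → gramDet u v = 0 := by
  filter_upwards [ae_frequently_iterate_mem (measurePreserving_shift_symm hT)
    (fun n => (isClosed_areaExpansionLe (continuous_iterNat hM n) _).measurableSet) harea]
    with x hx u v hu hv using gramDet_eq_zero_of_bwdGrowth hγ hx hu hv

end BackwardUniqueness

section KrylovBogolyubov

variable {X Y : Type*} [MeasurableSpace X] {G : X → X} {f : X → ℝ}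

/-- The average of the images of `β` under the first `n` iterates of `G`. -/
def averageMeasure (G : X → X) (β : Measure X) (n : ℕ) : Measure X :=
  (n : ENNReal)⁻¹ • ∑ k ∈ Finset.range n, β.map G^[k]

lemma isProbabilityMeasure_averageMeasure (hG : Measurable G) (β : Measure X)
    [IsProbabilityMeasure β] {n : ℕ} (hn : n ≠ 0) :
    IsProbabilityMeasure (averageMeasure G β n) := by
  refine ⟨?_⟩
  have hmap : ∀ k, β.map G^[k] Set.univ = 1 := fun k => by
    rw [Measure.map_apply (hG.iterate k) MeasurableSet.univ, Set.preimage_univ, measure_univ]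
  simp only [averageMeasure, Measure.smul_apply, Measure.finsetSum_apply, hmap, Finset.sum_const,
    Finset.card_range, smul_eq_mul, nsmul_eq_mul, mul_one]
  exact ENNReal.inv_mul_cancel (by exact_mod_cast hn) (ENNReal.natCast_ne_top n)

lemma integral_averageMeasure (hG : Measurable G) (β : Measure X) [IsFiniteMeasure β]
    (hf : Measurable f) {K : ℝ} (hK : ∀ x, |f x| ≤ K) (n : ℕ) :
    ∫ x, f x ∂averageMeasure G β n = ∫ x, birkhoffAverage ℝ G f n x ∂β := by
  have hcomp : ∀ k, Integrable (fun x => f (G^[k] x)) β := fun k =>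
    integrable_of_abs_le (hf.comp (hG.iterate k)) fun x => hK _
  simp only [averageMeasure, birkhoffAverage, birkhoffSum]
  rw [integral_smul_measure, integral_finsetSum_measure fun k _ => integrable_of_abs_le hf hK,
    integral_smul, integral_finsetSum _ fun k _ => hcomp k]
  simp only [integral_map (hG.iterate _).aemeasurable hf.aestronglyMeasurable, ENNReal.toReal_inv,
    ENNReal.toReal_natCast]

variable [TopologicalSpace X] {β : ℕ → Measure X} {ρ : Measure X}

/-- `ρ` is a limit point of the averages of `β n` along the first `n` iterates of `G`, as far as
continuous functions whose averages converge can tell. -/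
def IsAverageLimit (G : X → X) (β : ℕ → Measure X) (ρ : Measure X) : Prop :=
  ∀ (f : X → ℝ) (c : ℝ), Continuous f →
    Tendsto (fun n => ∫ x, birkhoffAverage ℝ G f n x ∂β n) atTop (𝓝 c) → ∫ x, f x ∂ρ = c

lemma exists_isAverageLimit [CompactSpace X] [TopologicalSpace.MetrizableSpace X] [BorelSpace X]
    (hG : Measurable G) [∀ n, IsProbabilityMeasure (β n)] :
    ∃ ρ, IsProbabilityMeasure ρ ∧ IsAverageLimit G β ρ := by
  let P : ℕ → ProbabilityMeasure X := fun n =>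
    ⟨averageMeasure G (β (n + 1)) (n + 1),
      isProbabilityMeasure_averageMeasure hG _ n.succ_ne_zero⟩
  obtain ⟨ρ, -, hρ⟩ := isCompact_univ.ultrafilter_le_nhds ((hyperfilter ℕ).map P) (by simp)
  have hlim : Tendsto P (hyperfilter ℕ) (𝓝 ρ) := hρ
  rw [ProbabilityMeasure.tendsto_iff_forall_integral_tendsto] at hlim
  refine ⟨ρ, inferInstance, fun f c hf h => tendsto_nhds_unique
    (hlim (BoundedContinuousFunction.mkOfCompact ⟨f, hf⟩)) ?_⟩
  obtain ⟨K, hK⟩ := isCompact_univ.exists_bound_of_continuousOn hf.continuousOn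
  refine Tendsto.mono_left ?_ Nat.hyperfilter_le_atTop
  exact ((tendsto_add_atTop_iff_nat 1).2 h).congr fun n =>
    (integral_averageMeasure hG _ hf.measurable (fun x => hK x trivial) _).symm

lemma IsAverageLimit.measurePreserving [HasOuterApproxClosed X] [BorelSpace X]
    [∀ n, IsProbabilityMeasure (β n)] [IsFiniteMeasure ρ] (h : IsAverageLimit G β ρ)
    (hG : Continuous G) : MeasurePreserving G ρ ρ := by
  refine ⟨hG.measurable, ext_of_forall_integral_eq_of_IsFiniteMeasure fun f => ?_⟩
  have hfG : Integrable (fun x => f (G x)) ρ := (f.compContinuous ⟨G, hG⟩).integrable ρ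
  rw [integral_map hG.aemeasurable f.continuous.aestronglyMeasurable, ← sub_eq_zero,
    ← integral_sub hfG (f.integrable ρ)]
  refine h (fun x => f (G x) - f x) 0 ((f.continuous.comp hG).sub f.continuous) ?_
  refine squeeze_zero_norm (fun n => ?_) (tendsto_const_div_atTop_nhds_zero_nat (2 * ‖f‖))
  have hbound : ∀ x, ‖birkhoffAverage ℝ G (fun x => f (G x) - f x) n x‖ ≤ 2 * ‖f‖ / n := fun x => by
    have hsum : birkhoffSum G (fun x => f (G x) - f x) n x = f (G^[n] x) - f x := by
      simpa only [birkhoffSum, Function.iterate_succ_apply', Function.iterate_zero, id_eq] using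
        Finset.sum_range_sub (fun k => f (G^[k] x)) n
    rw [birkhoffAverage, hsum, norm_smul, norm_inv, Real.norm_natCast, inv_mul_eq_div]
    exact div_le_div_of_nonneg_right (by simpa only [dist_eq_norm] using f.dist_le_two_norm _ _)
      n.cast_nonneg
  simpa using norm_integral_le_of_norm_le_const (μ := β n) (ae_of_all _ hbound)

lemma IsAverageLimit.map_eq [BorelSpace X] [IsFiniteMeasure ρ] (h : IsAverageLimit G β ρ)
    [TopologicalSpace Y] [MeasurableSpace Y] [BorelSpace Y] [HasOuterApproxClosed Y]
    {μ : Measure Y} [IsFiniteMeasure μ] {T : Y → Y} (hT : MeasurePreserving T μ μ)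
    {π : X → Y} (hπ : Continuous π) (hsemi : Function.Semiconj π G T)
    (hβ : ∀ n, (β n).map π = μ) : ρ.map π = μ := by
  refine ext_of_forall_integral_eq_of_IsFiniteMeasure fun f => ?_
  rw [integral_map hπ.aemeasurable f.continuous.aestronglyMeasurable]
  refine h (fun x => f (π x)) _ (f.continuous.comp hπ) (tendsto_const_nhds.congr' ?_)
  filter_upwards [eventually_ne_atTop 0] with n hn
  have hcomp : birkhoffAverage ℝ G (fun x => f (π x)) n =
      fun x => birkhoffAverage ℝ T f n (π x) := funext fun x => by
    simp only [birkhoffAverage, birkhoffSum, (hsemi.iterate_right _).eq]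
  rw [hcomp, ← integral_map hπ.aemeasurable, hβ, integral_birkhoffAverage hT (f.integrable μ) hn]
  rw [hβ]
  exact (measurable_birkhoffAverage hT.measurable f.continuous.measurable n).aestronglyMeasurable

end KrylovBogolyubov

section MaximalMeasure

variable {m d : ℕ} {A : Fin m → Fin m → Prop} {μ : Measure (SFT A)} {M : SFT A → GLd d}

lemma IsLyapunovSpectrum.ae_hasExpRate_norm [NeZero d] {lam : Fin d → ℝ}
    (hlam : IsLyapunovSpectrum μ M lam) :
    ∀ᵐ x ∂μ, HasExpRate (fun n => (iterNat M n x).1) (lam 0) := by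
  have hIic : Finset.Iic (0 : Fin d) = {0} := by ext i; simp
  filter_upwards [hlam] with x hx
  simpa only [HasExpRate, exteriorNorm_zero, hIic, Finset.sum_singleton] using hx 0

lemma opNorm_le_card_mul (g : Vec d →L[ℝ] Vec d) {C : ℝ} (hC : 0 ≤ C)
    (h : ∀ i, ‖g (EuclideanSpace.single i 1)‖ ≤ C) : ‖g‖ ≤ d * C := by
  refine g.opNorm_le_bound (by positivity) fun v => ?_
  have hv : v = ∑ i, v i • EuclideanSpace.single i (1 : ℝ) := by
    simpa using ((EuclideanSpace.basisFun (Fin d) ℝ).sum_repr v).symm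
  calc ‖g v‖ = ‖∑ i, v i • g (EuclideanSpace.single i 1)‖ := by
        conv_lhs => rw [hv]
        simp only [map_sum, map_smul]
    _ ≤ ∑ _i : Fin d, ‖v‖ * C := by
        refine norm_sum_le_of_le _ fun i _ => ?_
        rw [norm_smul]
        exact mul_le_mul (PiLp.norm_apply_le v i) (h i) (norm_nonneg _) (norm_nonneg _)
    _ = d * C * ‖v‖ := by simp; ring

lemma exists_measurable_logExp_ge [NeZero d] {X : Type*} [TopologicalSpace X] [MeasurableSpace X]
    [OpensMeasurableSpace X] {g : X → GLd d} (hg : Continuous g) :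
    ∃ r : X → Proj d, Measurable r ∧ ∀ x, Real.log ‖(g x).1‖ ≤ logExp (g x) (r x) + Real.log d := by
  let e : Fin d → Vec d := fun i => EuclideanSpace.single i 1
  have he : ∀ i, e i ≠ 0 := fun i => by simp [e]
  have hg' : Continuous fun x => (g x).1 := Units.continuous_val.comp hg
  obtain ⟨r, hr, hmax⟩ := exists_measurable_argmax (f := fun i x => ‖(g x).1 (e i)‖)
    fun i => ((hg'.clm_apply continuous_const).norm).measurable
  refine ⟨fun x => Projectivization.mk ℝ (e (r x)) (he _),
    (measurable_of_finite fun i => Projectivization.mk ℝ (e i) (he i)).comp hr, fun x => ?_⟩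
  have hnorm := opNorm_le_card_mul (g x).1 (norm_nonneg _) (hmax x)
  have hd : (d : ℝ) ≠ 0 := Nat.cast_ne_zero.2 (NeZero.ne d)
  have hpos := norm_units_apply_pos (g x) (he (r x))
  have he1 : ‖e (r x)‖ = 1 := by simp [e]
  rw [logExp_mk, he1, div_one, add_comm, ← Real.log_mul hd hpos.ne']
  exact Real.log_le_log (norm_units_pos _) hnorm

lemma continuous_projFibered (hM : Continuous M) : Continuous (projFibered M) :=
  (continuous_shift.comp continuous_fst).prodMk (continuous_projMap_prod hM)

lemma tendsto_birkhoffAverage_logExpFibered {r : ℕ → SFT A → Proj d} {l : ℝ} {x : SFT A}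
    (hr : ∀ n, Real.log ‖(iterNat M n x).1‖ ≤ logExp (iterNat M n x) (r n x) + Real.log d)
    (hl : HasExpRate (fun n => (iterNat M n x).1) l) :
    Tendsto (fun n => birkhoffAverage ℝ (projFibered M) (logExpFibered M) n (x, r n x)) atTop
      (𝓝 l) := by
  simp only [birkhoffAverage, birkhoffSum_logExpFibered, smul_eq_mul, inv_mul_eq_div]
  refine tendsto_of_tendsto_of_tendsto_of_le_of_le
    (g := fun n => Real.log ‖(iterNat M n x).1‖ / n - Real.log d / n)
    (by simpa using Tendsto.sub hl (tendsto_const_div_atTop_nhds_zero_nat (Real.log d))) hl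
    (fun n => ?_) fun n => ?_
  · simp only [← sub_div]
    exact div_le_div_of_nonneg_right (by linarith [hr n]) n.cast_nonneg
  · exact div_le_div_of_nonneg_right (logExp_le _ le_rfl _) n.cast_nonneg

theorem exists_invariant_measure_integral_logExpFibered_eq [NeZero d] [IsProbabilityMeasure μ]
    (hT : MeasurePreserving (shift A) μ μ) (hM : Continuous M) {l : ℝ}
    (hl : ∀ᵐ x ∂μ, HasExpRate (fun n => (iterNat M n x).1) l) :
    ∃ ν : Measure (SFT A × Proj d), IsProbabilityMeasure ν ∧ ν.fst = μ ∧
      MeasurePreserving (projFibered M) ν ν ∧ ∫ q, logExpFibered M q ∂ν = l := by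
  choose r hr hle using fun n => exists_measurable_logExp_ge (continuous_iterNat hM n)
  have hgraph : ∀ n, Measurable fun x => (x, r n x) := fun n => measurable_id.prodMk (hr n)
  have hβ : ∀ n, IsProbabilityMeasure (μ.map fun x => (x, r n x)) := fun n =>
    Measure.isProbabilityMeasure_map (hgraph n).aemeasurable
  obtain ⟨ν, hν, hlim⟩ := exists_isAverageLimit (continuous_projFibered hM).measurable
    (β := fun n => μ.map fun x => (x, r n x))
  refine ⟨ν, hν, hlim.map_eq hT continuous_fst (fun q => rfl) fun n => ?_,
    hlim.measurePreserving (continuous_projFibered hM),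
    hlim _ _ (continuous_logExp_prod hM) ?_⟩
  · rw [Measure.map_map measurable_fst (hgraph n)]
    exact Measure.map_id
  obtain ⟨K, hK⟩ := exists_abs_logExpFibered_le hM
  have hmeas := measurable_birkhoffAverage (continuous_projFibered hM).measurable
    (measurable_logExpFibered hM)
  have hdct := tendsto_integral_of_dominated_convergence (μ := μ) (fun _ => K)
    (fun n => ((hmeas n).comp (hgraph n)).aestronglyMeasurable) (integrable_const K)
    (fun n => ae_of_all _ fun x => abs_birkhoffAverage_le hK n (x, r n x))
    (hl.mono fun x hx => tendsto_birkhoffAverage_logExpFibered (fun n => hle n x) hx)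
  rw [integral_const, probReal_univ, one_smul] at hdct
  exact hdct.congr fun n =>
    (integral_map (hgraph n).aemeasurable (hmeas n).aestronglyMeasurable).symm

end MaximalMeasure

section OseledetsLine

variable {m d : ℕ} {A : Fin m → Fin m → Prop} {μ : Measure (SFT A)} {M : SFT A → GLd d}

/-- If `κ x` is a Dirac mass, the nonzero means of the continuous maps `lineVec i` are generators of
the line. -/
lemma exists_measurable_generator [NeZero d] {X : Type*} [MeasurableSpace X]
    (κ : Kernel X (Proj d)) [IsMarkovKernel κ] :
    ∃ v : X → Vec d, Measurable v ∧ (∀ x, v x ≠ 0) ∧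
      ∀ x p, (∀ᵐ q ∂κ x, q = p) → ∃ c : ℝ, c ≠ 0 ∧ v x = c • p.rep := by
  let w : Fin d → X → Vec d := fun i x => ∫ p, lineVec i p ∂κ x
  have hw : ∀ i, Measurable (w i) := fun i =>
    ((continuous_lineVec i).stronglyMeasurable.integral_kernel (κ := κ)).measurable
  obtain ⟨j, hj, hmax⟩ := exists_measurable_argmax fun i => (hw i).norm
  have hwj : Measurable fun x => w (j x) x :=
    (measurable_from_prod_countable_right (f := fun q : Fin d × X => w q.1 q.2) hw).comp
      (hj.prodMk measurable_id)
  obtain ⟨e, he⟩ := exists_ne (0 : Vec d)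
  refine ⟨fun x => if w (j x) x = 0 then e else w (j x) x,
    Measurable.ite (hwj (measurableSet_singleton 0)) measurable_const hwj, fun x => ?_,
    fun x p hp => ?_⟩
  · dsimp only
    split_ifs with h
    exacts [he, h]
  have hwp : ∀ i, w i x = lineVec i p := fun i => by
    have hconst : lineVec i =ᵐ[κ x] fun _ => lineVec i p := hp.mono fun q hq => by rw [hq]
    rw [show w i x = _ from integral_congr_ae hconst, integral_const, probReal_univ, one_smul]
  have hjx : w (j x) x ≠ 0 := fun h => by
    obtain ⟨i, hi⟩ := exists_lineVec_ne_zero p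
    have := hmax x i
    rw [h, norm_zero, hwp] at this
    exact hi (norm_le_zero_iff.1 this)
  simp only [hwp] at hjx ⊢
  rw [if_neg hjx]
  exact ⟨_, left_ne_zero_of_smul hjx, rfl⟩

/-- The conditional measures of a measure of maximal expansion live on the lines of growth rate `l`
in the past, hence they are Dirac masses. -/
theorem exists_measurable_growth [NeZero d] [IsProbabilityMeasure μ]
    (hT : MeasurePreserving (shift A) μ μ) (hM : Continuous M) {l : ℝ}
    (hl : ∀ᵐ x ∂μ, HasExpRate (fun n => (iterNat M n x).1) l)
    (huniq : ∀ᵐ x ∂μ, ∀ u v : Vec d, BwdGrowth M l x u → BwdGrowth M l x v → gramDet u v = 0) :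
    ∃ v : SFT A → Vec d, Measurable v ∧ (∀ x, v x ≠ 0) ∧
      ∀ᵐ x ∂μ, FwdGrowth M l x (v x) ∧ BwdGrowth M l x (v x) := by
  obtain ⟨ν, hν, hfst, hinv, hInt⟩ :=
    exists_invariant_measure_integral_logExpFibered_eq hT hM hl
  have hlν : ∀ᵐ q ∂ν, HasExpRate (fun n => (iterNat M n q.1).1) l :=
    ae_of_ae_map measurable_fst.aemeasurable (hfst.symm ▸ hl)
  have hgrow := ae_growth_of_le_integral hM hinv hInt.ge hlν
  obtain ⟨v, hv, hv0, hvp⟩ := exists_measurable_generator ν.condKernel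
  refine ⟨v, hv, hv0, ?_⟩
  rw [← ν.disintegrate ν.condKernel, hfst] at hgrow
  filter_upwards [Measure.ae_ae_of_ae_compProd hgrow, huniq] with x hx hux
  obtain ⟨p, hp⟩ := hx.exists
  obtain ⟨c, hc, hcv⟩ := hvp x p (hx.mono fun q hq =>
    eq_of_gramDet_rep_eq_zero (hux _ _ hq.2 hp.2))
  rw [hcv]
  exact ⟨hp.1.smul hc, hp.2.smul hc⟩

end OseledetsLine

/-! ### Local product structure -/

section Cylinders

variable {m : ℕ} {A : Fin m → Fin m → Prop} {μ : Measure (SFT A)}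

/-- The cylinder `[x_{-n}, …, x_k]`. -/
def twoSidedCylinder (x : SFT A) (n k : ℕ) : Set (SFT A) :=
  {y | ∀ i : ℤ, -n ≤ i → i ≤ k → y.1 i = x.1 i}

lemma eventually_coord_eq (i : ℤ) (x : SFT A) : ∀ᶠ y : SFT A in 𝓝 x, y.1 i = x.1 i :=
  (continuous_coord i).continuousAt.eventually ((isOpen_discrete {x.1 i}).mem_nhds rfl)

lemma measurableSet_cylinder (x : SFT A) (n : ℕ) : MeasurableSet (cylinder x n) := by
  simp only [cylinder, Set.ofPred_forall]
  exact MeasurableSet.iInter fun i => MeasurableSet.iInter fun _ => MeasurableSet.iInter fun _ =>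
    (continuous_coord i).measurable (measurableSet_singleton (x.1 i))

lemma mem_cylinder_one {x y : SFT A} : y ∈ cylinder x 1 ↔ y.1 0 = x.1 0 := by
  refine ⟨fun h => h 0 le_rfl (by simp), fun h i h₀ h₁ => ?_⟩
  obtain rfl : i = 0 := by push_cast at h₁; omega
  exact h

lemma cylinder_eq_of_mem {x y : SFT A} {n : ℕ} (h : y ∈ cylinder x n) :
    cylinder y n = cylinder x n :=
  Set.ext fun _ => forall_congr' fun i => forall_congr' fun h₀ => forall_congr' fun h₁ => by
    rw [h i h₀ h₁]

lemma cylinder_antitone (x : SFT A) : Antitone (cylinder x) :=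
  fun _ _ hnk _ hy i h₀ h₁ => hy i h₀ (by omega)

lemma cylinder_succ (x : SFT A) (n : ℕ) :
    cylinder x (n + 1) = cylinder x 1 ∩ shift A ⁻¹' cylinder (shift A x) n := by
  ext y
  refine ⟨fun h => ⟨cylinder_antitone x (by omega) h, fun i h₀ h₁ => ?_⟩, fun h i h₀ h₁ => ?_⟩
  · exact h (i + 1) (by omega) (by push_cast; omega)
  · rcases h₀.eq_or_lt with rfl | hi
    · exact mem_cylinder_one.1 h.1
    · have := h.2 (i - 1) (by omega) (by push_cast at h₁; omega)
      simpa only [shift, Equiv.coe_fn_mk, sub_add_cancel] using this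

lemma twoSidedCylinder_eq_preimage (x : SFT A) (n k : ℕ) :
    twoSidedCylinder x n k =
      (shift A).symm^[n] ⁻¹' cylinder ((shift A).symm^[n] x) (n + (k + 1)) := by
  ext y
  refine ⟨fun h i h₀ h₁ => ?_, fun h i h₀ h₁ => ?_⟩
  · rw [shift_symm_iterate_apply, shift_symm_iterate_apply]
    exact h _ (by omega) (by push_cast at h₁; omega)
  · have := h (i + n) (by omega) (by push_cast; omega)
    simpa only [shift_symm_iterate_apply, add_sub_cancel_right] using this

lemma measurableSet_twoSidedCylinder (x : SFT A) (n k : ℕ) :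
    MeasurableSet (twoSidedCylinder x n k) := by
  rw [twoSidedCylinder_eq_preimage]
  exact (continuous_shift_symm.measurable.iterate n) (measurableSet_cylinder _ _)

lemma measure_twoSidedCylinder (hμ : MeasurePreserving (shift A) μ μ) (x : SFT A) (n k : ℕ) :
    μ (twoSidedCylinder x n k) = μ (cylinder ((shift A).symm^[n] x) (n + (k + 1))) := by
  rw [twoSidedCylinder_eq_preimage, ((measurePreserving_shift_symm hμ).iterate n).measure_preimage
    (measurableSet_cylinder _ _).nullMeasurableSet]

lemma exists_twoSidedCylinder_subset {U : Set (SFT A)} (hU : IsOpen U) {x : SFT A} (hx : x ∈ U) :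
    ∃ n, twoSidedCylinder x n n ⊆ U := by
  obtain ⟨V, hV, rfl⟩ := isOpen_induced_iff.1 hU
  obtain ⟨I, u, hu, hIu⟩ := isOpen_pi_iff.1 hV x.1 hx
  refine ⟨I.sup Int.natAbs, fun y hy => hIu fun i hi => ?_⟩
  have := Finset.le_sup (f := Int.natAbs) hi
  rw [hy i (by omega) (by omega)]
  exact (hu i hi).2

lemma measure_le_of_twoSidedCylinder_subset {μ₁ μ₂ : Measure (SFT A)} {n : ℕ}
    (h : ∀ x, μ₁ (twoSidedCylinder x n n) ≤ μ₂ (twoSidedCylinder x n n)) {U : Set (SFT A)}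
    (hU : ∀ x ∈ U, twoSidedCylinder x n n ⊆ U) : μ₁ U ≤ μ₂ U := by
  classical
  let word : SFT A → Set.Icc (-(n : ℤ)) n → Fin m := fun x i => x.1 i
  have hword : Measurable word := measurable_pi_lambda _ fun i => (continuous_coord i.1).measurable
  have hfiber : ∀ x, word ⁻¹' {word x} = twoSidedCylinder x n n := fun x => by
    ext y
    simp only [Set.mem_preimage, Set.mem_singleton_iff, funext_iff, word]
    exact ⟨fun hy i h₀ h₁ => hy ⟨i, h₀, h₁⟩, fun hy i => hy i i.2.1 i.2.2⟩
  have hU_eq : U = word ⁻¹' ((word '' U).toFinset : Set _) := by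
    rw [Set.coe_toFinset]
    refine Set.Subset.antisymm (Set.subset_preimage_image word U) fun x hx => ?_
    obtain ⟨y, hy, hyx⟩ := hx
    exact hU y hy (hfiber y ▸ hyx.symm)
  rw [hU_eq, ← sum_measure_preimage_singleton _ fun _ _ => hword (measurableSet_singleton _),
    ← sum_measure_preimage_singleton _ fun _ _ => hword (measurableSet_singleton _)]
  refine Finset.sum_le_sum fun s hs => ?_
  obtain ⟨x, -, rfl⟩ := Set.mem_toFinset.1 hs
  simpa only [hfiber] using h x

theorem measure_le_of_twoSidedCylinder_le {μ₁ μ₂ : Measure (SFT A)} [IsFiniteMeasure μ₂]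
    (h : ∀ x n, μ₁ (twoSidedCylinder x n n) ≤ μ₂ (twoSidedCylinder x n n)) : μ₁ ≤ μ₂ := by
  have hopen : ∀ U : Set (SFT A), IsOpen U → μ₁ U ≤ μ₂ U := fun U hU => by
    let W : ℕ → Set (SFT A) := fun n => {x | twoSidedCylinder x n n ⊆ U}
    have hW : Monotone W := fun n k hnk x hx y hy =>
      hx fun i h₀ h₁ => hy i (by omega) (by omega)
    have hUW : U = ⋃ n, W n := Set.Subset.antisymm
      (fun x hx => Set.mem_iUnion.2 (exists_twoSidedCylinder_subset hU hx))
      (Set.iUnion_subset fun n x (hx : twoSidedCylinder x n n ⊆ U) => hx fun _ _ _ => rfl)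
    rw [hUW, hW.measure_iUnion, hW.measure_iUnion]
    refine iSup_mono fun n => measure_le_of_twoSidedCylinder_subset (n := n) (h · n) ?_
    intro x hx y hy z hz
    exact hx fun i h₀ h₁ => (hz i h₀ h₁).trans (hy i h₀ h₁)
  refine Measure.le_iff.2 fun E _ => ?_
  rw [E.measure_eq_iInf_isOpen μ₂]
  exact le_iInf fun U => le_iInf fun hEU => le_iInf fun hU => (measure_mono hEU).trans (hopen U hU)

end Cylinders

section ProductStructure

variable {m : ℕ} {A : Fin m → Fin m → Prop} {μ : Measure (SFT A)}

/-- The point with the past of `p.1` and the future of `p.2` if these points have the same symbol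
in position `0`; otherwise the junk value `p.1`. -/
def bracket (p : SFT A × SFT A) : SFT A :=
  ⟨fun i => if p.1.1 0 = p.2.1 0 ∧ 0 < i then p.2.1 i else p.1.1 i, fun i => by
    beta_reduce
    by_cases h : p.1.1 0 = p.2.1 0
    · rcases lt_trichotomy i 0 with hi | rfl | hi
      · rw [if_neg (by omega), if_neg (by omega)]
        exact p.1.2 i
      · rw [if_neg (by omega), if_pos ⟨h, by omega⟩, h]
        exact p.2.2 0
      · rw [if_pos ⟨h, hi⟩, if_pos ⟨h, by omega⟩]
        exact p.2.2 i
    · rw [if_neg fun h' => h h'.1, if_neg fun h' => h h'.1]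
      exact p.1.2 i⟩

lemma bracket_apply_of_nonpos (p : SFT A × SFT A) {i : ℤ} (hi : i ≤ 0) :
    (bracket p).1 i = p.1.1 i :=
  if_neg fun h => (h.2.trans_le hi).false

lemma bracket_apply_of_nonneg {p : SFT A × SFT A} (h : p.1.1 0 = p.2.1 0) {i : ℤ} (hi : 0 ≤ i) :
    (bracket p).1 i = p.2.1 i := by
  rcases hi.eq_or_lt with rfl | hi
  · rw [bracket_apply_of_nonpos p le_rfl, h]
  · exact if_pos ⟨h, hi⟩

lemma measurableSet_sameSymbol : MeasurableSet {p : SFT A × SFT A | p.1.1 0 = p.2.1 0} :=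
  measurableSet_eq_fun ((continuous_coord 0).measurable.comp measurable_fst)
    ((continuous_coord 0).measurable.comp measurable_snd)

lemma measurable_bracket : Measurable (bracket (A := A)) := by
  refine Measurable.subtype_mk (measurable_pi_lambda _ fun i => ?_)
  exact Measurable.ite (measurableSet_sameSymbol.inter (MeasurableSet.const (0 < i)))
    ((continuous_coord i).measurable.comp measurable_snd)
    ((continuous_coord i).measurable.comp measurable_fst)

/-- The law of the bracket of two independent `μ`-distributed points, on the event that their
symbols in position `0` agree. -/
def bracketMeasure (μ : Measure (SFT A)) : Measure (SFT A) :=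
  ((μ.prod μ).restrict {p | p.1.1 0 = p.2.1 0}).map bracket

instance [IsFiniteMeasure μ] : IsFiniteMeasure (bracketMeasure μ) := by
  unfold bracketMeasure; infer_instance

lemma bracketMeasure_twoSidedCylinder [SFinite μ] (x : SFT A) (n k : ℕ) :
    bracketMeasure μ (twoSidedCylinder x n k) =
      μ (twoSidedCylinder x n 0) * μ (cylinder x (k + 1)) := by
  have hmeas := measurableSet_twoSidedCylinder x n k
  rw [bracketMeasure, Measure.map_apply measurable_bracket hmeas,
    Measure.restrict_apply (measurable_bracket hmeas), ← Measure.prod_prod]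
  congr 1
  ext p
  constructor
  · rintro ⟨hb, h : p.1.1 0 = p.2.1 0⟩
    refine ⟨fun i h₀ h₁ => ?_, fun i h₀ h₁ => ?_⟩
    · rw [← bracket_apply_of_nonpos p (by simpa using h₁)]
      exact hb i h₀ (by push_cast at h₁; omega)
    · rw [← bracket_apply_of_nonneg h h₀]
      exact hb i (by omega) (by push_cast at h₁; omega)
  · rintro ⟨hpast, hfuture⟩
    have h : p.1.1 0 = p.2.1 0 :=
      (hpast 0 (by simp) (by simp)).trans (hfuture 0 le_rfl (by positivity)).symm
    refine ⟨fun i h₀ h₁ => ?_, h⟩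
    rcases le_total i 0 with hi | hi
    · rw [bracket_apply_of_nonpos p hi]
      exact hpast i h₀ (by simpa using hi)
    · rw [bracket_apply_of_nonneg h hi]
      exact hfuture i hi (by push_cast; omega)

/-- A measure `μ` has local product structure with constant `D` if it is comparable, up to the
factor `D`, to the measure under which past and future are independent given the symbol in
position `0`, weighted by the probability of this symbol. -/
structure HasLocalProductStructure (μ : Measure (SFT A)) (D : NNReal) : Prop where
  le_bracketMeasure : μ ≤ D • bracketMeasure μ
  bracketMeasure_le : bracketMeasure μ ≤ D • μ

theorem HasLocalProductStructure.compProd_le {D : NNReal} (hμ : HasLocalProductStructure μ D)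
    [SFinite μ] {Z : Type*} [MeasurableSpace Z] {κ : Kernel (SFT A) Z} [IsSFiniteKernel κ]
    {S : Set (SFT A)} (hS : S ∈ ae μ) (hκ : ∀ x ∈ S, ∀ y ∈ S, y ∈ Wuloc x → κ x = κ y)
    {E : Set (SFT A × Z)} (hE : MeasurableSet E)
    (hfuture : ∀ x, ∀ y ∈ Wsloc x, Prod.mk y ⁻¹' E = Prod.mk x ⁻¹' E) :
    (μ ⊗ₘ κ) E ≤ D * ∫⁻ z, (μ ⊗ₘ κ) (cylinder z 1 ×ˢ (Prod.mk z ⁻¹' E)) ∂μ := by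
  have hbracket : ∀ᵐ p ∂(μ.prod μ).restrict {p | p.1.1 0 = p.2.1 0}, bracket p ∈ S :=
    ae_of_ae_map measurable_bracket.aemeasurable
      ((Measure.absolutelyContinuous_of_le hμ.bracketMeasure_le).trans
        Measure.smul_absolutelyContinuous |>.ae_le hS)
  have hfst : ∀ᵐ p ∂(μ.prod μ).restrict {p | p.1.1 0 = p.2.1 0}, p.1 ∈ S :=
    ae_restrict_of_ae (Measure.quasiMeasurePreserving_fst.ae hS)
  have hF : Measurable fun p : SFT A × SFT A => κ p.1 (Prod.mk p.2 ⁻¹' E) :=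
    Kernel.measurable_kernel_prodMk_left (κ := Kernel.prodMkRight (SFT A) κ)
      (hE.preimage ((measurable_snd.comp measurable_fst).prodMk measurable_snd))
  calc (μ ⊗ₘ κ) E = ∫⁻ x, κ x (Prod.mk x ⁻¹' E) ∂μ := Measure.compProd_apply hE
    _ ≤ ∫⁻ x, κ x (Prod.mk x ⁻¹' E) ∂(D • bracketMeasure μ) :=
        lintegral_mono' hμ.le_bracketMeasure le_rfl
    _ = D * ∫⁻ p in {p | p.1.1 0 = p.2.1 0}, κ (bracket p) (Prod.mk (bracket p) ⁻¹' E)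
          ∂(μ.prod μ) := by
        rw [lintegral_smul_measure, bracketMeasure,
          lintegral_map (Kernel.measurable_kernel_prodMk_left hE) measurable_bracket]
        rfl
    _ = D * ∫⁻ p in {p | p.1.1 0 = p.2.1 0}, κ p.1 (Prod.mk p.2 ⁻¹' E) ∂(μ.prod μ) := by
        congr 1
        refine lintegral_congr_ae ?_
        filter_upwards [hbracket, hfst, ae_restrict_mem measurableSet_sameSymbol] with p hb h₁ hp
        rw [hκ _ h₁ _ hb fun i hi => bracket_apply_of_nonpos p hi,
          hfuture p.2 _ fun i hi => bracket_apply_of_nonneg hp hi]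
    _ = D * ∫⁻ z, ∫⁻ y in cylinder z 1, κ y (Prod.mk z ⁻¹' E) ∂μ ∂μ := by
        rw [← lintegral_indicator measurableSet_sameSymbol,
          lintegral_prod_symm _ (hF.indicator measurableSet_sameSymbol).aemeasurable]
        congr! 3 with z
        rw [← lintegral_indicator (measurableSet_cylinder z 1)]
        congr! 2 with y
        simp only [Set.indicator, Set.mem_ofPred_eq, mem_cylinder_one]
    _ = D * ∫⁻ z, (μ ⊗ₘ κ) (cylinder z 1 ×ˢ (Prod.mk z ⁻¹' E)) ∂μ := by
        simp only [Measure.compProd_apply_prod (measurableSet_cylinder _ 1)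
          (measurable_prodMk_left hE)]

end ProductStructure

section QuasiBernoulli

variable {m : ℕ} {A : Fin m → Fin m → Prop} {μ : Measure (SFT A)}

/-- Quasi-Bernoulli measures: the invariant probability measures of full support for which the
measure of a concatenation of two words is comparable to the product of the measures of the
words. -/
structure IsQuasiBernoulli (μ : Measure (SFT A)) : Prop where
  isProbabilityMeasure : IsProbabilityMeasure μ
  invariant : MeasurePreserving (shift A) μ μ
  cylinder_pos : ∀ x n, 0 < μ.real (cylinder x n)
  exists_comparable : ∃ D : ℝ, 0 < D ∧ ∀ (n k : ℕ) (x : SFT A),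
    μ.real (cylinder x (n + k)) ≤
      D * (μ.real (cylinder x n) * μ.real (cylinder ((shift A)^[n] x) k)) ∧
    μ.real (cylinder x n) * μ.real (cylinder ((shift A)^[n] x) k) ≤
      D * μ.real (cylinder x (n + k))

theorem IsGibbs.isQuasiBernoulli (hμ : IsGibbs μ) : IsQuasiBernoulli μ := by
  obtain ⟨φ, -, P, C, hC, h⟩ := hμ.gibbs
  let g : ℕ → SFT A → ℝ := fun n x => Real.exp (birkhoffSum (shift A) φ n x - n * P)
  have hg : ∀ n x, 0 < g n x := fun n x => Real.exp_pos _
  have hg_add : ∀ n k x, g (n + k) x = g n x * g k ((shift A)^[n] x) := fun n k x => by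
    simp only [g]
    rw [← Real.exp_add, birkhoffSum_add]
    congr 1; push_cast; ring
  have hlower : ∀ n x, g n x ≤ C * μ.real (cylinder x n) := fun n x =>
    (inv_mul_le_iff₀ hC).1 ((le_div_iff₀ (hg n x)).1 (h n x).1)
  have hupper : ∀ n x, μ.real (cylinder x n) ≤ C * g n x := fun n x =>
    (div_le_iff₀ (hg n x)).1 (h n x).2
  refine ⟨hμ.isProbabilityMeasure, hμ.invariant,
    fun x n => pos_of_mul_pos_right ((hg n x).trans_le (hlower n x)) hC.le, C ^ 3, by positivity,
    fun n k x => ⟨?_, ?_⟩⟩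
  · calc μ.real (cylinder x (n + k)) ≤ C * (g n x * g k ((shift A)^[n] x)) :=
          (hupper _ _).trans_eq (by rw [hg_add])
      _ ≤ C * ((C * μ.real (cylinder x n)) * (C * μ.real (cylinder ((shift A)^[n] x) k))) := by
          gcongr
          exacts [hlower _ _, hlower _ _]
      _ = C ^ 3 * (μ.real (cylinder x n) * μ.real (cylinder ((shift A)^[n] x) k)) := by ring
  · calc μ.real (cylinder x n) * μ.real (cylinder ((shift A)^[n] x) k)
        ≤ (C * g n x) * (C * g k ((shift A)^[n] x)) := by
          gcongr
          exacts [hupper _ _, hupper _ _]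
      _ = C ^ 2 * g (n + k) x := by rw [hg_add]; ring
      _ ≤ C ^ 2 * (C * μ.real (cylinder x (n + k))) := by gcongr; exact hlower _ _
      _ = C ^ 3 * μ.real (cylinder x (n + k)) := by ring

lemma IsQuasiBernoulli.exists_pos_le_cylinder_one (hμ : IsQuasiBernoulli μ) :
    ∃ c : ℝ, 0 < c ∧ ∀ x, c ≤ μ.real (cylinder x 1) := by
  have := hμ.isProbabilityMeasure
  have := nonempty_of_isProbabilityMeasure μ
  have hloc : IsLocallyConstant fun x : SFT A => μ.real (cylinder x 1) := by
    refine (IsLocallyConstant.iff_eventually_eq _).2 fun x => ?_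
    filter_upwards [eventually_coord_eq 0 x] with y hy
    rw [cylinder_eq_of_mem (mem_cylinder_one.2 hy)]
  obtain ⟨x, -, hx⟩ := isCompact_univ.exists_isMinOn Set.univ_nonempty hloc.continuous.continuousOn
  exact ⟨μ.real (cylinder x 1), hμ.cylinder_pos x 1, fun y => hx (Set.mem_univ y)⟩

lemma IsQuasiBernoulli.exists_measureReal_cylinder_shift_le (hμ : IsQuasiBernoulli μ) :
    ∃ D : ℝ, 0 < D ∧
      ∀ n x, μ.real (cylinder (shift A x) n) ≤ D * μ.real (cylinder x (n + 1)) := by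
  obtain ⟨c, hc, hcyl⟩ := hμ.exists_pos_le_cylinder_one
  obtain ⟨D, hD, hcomp⟩ := hμ.exists_comparable
  refine ⟨D / c, by positivity, fun n x => ?_⟩
  rw [div_mul_eq_mul_div, le_div_iff₀' hc, add_comm n]
  calc c * μ.real (cylinder (shift A x) n)
      ≤ μ.real (cylinder x 1) * μ.real (cylinder (shift A x) n) := by gcongr; exact hcyl x
    _ ≤ D * μ.real (cylinder x (1 + n)) := (hcomp 1 n x).2

lemma IsQuasiBernoulli.exists_comparable_overlap (hμ : IsQuasiBernoulli μ) :
    ∃ D : ℝ, 0 < D ∧ ∀ (n k : ℕ) (x : SFT A),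
      μ.real (cylinder x (n + (k + 1))) ≤
        D * (μ.real (cylinder x (n + 1)) * μ.real (cylinder ((shift A)^[n] x) (k + 1))) ∧
      μ.real (cylinder x (n + 1)) * μ.real (cylinder ((shift A)^[n] x) (k + 1)) ≤
        D * μ.real (cylinder x (n + (k + 1))) := by
  have := hμ.isProbabilityMeasure
  obtain ⟨c, hc, hcyl⟩ := hμ.exists_pos_le_cylinder_one
  obtain ⟨D, hD, hcomp⟩ := hμ.exists_comparable
  refine ⟨D + D ^ 2 / c, by positivity, fun n k x => ⟨?_, ?_⟩⟩
  · have hlast : μ.real (cylinder x n) ≤ D / c * μ.real (cylinder x (n + 1)) := by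
      rw [div_mul_eq_mul_div, le_div_iff₀ hc]
      refine le_trans ?_ (hcomp n 1 x).2
      gcongr
      exact hcyl _
    calc μ.real (cylinder x (n + (k + 1)))
        ≤ D * (μ.real (cylinder x n) * μ.real (cylinder ((shift A)^[n] x) (k + 1))) :=
          (hcomp n (k + 1) x).1
      _ ≤ D * (D / c * μ.real (cylinder x (n + 1)) *
            μ.real (cylinder ((shift A)^[n] x) (k + 1))) := by gcongr
      _ = D ^ 2 / c *
            (μ.real (cylinder x (n + 1)) * μ.real (cylinder ((shift A)^[n] x) (k + 1))) := by ring
      _ ≤ _ := by gcongr; exact le_add_of_nonneg_left hD.le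
  · calc μ.real (cylinder x (n + 1)) * μ.real (cylinder ((shift A)^[n] x) (k + 1))
        ≤ μ.real (cylinder x n) * μ.real (cylinder ((shift A)^[n] x) (k + 1)) := by
          gcongr
          · exact measure_ne_top _ _
          · exact cylinder_antitone x n.le_succ
      _ ≤ D * μ.real (cylinder x (n + (k + 1))) := (hcomp n (k + 1) x).2
      _ ≤ _ := by gcongr; exact le_add_of_nonneg_right (by positivity)

theorem IsQuasiBernoulli.exists_hasLocalProductStructure (hμ : IsQuasiBernoulli μ) :
    ∃ D, HasLocalProductStructure μ D := by
  have := hμ.isProbabilityMeasure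
  obtain ⟨D, hD, hcomp⟩ := hμ.exists_comparable_overlap
  have hsym : ∀ (x : SFT A) n, μ (twoSidedCylinder x n n) =
      ENNReal.ofReal (μ.real (cylinder ((shift A).symm^[n] x) (n + (n + 1)))) := fun x n => by
    rw [measure_twoSidedCylinder hμ.invariant, ofReal_measureReal]
  have hbracket : ∀ (x : SFT A) n, bracketMeasure μ (twoSidedCylinder x n n) =
      ENNReal.ofReal (μ.real (cylinder ((shift A).symm^[n] x) (n + 1)) *
        μ.real (cylinder ((shift A)^[n] ((shift A).symm^[n] x)) (n + 1))) := fun x n => by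
    rw [bracketMeasure_twoSidedCylinder, measure_twoSidedCylinder hμ.invariant,
      ENNReal.ofReal_mul measureReal_nonneg, ofReal_measureReal, ofReal_measureReal,
      shift_iterate_symm_iterate, zero_add]
  refine ⟨D.toNNReal, measure_le_of_twoSidedCylinder_le fun x n => ?_,
    measure_le_of_twoSidedCylinder_le fun x n => ?_⟩
  · rw [Measure.smul_apply, ENNReal.smul_def, smul_eq_mul, hsym, hbracket,
      ← ENNReal.ofReal, ← ENNReal.ofReal_mul hD.le]
    exact ENNReal.ofReal_le_ofReal (hcomp n n _).1
  · rw [Measure.smul_apply, ENNReal.smul_def, smul_eq_mul, hsym, hbracket,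
      ← ENNReal.ofReal, ← ENNReal.ofReal_mul hD.le]
    exact ENNReal.ofReal_le_ofReal (hcomp n n _).2

end QuasiBernoulli

/-! ### Strong irreducibility and the mass of linear subspaces -/

section Irreducibility

variable {m d : ℕ} {A : Fin m → Fin m → Prop} {M L : SFT A → GLd d}

lemma mem_mapSubspace {g : GLd d} {W : Submodule ℝ (Vec d)} {v : Vec d} :
    v ∈ mapSubspace g W ↔ g⁻¹.1 v ∈ W := by
  refine ⟨?_, fun h => ⟨_, h, units_apply_inv_apply g v⟩⟩
  rintro ⟨w, hw, rfl⟩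
  exact (units_inv_apply_apply g w).symm ▸ hw

lemma mapSubspace_mul (g h : GLd d) (W : Submodule ℝ (Vec d)) :
    mapSubspace (g * h) W = mapSubspace g (mapSubspace h W) :=
  Submodule.map_comp _ _ W

lemma mapSubspace_mapSubspace_inv (g : GLd d) (W : Submodule ℝ (Vec d)) :
    mapSubspace g (mapSubspace g⁻¹ W) = W := by
  rw [← mapSubspace_mul, mul_inv_cancel]
  exact Submodule.map_id W

lemma mapSubspace_injective (g : GLd d) : Function.Injective (mapSubspace g) :=
  Submodule.map_injective_of_injective (ContinuousLinearEquiv.unitsEquiv ℝ (Vec d) g).injective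

lemma finrank_mapSubspace (g : GLd d) (W : Submodule ℝ (Vec d)) :
    Module.finrank ℝ (mapSubspace g W) = Module.finrank ℝ W :=
  (Submodule.equivMapOfInjective _
    (ContinuousLinearEquiv.unitsEquiv ℝ (Vec d) g).injective W).finrank_eq.symm

lemma grassDist_mapSubspace_le (g : GLd d) (W : Submodule ℝ (Vec d)) :
    grassDist (mapSubspace g W) W ≤ ‖1 - (g⁻¹).1‖ := by
  refine ContinuousLinearMap.opNorm_le_bound _ (norm_nonneg _) fun v => ?_
  set u := (mapSubspace g W).starProjection v
  have hu : (Wᗮ).starProjection (g⁻¹.1 u) = 0 :=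
    (Submodule.starProjection_apply_eq_zero_iff _).2 (Submodule.le_orthogonal_orthogonal W
      (mem_mapSubspace.1 (Submodule.starProjection_apply_mem _ v)))
  calc ‖(Wᗮ).starProjection u‖ = ‖(Wᗮ).starProjection ((1 - g⁻¹.1) u)‖ := by
        rw [sub_apply, map_sub, hu, sub_zero, one_apply_eq_self]
    _ ≤ ‖(1 - g⁻¹.1) u‖ := Submodule.norm_starProjection_apply_le _ _
    _ ≤ ‖1 - g⁻¹.1‖ * ‖u‖ := ContinuousLinearMap.le_opNorm _ _
    _ ≤ ‖1 - g⁻¹.1‖ * ‖v‖ := by gcongr; exact Submodule.norm_starProjection_apply_le _ _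

lemma tendsto_grassDist_mapSubspace {X : Type*} [TopologicalSpace X] {g : X → GLd d}
    (hg : Continuous g) (x : X) (W : Submodule ℝ (Vec d)) :
    Tendsto (fun y => grassDist (mapSubspace (g y) W) (mapSubspace (g x) W)) (𝓝 x) (𝓝 0) := by
  have hlim : Tendsto (fun y => ‖1 - ((g y * (g x)⁻¹)⁻¹).1‖) (𝓝 x) (𝓝 0) := by
    have hcont : Continuous fun y => ‖1 - ((g y * (g x)⁻¹)⁻¹).1‖ :=
      (continuous_const.sub (Units.continuous_val.comp (hg.mul continuous_const).inv)).norm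
    simpa using hcont.tendsto x
  refine squeeze_zero (fun y => norm_nonneg _) (fun y => ?_) hlim
  have hW : mapSubspace (g y) W = mapSubspace (g y * (g x)⁻¹) (mapSubspace (g x) W) := by
    rw [← mapSubspace_mul, inv_mul_cancel_right]
  rw [hW]
  exact grassDist_mapSubspace_le _ _

lemma exists_enumeration {α : Type*} {s : Set α} (hs : s.Finite) {n : ℕ} (h : s.ncard = n) :
    ∃ e : Fin n → α, Function.Injective e ∧ Set.range e = s := by
  have := hs.to_subtype
  let e := (Finite.equivFinOfCardEq h).symm
  exact ⟨fun i => e i, Subtype.val_injective.comp e.injective, by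
    rw [← Function.comp_def, e.surjective.range_comp, Subtype.range_coe]⟩

theorem StronglyIrreducible.false_of_invariant_family
    (hirr : StronglyIrreducible M (trivHolonomy L) (trivHolonomy L)) (hL : Continuous L)
    {k n : ℕ} (hk : 0 < k) (hkd : k < d) (hn : 0 < n) {U : Fin m → Set (Submodule ℝ (Vec d))}
    (hfin : ∀ a, (U a).Finite) (hdim : ∀ a, ∀ W ∈ U a, Module.finrank ℝ W = k)
    (hcard : ∀ x : SFT A, (U (x.1 0)).ncard = n)
    (hinv : ∀ x : SFT A, mapSubspace (L (shift A x) * M x * (L x)⁻¹) '' U (x.1 0) = U (x.1 1)) :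
    False := by
  choose! e he_inj he_range using fun a (h : (U a).ncard = n) => exists_enumeration (hfin a) h
  have hV : ∀ x : SFT A, (Set.range fun i => mapSubspace (L x)⁻¹ (e (x.1 0) i)) =
      mapSubspace (L x)⁻¹ '' U (x.1 0) := fun x => by
    rw [← he_range _ (hcard x), ← Set.range_comp]; rfl
  have hhol : ∀ x y : SFT A, y.1 0 = x.1 0 → mapSubspace (trivHolonomy L x y) ''
      (Set.range fun i => mapSubspace (L x)⁻¹ (e (x.1 0) i)) =
      Set.range fun i => mapSubspace (L y)⁻¹ (e (y.1 0) i) := fun x y hxy => by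
    rw [hV, hV, Set.image_image, hxy]
    simp only [trivHolonomy, mapSubspace_mul, mapSubspace_mapSubspace_inv]
  refine hirr ⟨k, n, fun i x => mapSubspace (L x)⁻¹ (e (x.1 0) i), hk, hkd, hn, fun i x => ?_,
    fun x => (mapSubspace_injective _).comp (he_inj _ (hcard x)), fun i x => ?_, fun x => ?_,
    fun x y hy => hhol x y (hy 0 le_rfl), fun x y hy => hhol x y (hy 0 le_rfl)⟩
  · rw [finrank_mapSubspace]
    exact hdim _ _ (he_range _ (hcard x) ▸ Set.mem_range_self i)
  · refine (tendsto_grassDist_mapSubspace hL.inv x (e (x.1 0) i)).congr' ?_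
    filter_upwards [eventually_coord_eq 0 x] with y hy
    rw [hy, Pi.inv_apply, Pi.inv_apply]
  · have hshift : U ((shift A x).1 0) = U (x.1 1) := rfl
    simp only [hV, hshift, ← hinv x, Set.image_image, ← mapSubspace_mul]
    exact Set.image_congr fun W _ => by group

end Irreducibility

section ProjSet

variable {d : ℕ}

/-- The set of the lines contained in a linear subspace. -/
def projSet (W : Submodule ℝ (Vec d)) : Set (Proj d) := {p | p.rep ∈ W}

lemma mk_mem_projSet {W : Submodule ℝ (Vec d)} {v : Vec d} (hv : v ≠ 0) :
    Projectivization.mk ℝ v hv ∈ projSet W ↔ v ∈ W := by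
  obtain ⟨c, hc⟩ := Projectivization.exists_smul_eq_mk_rep ℝ v hv
  change (Projectivization.mk ℝ v hv).rep ∈ W ↔ v ∈ W
  rw [← hc]
  exact W.smul_mem_iff c.ne_zero

lemma isClosed_projSet (W : Submodule ℝ (Vec d)) : IsClosed (projSet W) := by
  rw [← isOpenQuotientMap_mk'.isQuotientMap.isClosed_preimage]
  have hpre : Projectivization.mk' ℝ ⁻¹' projSet W =
      (fun v : {v : Vec d // v ≠ 0} => v.1) ⁻¹' (W : Set (Vec d)) :=
    Set.ext fun v => mk_mem_projSet v.2
  rw [hpre]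
  exact (Submodule.closed_of_finiteDimensional W).preimage continuous_subtype_val

lemma measurableSet_projSet (W : Submodule ℝ (Vec d)) : MeasurableSet (projSet W) :=
  (isClosed_projSet W).measurableSet

lemma projSet_bot : projSet (⊥ : Submodule ℝ (Vec d)) = ∅ :=
  Set.eq_empty_of_forall_notMem fun p => p.rep_nonzero

lemma projMap_mem_projSet {g : GLd d} {W : Submodule ℝ (Vec d)} {p : Proj d} :
    projMap g p ∈ projSet W ↔ p ∈ projSet (mapSubspace g⁻¹ W) := by
  induction p using Projectivization.ind with
  | h v hv => rw [projMap_mk, mk_mem_projSet, mk_mem_projSet, mem_mapSubspace, inv_inv]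

lemma finite_setOf_le_measure_projSet {η : Measure (Proj d)} [IsFiniteMeasure η] {k : ℕ}
    (hmin : ∀ W : Submodule ℝ (Vec d), Module.finrank ℝ W < k → η (projSet W) = 0)
    {c : ENNReal} (hc : 0 < c) :
    {W : Submodule ℝ (Vec d) | Module.finrank ℝ W = k ∧ c ≤ η (projSet W)}.Finite := by
  have hdisj : Pairwise (Function.onFun (AEDisjoint η)
      fun W : {W : Submodule ℝ (Vec d) // Module.finrank ℝ W = k} => projSet W.1) := by
    intro W W' hne
    refine hmin (W.1 ⊓ W'.1) (lt_of_not_ge fun hk => hne (Subtype.ext ?_))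
    have hleft : W.1 ⊓ W'.1 = W.1 := Submodule.eq_of_le_of_finrank_le inf_le_left (W.2.trans_le hk)
    have hright : W.1 ⊓ W'.1 = W'.1 :=
      Submodule.eq_of_le_of_finrank_le inf_le_right (W'.2.trans_le hk)
    exact hleft.symm.trans hright
  have hfin := Measure.finite_const_le_meas_of_disjoint_iUnion₀ η hc
    (fun W : {W : Submodule ℝ (Vec d) // Module.finrank ℝ W = k} =>
      (measurableSet_projSet W.1).nullMeasurableSet) hdisj (measure_ne_top _ _)
  exact (hfin.image Subtype.val).subset fun W hW => ⟨⟨W, hW.1⟩, hW.2, rfl⟩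

lemma exists_minimal_charged {η : Measure (Proj d)} {W : Submodule ℝ (Vec d)} (hW : W ≠ ⊤)
    (hne : η (projSet W) ≠ 0) : ∃ W₁ : Submodule ℝ (Vec d), 0 < Module.finrank ℝ W₁ ∧
      Module.finrank ℝ W₁ < d ∧ η (projSet W₁) ≠ 0 ∧
      ∀ W' : Submodule ℝ (Vec d), Module.finrank ℝ W' < Module.finrank ℝ W₁ →
        η (projSet W') = 0 := by
  obtain ⟨W₁, hW₁, hmin⟩ :=
    (InvImage.wf (fun W : Submodule ℝ (Vec d) => Module.finrank ℝ W) wellFounded_lt).has_min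
      {W | η (projSet W) ≠ 0} ⟨W, hne⟩
  refine ⟨W₁, Nat.pos_of_ne_zero fun h => ?_, ?_, hW₁, fun W' hlt => not_not.1 (hmin W' · hlt)⟩
  · rw [Submodule.finrank_eq_zero] at h
    exact hW₁ (by rw [h, projSet_bot, measure_empty])
  · exact (not_lt.1 (hmin W hne)).trans_lt
      ((Submodule.finrank_lt hW).trans_eq finrank_euclideanSpace_fin)

end ProjSet

section MaxMass

variable {m d : ℕ} {A : Fin m → Fin m → Prop} {μ : Measure (SFT A)}
  {ν : Measure (SFT A × Proj d)} {N : SFT A → GLd d} {B : Fin m → Fin m → GLd d}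

/-- The supremum of the conditional masses `ν(C × P(W)) / μ(C)` over the cylinders
`C = [a, x_1, …, x_n]`; for a measure `ν` over `μ`, this is the essential supremum of the mass of
`P(W)` for the conditional measures of `ν` given a future which starts with `a`. -/
def maxMass (μ : Measure (SFT A)) (ν : Measure (SFT A × Proj d)) (a : Fin m)
    (W : Submodule ℝ (Vec d)) : ℝ :=
  ⨆ z : {x : SFT A // x.1 0 = a} × ℕ,
    ν.real (cylinder z.1.1 (z.2 + 1) ×ˢ projSet W) / μ.real (cylinder z.1.1 (z.2 + 1))

section Bounds

variable (hpos : ∀ x n, 0 < μ.real (cylinder x n))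

include hpos

lemma maxMass_le {W : Submodule ℝ (Vec d)} {C : ℝ} (x : SFT A)
    (h : ∀ (y : SFT A) n, y.1 0 = x.1 0 →
      ν.real (cylinder y (n + 1) ×ˢ projSet W) ≤ C * μ.real (cylinder y (n + 1))) :
    maxMass μ ν (x.1 0) W ≤ C := by
  have : Nonempty {y : SFT A // y.1 0 = x.1 0} := ⟨⟨x, rfl⟩⟩
  exact ciSup_le fun z => (div_le_iff₀ (hpos _ _)).2 (h _ _ z.1.2)

variable {D : ℝ} (hprod : ∀ x n (W : Submodule ℝ (Vec d)), ν.real (cylinder x n ×ˢ projSet W) ≤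
  D * ν.snd.real (projSet W) * μ.real (cylinder x n))

include hprod

lemma measureReal_le_maxMass_mul (x : SFT A) (n : ℕ) (W : Submodule ℝ (Vec d)) :
    ν.real (cylinder x (n + 1) ×ˢ projSet W) ≤
      maxMass μ ν (x.1 0) W * μ.real (cylinder x (n + 1)) := by
  refine (div_le_iff₀ (hpos _ _)).1
    (le_ciSup (f := fun z : {y : SFT A // y.1 0 = x.1 0} × ℕ =>
      ν.real (cylinder z.1.1 (z.2 + 1) ×ˢ projSet W) / μ.real (cylinder z.1.1 (z.2 + 1)))
      ⟨D * ν.snd.real (projSet W), ?_⟩ (⟨x, rfl⟩, n))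
  rintro _ ⟨z, rfl⟩
  exact (div_le_iff₀ (hpos _ _)).2 (hprod _ _ _)

lemma exists_maxMass_pos [IsFiniteMeasure ν] {W : Submodule ℝ (Vec d)}
    (hW : ν.snd (projSet W) ≠ 0) : ∃ x : SFT A, 0 < maxMass μ ν (x.1 0) W := by
  contrapose! hW
  rw [Measure.snd_apply (measurableSet_projSet W)]
  refine measure_null_of_locally_null _ fun q _ => ⟨_, inter_mem_nhdsWithin _
    (continuous_fst.continuousAt.eventually (eventually_coord_eq 0 q.1)), ?_⟩
  have hnull : ν (cylinder q.1 1 ×ˢ projSet W) = 0 := by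
    refine (measureReal_eq_zero_iff).1 (le_antisymm ?_ measureReal_nonneg)
    exact (measureReal_le_maxMass_mul hpos hprod q.1 0 W).trans
      (mul_nonpos_of_nonpos_of_nonneg (hW q.1) measureReal_nonneg)
  refine measure_mono_null (fun r hr => ?_) hnull
  exact ⟨mem_cylinder_one.2 hr.2, hr.1⟩

lemma finite_setOf_le_maxMass [IsFiniteMeasure ν] (hD : 0 < D) {k : ℕ}
    (hmin : ∀ W : Submodule ℝ (Vec d), Module.finrank ℝ W < k → ν.snd (projSet W) = 0)
    {c : ℝ} (hc : 0 < c) :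
    {W : Submodule ℝ (Vec d) | Module.finrank ℝ W = k ∧
      ∃ x : SFT A, c ≤ maxMass μ ν (x.1 0) W}.Finite := by
  refine (finite_setOf_le_measure_projSet hmin (ENNReal.ofReal_pos.2 (div_pos hc hD))).subset ?_
  rintro W ⟨hW, x, hx⟩
  refine ⟨hW, ENNReal.ofReal_le_of_le_toReal ((div_le_iff₀' hD).2 ?_)⟩
  exact hx.trans (maxMass_le hpos x fun y n _ => hprod y (n + 1) W)

lemma exists_isMax_maxMass [IsFiniteMeasure ν] (hD : 0 < D) {k : ℕ}
    (hmin : ∀ W : Submodule ℝ (Vec d), Module.finrank ℝ W < k → ν.snd (projSet W) = 0)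
    {W₁ : Submodule ℝ (Vec d)} (hW₁ : Module.finrank ℝ W₁ = k) (hne : ν.snd (projSet W₁) ≠ 0) :
    ∃ (x₀ : SFT A) (W₀ : Submodule ℝ (Vec d)), Module.finrank ℝ W₀ = k ∧
      0 < maxMass μ ν (x₀.1 0) W₀ ∧ ∀ (x : SFT A) (W : Submodule ℝ (Vec d)),
        Module.finrank ℝ W = k → maxMass μ ν (x.1 0) W ≤ maxMass μ ν (x₀.1 0) W₀ := by
  obtain ⟨x₁, hx₁⟩ := exists_maxMass_pos hpos hprod hne
  let S : Set (Fin m × Submodule ℝ (Vec d)) := {p | Module.finrank ℝ p.2 = k ∧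
    (∃ x : SFT A, x.1 0 = p.1) ∧ maxMass μ ν (x₁.1 0) W₁ ≤ maxMass μ ν p.1 p.2}
  have hS : S.Finite := by
    refine (Set.finite_univ.prod
      (finite_setOf_le_maxMass hpos hprod hD hmin hx₁)).subset ?_
    rintro ⟨_, W⟩ ⟨hW, ⟨x, rfl⟩, hx⟩
    exact ⟨Set.mem_univ _, hW, x, hx⟩
  obtain ⟨⟨_, W₀⟩, ⟨hW₀, ⟨x₀, rfl⟩, hle⟩, hmax⟩ := Set.exists_max_image S
    (fun p => maxMass μ ν p.1 p.2) hS ⟨(x₁.1 0, W₁), hW₁, ⟨x₁, rfl⟩, le_rfl⟩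
  refine ⟨x₀, W₀, hW₀, hx₁.trans_le hle, fun x W hW => ?_⟩
  rcases le_total (maxMass μ ν (x₁.1 0) W₁) (maxMass μ ν (x.1 0) W) with h | h
  · exact hmax (x.1 0, W) ⟨hW, ⟨x, rfl⟩, h⟩
  · exact h.trans hle

end Bounds

section Step

lemma measureReal_eq_sum_inter_shift_preimage [IsFiniteMeasure μ]
    (hμ : MeasurePreserving (shift A) μ μ) {C : Set (SFT A)} (hC : MeasurableSet C) :
    μ.real C = ∑ c : Fin m, μ.real ({x | x.1 0 = c} ∩ shift A ⁻¹' C) := by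
  rw [← hμ.measureReal_preimage hC.nullMeasurableSet, ← measureReal_iUnion_fintype]
  · exact congrArg _ (Set.ext fun x => by simp)
  · exact fun c c' hcc' => Set.disjoint_left.2 fun x hx hx' => hcc' (hx.1.symm.trans hx'.1)
  · exact fun c => ((continuous_coord 0).measurable (measurableSet_singleton c)).inter
      (continuous_shift.measurable hC)

variable [IsFiniteMeasure μ] [IsFiniteMeasure ν] (hμ : MeasurePreserving (shift A) μ μ)
  (hN : ∀ x, N x = B (x.1 0) (x.1 1)) (hν : MeasurePreserving (projFibered N) ν ν)
  {k : ℕ} {H : ℝ} (hH : ∀ x n (W : Submodule ℝ (Vec d)), Module.finrank ℝ W = k →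
    ν.real (cylinder x (n + 1) ×ˢ projSet W) ≤ H * μ.real (cylinder x (n + 1)))

include hμ hN hν hH

lemma measureReal_cylinder_shift_le (z : SFT A) (n : ℕ) {W : Submodule ℝ (Vec d)}
    (hW : Module.finrank ℝ W = k) :
    ν.real (cylinder (shift A z) (n + 1) ×ˢ projSet W) ≤
      ν.real (cylinder z (n + 2) ×ˢ projSet (mapSubspace (N z)⁻¹ W)) +
        H * (μ.real (cylinder (shift A z) (n + 1)) - μ.real (cylinder z (n + 2))) := by
  classical
  let C := cylinder (shift A z) (n + 1)
  have hC : MeasurableSet C := measurableSet_cylinder _ _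
  let E : Fin m → Set (SFT A) := fun c => {x | x.1 0 = c} ∩ shift A ⁻¹' C
  have hE_eq : ∀ c, ∀ u ∈ E c, E c = cylinder u (n + 2) := fun c u hu => by
    rw [cylinder_succ, cylinder_eq_of_mem hu.2]
    exact congrArg (· ∩ _) (Set.ext fun x => by rw [mem_cylinder_one, ← hu.1]; rfl)
  have hμC : μ.real C = ∑ c, μ.real (E c) := measureReal_eq_sum_inter_shift_preimage hμ hC
  have hνC : ν.real (C ×ˢ projSet W) ≤
      ∑ c, ν.real (E c ×ˢ projSet (mapSubspace (B c (z.1 1))⁻¹ W)) := by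
    rw [← hν.measureReal_preimage (hC.prod (measurableSet_projSet W)).nullMeasurableSet]
    refine (measureReal_mono ?_).trans (measureReal_iUnion_fintype_le _)
    rintro ⟨u, p⟩ ⟨hu, hp⟩
    have hu₁ : u.1 1 = z.1 1 := hu 0 le_rfl (by positivity)
    refine Set.mem_iUnion.2 ⟨u.1 0, ⟨rfl, hu⟩, ?_⟩
    rw [← hu₁, ← hN]
    exact projMap_mem_projSet.1 hp
  have hterm : ∀ c, ν.real (E c ×ˢ projSet (mapSubspace (B c (z.1 1))⁻¹ W)) ≤
      H * μ.real (E c) := fun c => by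
    rcases (E c).eq_empty_or_nonempty with hc | ⟨u, hu⟩
    · simp [hc]
    · rw [hE_eq c u hu]
      exact hH u (n + 1) _ ((finrank_mapSubspace _ _).trans hW)
  rw [hN z, ← hE_eq (z.1 0) z ⟨rfl, fun _ _ _ => rfl⟩]
  refine hνC.trans ?_
  change _ ≤ _ + H * (μ.real C - _)
  rw [hμC, ← Finset.add_sum_erase _ _ (Finset.mem_univ (z.1 0)),
    ← Finset.add_sum_erase _ (fun c => μ.real (E c)) (Finset.mem_univ (z.1 0)),
    add_sub_cancel_left, Finset.mul_sum]
  gcongr with c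
  exact hterm c

end Step

lemma exists_shift_mem_Wsloc {x y : SFT A} (h : x.1 0 = y.1 1) :
    ∃ z : SFT A, z.1 0 = y.1 0 ∧ z.1 1 = y.1 1 ∧ shift A z ∈ Wsloc x := by
  have hsymb : (shift A y).1 0 = x.1 0 := h.symm
  refine ⟨(shift A).symm (bracket (shift A y, x)), ?_, ?_, fun i hi => ?_⟩
  · exact (bracket_apply_of_nonpos (shift A y, x) (by omega : (0 : ℤ) - 1 ≤ 0)).trans
      (congrArg y.1 (by omega))
  · exact (bracket_apply_of_nonpos (shift A y, x) (by omega : (1 : ℤ) - 1 ≤ 0)).trans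
      (congrArg y.1 (by omega))
  · rw [Equiv.apply_symm_apply]
    exact bracket_apply_of_nonneg hsymb hi

/-- A maximum principle: the future `[y_1, …]` has the preimages `[c, y_1, …]`, among which the one
with `c = y_0` has a definite proportion of the mass. -/
lemma maxMass_le_sub (hμ : IsQuasiBernoulli μ) [IsFiniteMeasure ν]
    (hN : ∀ x, N x = B (x.1 0) (x.1 1)) (hν : MeasurePreserving (projFibered N) ν ν)
    {D : ℝ} (hprod : ∀ x n (W : Submodule ℝ (Vec d)), ν.real (cylinder x n ×ˢ projSet W) ≤
      D * ν.snd.real (projSet W) * μ.real (cylinder x n)) {k : ℕ} {H : ℝ}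
    (hmax : ∀ (x : SFT A) (W : Submodule ℝ (Vec d)), Module.finrank ℝ W = k →
      maxMass μ ν (x.1 0) W ≤ H) :
    ∃ D' > 0, ∀ (y : SFT A) (W : Submodule ℝ (Vec d)), Module.finrank ℝ W = k →
      maxMass μ ν (y.1 1) W ≤ H - (H - maxMass μ ν (y.1 0) (mapSubspace (N y)⁻¹ W)) / D' := by
  have := hμ.isProbabilityMeasure
  obtain ⟨D', hD', hshift⟩ := hμ.exists_measureReal_cylinder_shift_le
  refine ⟨D', hD', fun y W hW => maxMass_le hμ.cylinder_pos (shift A y) fun x n hx => ?_⟩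
  obtain ⟨z, hz₀, hz₁, hzx⟩ := exists_shift_mem_Wsloc hx
  have hWz : Module.finrank ℝ (mapSubspace (N y)⁻¹ W) = k := (finrank_mapSubspace _ _).trans hW
  have hNz : N z = N y := by rw [hN, hN, hz₀, hz₁]
  have hle := measureReal_le_maxMass_mul hμ.cylinder_pos hprod
  have hsplit := measureReal_cylinder_shift_le hμ.invariant hN hν (H := H)
    (fun x n W hW => (hle x n W).trans (by gcongr; exact hmax x W hW)) z n hW
  have hz := hle z (n + 1) (mapSubspace (N y)⁻¹ W)
  rw [hNz] at hsplit
  rw [hz₀] at hz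
  rw [← cylinder_eq_of_mem (x := x) fun i hi _ => hzx i hi]
  set h := maxMass μ ν (y.1 0) (mapSubspace (N y)⁻¹ W)
  set a := μ.real (cylinder (shift A z) (n + 1))
  set b := μ.real (cylinder z (n + 2))
  have hab : a / D' ≤ b := (div_le_iff₀' hD').2 (hshift (n + 1) z)
  have hh : 0 ≤ H - h := sub_nonneg.2 (hmax y _ hWz)
  calc ν.real (cylinder (shift A z) (n + 1) ×ˢ projSet W)
      ≤ h * b + H * (a - b) := hsplit.trans (by gcongr)
    _ = H * a - (H - h) * b := by ring
    _ ≤ H * a - (H - h) * (a / D') := by gcongr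
    _ = (H - (H - h) / D') * a := by ring

end MaxMass

section Transitivity

variable {m : ℕ} {A : Fin m → Fin m → Prop}

lemma IsTransitive.eq_of_apply_shift_le (hA : IsTransitive A) {β : Type*} [PartialOrder β]
    {g : SFT A → β} (hg : ∀ x y : SFT A, y.1 0 = x.1 0 → g y = g x)
    (hle : ∀ x, g (shift A x) ≤ g x) (x y : SFT A) : g x = g y := by
  have hiter : ∀ n x, g ((shift A)^[n] x) ≤ g x := fun n => by
    induction n with
    | zero => exact fun x => le_rfl
    | succ n ih => exact fun x => (ih (shift A x)).trans (hle x)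
  have hopen : ∀ z : SFT A, IsOpen {w : SFT A | w.1 0 = z.1 0} := fun z =>
    (isOpen_discrete {z.1 0}).preimage (continuous_coord 0)
  have hyx : ∀ x y : SFT A, g y ≤ g x := fun x y => by
    obtain ⟨n, _, ⟨w, hw, rfl⟩, hwn⟩ := hA _ _ (hopen x) ⟨x, rfl⟩ (hopen y) ⟨y, rfl⟩
    rw [← hg x w hw, ← hg y _ hwn]
    exact hiter n w
  exact le_antisymm (hyx y x) (hyx x y)

lemma IsTransitive.ncard_eq_and_image_eq (hA : IsTransitive A) {α : Type*} {U : Fin m → Set α}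
    (hfin : ∀ a, (U a).Finite) {f : SFT A → α → α} (hf : ∀ x, Function.Injective (f x))
    (hmaps : ∀ x : SFT A, Set.MapsTo (f x) (U (x.1 1)) (U (x.1 0))) :
    (∀ x y : SFT A, (U (x.1 0)).ncard = (U (y.1 0)).ncard) ∧
      ∀ x : SFT A, f x '' U (x.1 1) = U (x.1 0) := by
  have hcard : ∀ x y : SFT A, (U (x.1 0)).ncard = (U (y.1 0)).ncard :=
    hA.eq_of_apply_shift_le (g := fun x => (U (x.1 0)).ncard) (fun x y h => by rw [h]) fun x =>
      Set.ncard_le_ncard_of_injOn (f x) (hmaps x) (hf x).injOn (hfin _)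
  refine ⟨hcard, fun x => Set.eq_of_subset_of_ncard_le (hmaps x).image_subset ?_ (hfin _)⟩
  rw [Set.ncard_image_of_injective _ (hf x)]
  exact (hcard x (shift A x)).le

end Transitivity

section NoMass

variable {m d : ℕ} {A : Fin m → Fin m → Prop} {μ : Measure (SFT A)}
  {ν : Measure (SFT A × Proj d)} {M N L : SFT A → GLd d} {B : Fin m → Fin m → GLd d}

/-- The subspaces of minimal dimension and maximal conditional mass are finite in number and, by the
maximum principle, permuted by the cocycle. -/
theorem measure_projSet_eq_zero (hA : IsTransitive A) (hμ : IsQuasiBernoulli μ)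
    (hL : Continuous L) (hirr : StronglyIrreducible M (trivHolonomy L) (trivHolonomy L))
    (hNM : ∀ x, N x = L (shift A x) * M x * (L x)⁻¹) (hN : ∀ x, N x = B (x.1 0) (x.1 1))
    [IsFiniteMeasure ν] (hν : MeasurePreserving (projFibered N) ν ν) {D : ℝ} (hD : 0 < D)
    (hprod : ∀ x n (W : Submodule ℝ (Vec d)), ν.real (cylinder x n ×ˢ projSet W) ≤
      D * ν.snd.real (projSet W) * μ.real (cylinder x n))
    {W : Submodule ℝ (Vec d)} (hW : W ≠ ⊤) : ν.snd (projSet W) = 0 := by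
  by_contra hne
  obtain ⟨W₁, hpos, hlt, hne₁, hmin⟩ := exists_minimal_charged hW hne
  set k := Module.finrank ℝ W₁ with hk
  obtain ⟨x₀, W₀, hW₀, hH, hmax⟩ :=
    exists_isMax_maxMass hμ.cylinder_pos hprod hD hmin hk.symm hne₁
  set H := maxMass μ ν (x₀.1 0) W₀
  obtain ⟨D', hD', hstep⟩ := maxMass_le_sub hμ hN hν hprod hmax
  let U : Fin m → Set (Submodule ℝ (Vec d)) := fun a =>
    {W | Module.finrank ℝ W = k ∧ (∃ x : SFT A, x.1 0 = a) ∧ maxMass μ ν a W = H}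
  have hfin : ∀ a, (U a).Finite := fun a =>
    (finite_setOf_le_maxMass hμ.cylinder_pos hprod hD hmin hH).subset <| by
      rintro W ⟨hW, ⟨x, rfl⟩, hx⟩
      exact ⟨hW, x, hx.ge⟩
  have hmaps : ∀ x : SFT A, Set.MapsTo (mapSubspace (N x)⁻¹) (U (x.1 1)) (U (x.1 0)) := by
    rintro x W ⟨hW, -, hx⟩
    have hWx := (finrank_mapSubspace (N x)⁻¹ W).trans hW
    refine ⟨hWx, ⟨x, rfl⟩, (hmax x _ hWx).antisymm ?_⟩
    have hle := hstep x W hW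
    rw [hx, le_sub_self_iff] at hle
    exact sub_nonpos.1 (nonpos_of_mul_nonpos_left hle (inv_pos.2 hD'))
  obtain ⟨hcard, himage⟩ := hA.ncard_eq_and_image_eq hfin (fun x => mapSubspace_injective _) hmaps
  refine hirr.false_of_invariant_family hL hpos hlt (n := (U (x₀.1 0)).ncard) ?_ hfin
    (fun a W h => h.1) (fun x => hcard x x₀) fun x => ?_
  · exact (Set.ncard_pos (hfin _)).2 ⟨W₀, hW₀, ⟨x₀, rfl⟩, rfl⟩
  · rw [← hNM, ← himage x, Set.image_image]
    simp only [mapSubspace_mapSubspace_inv, Set.image_id']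

end NoMass

/-! ### Invariant `u`-states -/

section SlowLines

variable {m d : ℕ} {A : Fin m → Fin m → Prop} {M : SFT A → GLd d} {c : ℝ}

/-- The subspace of vectors whose iterates grow at most like `exp (n * c)`. -/
def slowSubspace (M : SFT A → GLd d) (c : ℝ) (x : SFT A) : Submodule ℝ (Vec d) where
  carrier := {v | ∃ K : ℝ, ∀ n : ℕ, ‖(iterNat M n x).1 v‖ ≤ K * Real.exp (n * c)}
  zero_mem' := ⟨0, fun n => by simp⟩
  add_mem' := by
    rintro v w ⟨K, hK⟩ ⟨K', hK'⟩
    refine ⟨K + K', fun n => ?_⟩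
    rw [map_add, add_mul]
    exact (norm_add_le _ _).trans (add_le_add (hK n) (hK' n))
  smul_mem' := by
    rintro a v ⟨K, hK⟩
    refine ⟨‖a‖ * K, fun n => ?_⟩
    rw [map_smul, norm_smul, mul_assoc]
    gcongr
    exact hK n

/-- If all vectors were slow, the uniform boundedness principle would bound the norms. -/
lemma slowSubspace_ne_top [NeZero d] {l : ℝ} {x : SFT A}
    (hl : HasExpRate (fun n => (iterNat M n x).1) l) (hc : c < l) : slowSubspace M c x ≠ ⊤ := by
  intro htop
  have hbdd : ∀ v, ∃ K, ∀ n : ℕ, ‖(Real.exp (-(n * c)) • (iterNat M n x).1) v‖ ≤ K := fun v => by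
    obtain ⟨K, hK⟩ : v ∈ slowSubspace M c x := htop ▸ Submodule.mem_top
    refine ⟨K, fun n => ?_⟩
    rw [smul_apply, norm_smul, Real.norm_of_nonneg (Real.exp_pos _).le, Real.exp_neg,
      inv_mul_le_iff₀ (Real.exp_pos _), mul_comm]
    exact hK n
  obtain ⟨K, hK⟩ := banach_steinhaus hbdd
  refine hc.not_ge (hl.le_of_norm_le (K := K) (fun n => (iterNat M n x).ne_zero) fun n => ?_)
  have := hK n
  rwa [norm_smul, Real.norm_of_nonneg (Real.exp_pos _).le, Real.exp_neg,
    inv_mul_le_iff₀ (Real.exp_pos _), mul_comm] at this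

lemma rep_mem_slowSubspace_iff {x : SFT A} {p : Proj d} :
    p.rep ∈ slowSubspace M c x ↔
      BddAbove (Set.range fun n : ℕ => logExp (iterNat M n x) p - n * c) := by
  have hp := norm_pos_iff.2 p.rep_nonzero
  have hpos : ∀ n, 0 < ‖(iterNat M n x).1 p.rep‖ := fun n => norm_units_apply_pos _ p.rep_nonzero
  have hbound : ∀ n (C : ℝ), logExp (iterNat M n x) p - n * c ≤ C ↔
      ‖(iterNat M n x).1 p.rep‖ ≤ Real.exp C * ‖p.rep‖ * Real.exp (n * c) := fun n C => by
    rw [logExp, sub_le_iff_le_add, Real.log_le_iff_le_exp (div_pos (hpos n) hp), Real.exp_add,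
      div_le_iff₀ hp, mul_right_comm]
  simp only [bddAbove_def, Set.forall_mem_range, hbound]
  refine ⟨fun ⟨K, hK⟩ => ⟨Real.log (K / ‖p.rep‖), ?_⟩, fun ⟨C, hC⟩ => ⟨_, hC⟩⟩
  have hK0 : 0 < K := pos_of_mul_pos_left ((hpos 0).trans_le (hK 0)) (Real.exp_pos _).le
  rw [Real.exp_log (by positivity), div_mul_cancel₀ _ hp.ne']
  exact hK

lemma measurableSet_slowLines (hM : Continuous M) :
    MeasurableSet {q : SFT A × Proj d | q.2 ∈ projSet (slowSubspace M c q.1)} := by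
  simp only [projSet, Set.mem_ofPred_eq, rep_mem_slowSubspace_iff]
  refine measurableSet_bddAbove_range fun n => ?_
  exact ((continuous_logExp_prod (continuous_iterNat hM n)).sub continuous_const).measurable

lemma ae_growth_of_measure_slowLines_eq_zero (hM : Continuous M) {ν : Measure (SFT A × Proj d)}
    [IsProbabilityMeasure ν] (hν : MeasurePreserving (projFibered M) ν ν) {l : ℝ}
    (hslow : ∀ c < l, ν {q | q.2 ∈ projSet (slowSubspace M c q.1)} = 0)
    (hl : ∀ᵐ q ∂ν, HasExpRate (fun n => (iterNat M n q.1).1) l) :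
    ∀ᵐ q ∂ν, FwdGrowth M l q.1 q.2.rep ∧ BwdGrowth M l q.1 q.2.rep := by
  obtain ⟨K, hK⟩ := exists_abs_logExpFibered_le hM
  refine ae_growth_of_le_integral hM hν (le_of_forall_lt_imp_le_of_dense fun c hc => ?_) hl
  refine le_integral_of_ae_exists_lt_birkhoffSum hν
    (integrable_of_abs_le (measurable_logExpFibered hM) hK) ?_
  filter_upwards [measure_eq_zero_iff_ae_notMem.1 (hslow c hc)] with q hq
  by_contra! hbdd
  simp only [birkhoffSum_logExpFibered] at hbdd
  refine hq (rep_mem_slowSubspace_iff.2 ⟨0, Set.forall_mem_range.2 fun n => ?_⟩)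
  linarith [hbdd n]

end SlowLines

section LocallyConstant

variable {m d : ℕ} {A : Fin m → Fin m → Prop} {N : SFT A → GLd d} {B : Fin m → Fin m → GLd d}

lemma continuous_of_eq_coord (hN : ∀ x, N x = B (x.1 0) (x.1 1)) : Continuous N := by
  rw [funext hN]
  exact (continuous_of_discreteTopology (f := fun p : Fin m × Fin m => B p.1 p.2)).comp
    ((continuous_coord 0).prodMk (continuous_coord 1))

lemma iterNat_congr (hN : ∀ x, N x = B (x.1 0) (x.1 1)) {x y : SFT A} :
    ∀ {n : ℕ}, (∀ i : ℤ, 0 ≤ i → i ≤ n → y.1 i = x.1 i) → iterNat N n y = iterNat N n x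
  | 0, _ => rfl
  | n + 1, h => by
    rw [iterNat_succ, iterNat_succ, iterNat_congr hN fun i h₀ h₁ => h i h₀ (by omega), hN, hN]
    simp only [shift_iterate_apply]
    rw [h _ (by omega) (by omega), h _ (by omega) (by omega)]

lemma iter_neg_eq_of_mem_Wuloc (hN : ∀ x, N x = B (x.1 0) (x.1 1)) {x y : SFT A}
    (h : y ∈ Wuloc x) (n : ℕ) : iter N (-n) y = iter N (-n) x := by
  rw [iter_neg_natCast, iter_neg_natCast, iterNat_congr hN fun i _ hi => ?_]
  rw [shift_symm_iterate_apply, shift_symm_iterate_apply]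
  exact h _ (by omega)

lemma slowSubspace_eq_of_mem_Wsloc (hN : ∀ x, N x = B (x.1 0) (x.1 1)) (c : ℝ) {x y : SFT A}
    (h : y ∈ Wsloc x) : slowSubspace N c y = slowSubspace N c x := by
  ext v
  exact exists_congr fun K => forall_congr' fun n => by
    rw [iterNat_congr hN fun i hi _ => h i hi]

end LocallyConstant

section UStates

variable {m d : ℕ} {A : Fin m → Fin m → Prop} {μ : Measure (SFT A)}

lemma HasLocalProductStructure.compProd_real_cylinder_prod_le {D : NNReal}
    (hμ : HasLocalProductStructure μ D) [IsFiniteMeasure μ] {Z : Type*} [MeasurableSpace Z]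
    {κ : Kernel (SFT A) Z} [IsFiniteKernel κ] {S : Set (SFT A)} (hS : S ∈ ae μ)
    (hκ : ∀ x ∈ S, ∀ y ∈ S, y ∈ Wuloc x → κ x = κ y) (x : SFT A) (n : ℕ) {F : Set Z}
    (hF : MeasurableSet F) :
    (μ ⊗ₘ κ).real (cylinder x n ×ˢ F) ≤ D * (μ ⊗ₘ κ).snd.real F * μ.real (cylinder x n) := by
  have hE := (measurableSet_cylinder x n).prod hF
  have hfuture : ∀ z, ∀ y ∈ Wsloc z, Prod.mk y ⁻¹' (cylinder x n ×ˢ F) =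
      Prod.mk z ⁻¹' (cylinder x n ×ˢ F) := fun z y hy => by
    have hyz : y ∈ cylinder x n ↔ z ∈ cylinder x n :=
      forall_congr' fun i => forall_congr' fun hi => by rw [hy i hi]
    exact Set.ext fun t => and_congr_left' hyz
  have hle : (μ ⊗ₘ κ) (cylinder x n ×ˢ F) ≤ D * ((μ ⊗ₘ κ).snd F * μ (cylinder x n)) := by
    refine (hμ.compProd_le hS hκ hE hfuture).trans ?_
    rw [← lintegral_indicator_const (measurableSet_cylinder x n)]
    gcongr with z
    by_cases hz : z ∈ cylinder x n
    · rw [Set.mk_preimage_prod_right hz, Set.indicator_of_mem hz, Measure.snd_apply hF]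
      exact measure_mono fun q hq => hq.2
    · simp [Set.mk_preimage_prod_right_eq_empty hz]
  rw [mul_assoc]
  exact (ENNReal.toReal_mono (by finiteness) hle).trans_eq (by simp [Measure.real])

variable {M L N : SFT A → GLd d} {B : Fin m → Fin m → GLd d}

theorem measure_slowLines_eq_zero [NeZero d] (hA : IsTransitive A) (hμ : IsQuasiBernoulli μ)
    (hL : Continuous L) (hirr : StronglyIrreducible M (trivHolonomy L) (trivHolonomy L))
    (hNM : ∀ x, N x = L (shift A x) * M x * (L x)⁻¹) (hN : ∀ x, N x = B (x.1 0) (x.1 1))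
    {l : ℝ} (hl : ∀ᵐ x ∂μ, HasExpRate (fun n => (iterNat N n x).1) l)
    {ν : Measure (SFT A × Proj d)} (hν : IsInvariantUState μ N (fun _ _ => 1) ν)
    {c : ℝ} (hc : c < l) : ν {q | q.2 ∈ projSet (slowSubspace N c q.1)} = 0 := by
  have := hμ.isProbabilityMeasure
  obtain ⟨D, hD⟩ := hμ.exists_hasLocalProductStructure
  obtain ⟨⟨-, -, κ, hκm, rfl, S, hS, hκ⟩, hinv⟩ := hν
  replace hκ : ∀ x ∈ S, ∀ y ∈ S, y ∈ Wuloc x → κ x = κ y := fun x hx y hy hxy => by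
    rw [← hκ x hx y hy hxy, funext projMap_one, Measure.map_id']
  have hmass : ∀ W : Submodule ℝ (Vec d), W ≠ ⊤ → (μ ⊗ₘ κ).snd (projSet W) = 0 := fun W hW => by
    refine measure_projSet_eq_zero hA hμ hL hirr hNM hN hinv (D := D + 1) (by positivity)
      (fun x n V => ?_) hW
    refine (hD.compProd_real_cylinder_prod_le hS hκ x n (measurableSet_projSet V)).trans ?_
    gcongr
    exact le_add_of_nonneg_right zero_le_one
  refine nonpos_iff_eq_zero.1 ((hD.compProd_le hS hκ
    (measurableSet_slowLines (continuous_of_eq_coord hN)) fun x y hy => ?_).trans_eq ?_)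
  · change projSet (slowSubspace N c y) = projSet (slowSubspace N c x)
    rw [slowSubspace_eq_of_mem_Wsloc hN c hy]
  · rw [lintegral_eq_zero_of_ae_eq_zero, mul_zero]
    filter_upwards [hl] with z hz
    have hnull := hmass _ (slowSubspace_ne_top hz hc)
    rw [Measure.snd_apply (measurableSet_projSet _)] at hnull
    exact measure_mono_null (fun q hq => hq.2) hnull

end UStates

section Trivialization

variable {m d : ℕ} {A : Fin m → Fin m → Prop} {μ : Measure (SFT A)} {M L N : SFT A → GLd d}
  {l : ℝ} {x y : SFT A} {v : Vec d}

lemma norm_units_mul_mul_le {K : ℝ} (g h k : GLd d) (hg : ‖g.1‖ ≤ K) (hk : ‖k.1‖ ≤ K) :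
    ‖(g * h * k).1‖ ≤ K * K * ‖h.1‖ := by
  have hK : 0 ≤ K := (norm_nonneg _).trans hg
  calc ‖g.1 * h.1 * k.1‖ ≤ ‖g.1‖ * ‖h.1‖ * ‖k.1‖ := norm_mul₃_le
    _ ≤ K * ‖h.1‖ * K := by gcongr
    _ = K * K * ‖h.1‖ := by ring

lemma hasExpRate_norm_conj (hL : Continuous L) (hNM : ∀ x, N x = L (shift A x) * M x * (L x)⁻¹)
    (h : HasExpRate (fun n => (iterNat M n x).1) l) :
    HasExpRate (fun n => (iterNat N n x).1) l := by
  obtain ⟨K, -, hK⟩ := exists_norm_units_le hL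
  refine h.of_comparable (K := K * K) (fun n => ?_) fun n => ?_
  · rw [show iterNat M n x = (L ((shift A)^[n] x))⁻¹ * iterNat N n x * L x by
      rw [iterNat_conj hNM]; group]
    exact norm_units_mul_mul_le _ _ _ (hK _).2 (hK _).1
  · rw [iterNat_conj hNM]
    exact norm_units_mul_mul_le _ _ _ (hK _).1 (hK _).2

lemma IsLocallyConstantIn.exists_conj (hM : IsLocallyConstantIn M L) :
    ∃ (N : SFT A → GLd d) (B : Fin m → Fin m → GLd d),
      (∀ x, N x = L (shift A x) * M x * (L x)⁻¹) ∧ ∀ x, N x = B (x.1 0) (x.1 1) := by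
  obtain ⟨-, B, hB⟩ := hM
  exact ⟨_, B, fun x => rfl, hB⟩

lemma IsLocallyConstantIn.continuous (hM : IsLocallyConstantIn M L) : Continuous M := by
  obtain ⟨N, B, hNM, hN⟩ := hM.exists_conj
  have hM_eq : M = fun x => (L (shift A x))⁻¹ * N x * L x := funext fun x => by rw [hNM]; group
  rw [hM_eq]
  exact ((hM.1.comp continuous_shift).inv.mul (continuous_of_eq_coord hN)).mul hM.1

lemma BwdGrowth.trivHolonomy (hM : IsLocallyConstantIn M L) (h : BwdGrowth M l x v)
    (hy : y ∈ Wuloc x) : BwdGrowth M l y ((trivHolonomy L x y).1 v) := by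
  obtain ⟨N, B, hNM, hN⟩ := hM.exists_conj
  rw [← bwdGrowth_conj hM.1 hNM, SFTCocycle.trivHolonomy, units_mul_apply, units_apply_inv_apply]
  simp only [BwdGrowth, iter_neg_eq_of_mem_Wuloc hN hy]
  exact (bwdGrowth_conj hM.1 hNM).2 h

lemma bwdGrowth_rep_mk (hv : v ≠ 0) :
    BwdGrowth M l x (Projectivization.mk ℝ v hv).rep ↔ BwdGrowth M l x v := by
  obtain ⟨c, hc⟩ := Projectivization.exists_smul_eq_mk_rep ℝ v hv
  rw [← hc, Units.smul_def]
  refine ⟨fun h => ?_, fun h => h.smul c.ne_zero⟩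
  simpa only [smul_smul, c.inv_mul, one_smul] using h.smul c⁻¹.ne_zero

lemma bwdGrowth_rep_projMap (g : GLd d) (p : Proj d) :
    BwdGrowth M l x (projMap g p).rep ↔ BwdGrowth M l x (g.1 p.rep) := by
  rw [← bwdGrowth_rep_mk (units_apply_ne_zero g p.rep_nonzero),
    ← projMap_mk g p.rep p.rep_nonzero, p.mk_rep]

lemma measurable_projMap (g : GLd d) : Measurable (projMap g) :=
  ((continuous_projMap_prod (X := Unit) (M := fun _ => g) continuous_const).comp
    (Continuous.prodMk_right ())).measurable

/-- The map between projective bundles given by the trivialization `L`. -/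
def projTriv (L : SFT A → GLd d) (q : SFT A × Proj d) : SFT A × Proj d :=
  (q.1, projMap (L q.1) q.2)

lemma measurable_projTriv (hL : Continuous L) : Measurable (projTriv L) :=
  measurable_fst.prodMk (measurable_projMap_prod hL)

lemma projTriv_semiconj (hNM : ∀ x, N x = L (shift A x) * M x * (L x)⁻¹) :
    Function.Semiconj (projTriv L) (projFibered M) (projFibered N) := fun q => by
  refine Prod.ext rfl ?_
  change projMap (L (shift A q.1)) (projMap (M q.1) q.2) = projMap (N q.1) (projMap (L q.1) q.2)
  rw [← projMap_mul, ← projMap_mul, hNM, inv_mul_cancel_right]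

lemma IsUState.map_projTriv [SFinite μ] (hL : Continuous L) {ν : Measure (SFT A × Proj d)}
    (hν : IsUState μ (trivHolonomy L) ν) :
    IsUState μ (fun _ _ => 1) (ν.map (projTriv L)) := by
  have hΘ := measurable_projTriv hL
  have hproj := measurable_projMap_prod hL
  obtain ⟨_, hfst, κ, hκ, rfl, S, hS, hinv⟩ := hν
  let κ' : Kernel (SFT A) (Proj d) :=
    (Kernel.id ×ₖ κ).map fun q => projMap (L q.1) q.2
  have hκ' : ∀ x, κ' x = (κ x).map (projMap (L x)) := fun x => by
    rw [Kernel.map_apply _ hproj, Kernel.prod_apply, Kernel.id_apply, Measure.dirac_prod,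
      Measure.map_map hproj measurable_prodMk_left]
    rfl
  refine ⟨Measure.isProbabilityMeasure_map hΘ.aemeasurable, ?_, κ',
    Kernel.IsMarkovKernel.map _ hproj, ?_, S, hS, fun x hx y hy hxy => ?_⟩
  · rw [Measure.map_map measurable_fst hΘ]
    exact hfst
  · ext E hE
    rw [Measure.map_apply hΘ hE, Measure.compProd_apply (hΘ hE), Measure.compProd_apply hE]
    refine lintegral_congr fun x => ?_
    rw [hκ', Measure.map_apply (measurable_projMap _) (measurable_prodMk_left hE)]
    rfl
  · rw [funext projMap_one, Measure.map_id', hκ', hκ', ← hinv x hx y hy hxy,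
      Measure.map_map (measurable_projMap _) (measurable_projMap _)]
    congr 1
    ext p
    rw [Function.comp_apply, ← projMap_mul, trivHolonomy, mul_inv_cancel_left]

lemma IsInvariantUState.map_projTriv [SFinite μ] (hM : Continuous M) (hL : Continuous L)
    (hNM : ∀ x, N x = L (shift A x) * M x * (L x)⁻¹) {ν : Measure (SFT A × Proj d)}
    (hν : IsInvariantUState μ M (trivHolonomy L) ν) :
    IsInvariantUState μ N (fun _ _ => 1) (ν.map (projTriv L)) := by
  have hΘ := measurable_projTriv hL
  have hN : Measurable (projFibered N) := by
    rw [funext hNM]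
    exact measurable_projFibered (((hL.comp continuous_shift).mul hM).mul hL.inv)
  exact ⟨hν.1.map_projTriv hL, (hΘ.measurePreserving ν).of_semiconj hν.2 (projTriv_semiconj hNM) hN⟩

theorem IsInvariantUState.ae_bwdGrowth [NeZero d] (hA : IsTransitive A) (hμ : IsQuasiBernoulli μ)
    (hM : IsLocallyConstantIn M L) (hirr : StronglyIrreducible M (trivHolonomy L) (trivHolonomy L))
    (hl : ∀ᵐ x ∂μ, HasExpRate (fun n => (iterNat M n x).1) l) {ν : Measure (SFT A × Proj d)}
    (hν : IsInvariantUState μ M (trivHolonomy L) ν) :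
    ∀ᵐ q ∂ν, BwdGrowth M l q.1 q.2.rep := by
  have := hμ.isProbabilityMeasure
  obtain ⟨N, B, hNM, hN⟩ := hM.exists_conj
  have hνN := hν.map_projTriv hM.continuous hM.1 hNM
  have hlN : ∀ᵐ x ∂μ, HasExpRate (fun n => (iterNat N n x).1) l :=
    hl.mono fun x hx => hasExpRate_norm_conj hM.1 hNM hx
  have := hνN.1.1
  have hgrow := ae_growth_of_measure_slowLines_eq_zero (continuous_of_eq_coord hN) hνN.2
    (fun c hc => measure_slowLines_eq_zero hA hμ hM.1 hirr hNM hN hlN hνN hc)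
    (ae_of_ae_map measurable_fst.aemeasurable (hνN.1.2.1.symm ▸ hlN))
  filter_upwards [ae_of_ae_map (measurable_projTriv hM.1).aemeasurable hgrow] with q hq
  exact (bwdGrowth_conj hM.1 hNM).1 ((bwdGrowth_rep_projMap _ _).1 hq.2)

end Trivialization

section Sections

lemma eq_map_of_ae_snd_eq {X Y : Type*} [MeasurableSpace X] [MeasurableSpace Y]
    {ν : Measure (X × Y)} {s : X → Y} (hs : Measurable s) (h : ∀ᵐ q ∂ν, q.2 = s q.1) :
    ν = ν.fst.map fun x => (x, s x) := by
  have hgraph : (fun q : X × Y => q) =ᵐ[ν] (fun x => (x, s x)) ∘ Prod.fst :=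
    h.mono fun q hq => Prod.ext rfl hq
  have hs' : Measurable fun x => (x, s x) := measurable_id.prodMk hs
  rw [Measure.fst, Measure.map_map hs' measurable_fst, ← Measure.map_congr hgraph,
    Measure.map_id']

variable {m d : ℕ} {A : Fin m → Fin m → Prop} {μ : Measure (SFT A)} {M L : SFT A → GLd d} {l : ℝ}

lemma isInvariantUState_map_section [IsProbabilityMeasure μ]
    (hT : MeasurePreserving (shift A) μ μ) (hM : Continuous M) {H : SFT A → SFT A → GLd d}
    {s : SFT A → Proj d} (hs : Measurable s) {S : Set (SFT A)} (hS : S ∈ ae μ)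
    (hinv : ∀ᵐ x ∂μ, projMap (M x) (s x) = s (shift A x))
    (hH : ∀ x ∈ S, ∀ y ∈ S, y ∈ Wuloc x → projMap (H x y) (s x) = s y) :
    IsInvariantUState μ M H (μ.map fun x => (x, s x)) := by
  have hgraph : Measurable fun x => (x, s x) := measurable_id.prodMk hs
  refine ⟨⟨Measure.isProbabilityMeasure_map hgraph.aemeasurable, ?_, Kernel.deterministic s hs,
    inferInstance, (Measure.compProd_deterministic hs).symm, S, hS, fun x hx y hy hxy => ?_⟩,
    measurable_projFibered hM, ?_⟩
  · rw [Measure.map_map measurable_fst hgraph]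
    exact Measure.map_id
  · rw [Kernel.deterministic_apply, Kernel.deterministic_apply,
      Measure.map_dirac' (measurable_projMap _), hH x hx y hy hxy]
  · have heq : projFibered M ∘ (fun x => (x, s x)) =ᵐ[μ] (fun x => (x, s x)) ∘ shift A :=
      hinv.mono fun x hx => Prod.ext rfl hx
    rw [Measure.map_map (measurable_projFibered hM) hgraph, Measure.map_congr heq,
      ← Measure.map_map hgraph hT.measurable, hT.map_eq]

lemma measurable_mk {X : Type*} [MeasurableSpace X] {v : X → Vec d} (hv : Measurable v)
    (hv0 : ∀ x, v x ≠ 0) : Measurable fun x => Projectivization.mk ℝ (v x) (hv0 x) :=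
  isOpenQuotientMap_mk'.continuous.measurable.comp (hv.subtype_mk (h := hv0))

lemma oseledets_eq_span {x : SFT A} {v : Vec d} (hv : v ≠ 0)
    (hgrow : FwdGrowth M l x v ∧ BwdGrowth M l x v)
    (huniq : ∀ u w : Vec d, BwdGrowth M l x u → BwdGrowth M l x w → gramDet u w = 0) :
    oseledets M l x = (Submodule.span ℝ {v} : Submodule ℝ (Vec d)) := by
  ext w
  rw [mem_oseledets_iff, SetLike.mem_coe]
  constructor
  · rintro (rfl | ⟨-, hw⟩)
    · exact Submodule.zero_mem _
    · exact mem_span_singleton_of_gramDet_eq_zero hv (huniq v w hgrow.2 hw)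
  · intro hw
    obtain ⟨c, rfl⟩ := Submodule.mem_span_singleton.1 hw
    rcases eq_or_ne c 0 with rfl | hc
    · exact .inl (zero_smul ℝ v)
    · exact .inr ⟨hgrow.1.smul hc, hgrow.2.smul hc⟩

/-- The lines of growth rate `l` in the past are equivariant under the cocycle and under the
unstable holonomy, so a section which spans them is invariant where they are unique. -/
lemma isInvariantUState_map_section_of_bwdGrowth [IsProbabilityMeasure μ]
    (hT : MeasurePreserving (shift A) μ μ) (hM : IsLocallyConstantIn M L) {s : SFT A → Proj d}
    (hs : Measurable s)
    (hgrow : ∀ᵐ x ∂μ, BwdGrowth M l x (s x).rep ∧ ∀ p, BwdGrowth M l x p.rep → p = s x) :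
    IsInvariantUState μ M (trivHolonomy L) (μ.map fun x => (x, s x)) := by
  refine isInvariantUState_map_section hT hM.continuous hs hgrow ?_ fun x hx y hy hxy => ?_
  · filter_upwards [hgrow, hT.quasiMeasurePreserving.ae hgrow] with x hx hTx
    exact hTx.2 _ ((bwdGrowth_rep_projMap _ _).2 hx.1.shift)
  · exact hy.2 _ ((bwdGrowth_rep_projMap _ _).2 (hx.1.trivHolonomy hM hxy))

end Sections

end SFTCocycle

end

open SFTCocycle in
theorem theorem3p7_general {m d : ℕ} [NeZero d] (A : Fin m → Fin m → Prop)
    (hA : IsTransitive A) (μ : Measure (SFT A)) (hμ : IsQuasiBernoulli μ)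
    (M L : SFT A → GLd d) (hM : IsLocallyConstantIn M L)
    (hirr : StronglyIrreducible M (trivHolonomy L) (trivHolonomy L))
    (lam : Fin d → ℝ) (hlam : IsLyapunovSpectrum μ M lam)
    (hsimple : ∀ j : Fin d, j ≠ 0 → lam j < lam 0) :
    ∃ (v₁ : SFT A → Vec d) (hv₁ : ∀ x, v₁ x ≠ 0),
      Measurable v₁ ∧
      (∀ᵐ x ∂μ, oseledets M (lam 0) x = (Submodule.span ℝ {v₁ x} : Submodule ℝ (Vec d))) ∧
      ∀ ν : Measure (SFT A × Proj d), IsInvariantUState μ M (trivHolonomy L) ν ↔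
        ν = μ.map (fun x => (x, Projectivization.mk ℝ (v₁ x) (hv₁ x))) := by
  have := hμ.isProbabilityMeasure
  have hnorm := hlam.ae_hasExpRate_norm
  obtain ⟨γ, hγ, harea⟩ := exists_areaExpansion_rate hlam hsimple
  have huniq := ae_gramDet_eq_zero_of_bwdGrowth hμ.invariant hM.continuous hγ harea
  obtain ⟨v, hv, hv0, hgrow⟩ := exists_measurable_growth hμ.invariant hM.continuous hnorm huniq
  have hs := measurable_mk hv hv0
  have hline : ∀ᵐ x ∂μ, BwdGrowth M (lam 0) x (Projectivization.mk ℝ (v x) (hv0 x)).rep ∧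
      ∀ p, BwdGrowth M (lam 0) x p.rep → p = Projectivization.mk ℝ (v x) (hv0 x) := by
    filter_upwards [hgrow, huniq] with x hx hxu
    have hrep := (bwdGrowth_rep_mk (hv0 x)).2 hx.2
    exact ⟨hrep, fun p hp => eq_of_gramDet_rep_eq_zero (hxu _ _ hp hrep)⟩
  refine ⟨v, hv0, hv, ?_, fun ν => ⟨fun hν => ?_, ?_⟩⟩
  · filter_upwards [hgrow, huniq] with x hx hxu using oseledets_eq_span (hv0 x) hx hxu
  · have hfst : ν.fst = μ := hν.1.2.1
    rw [← hfst] at hline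
    rw [← hfst]
    refine eq_map_of_ae_snd_eq hs ?_
    filter_upwards [hν.ae_bwdGrowth hA hμ hM hirr hnorm,
      ae_of_ae_map measurable_fst.aemeasurable hline] with q hq hql using hql.2 _ hq
  · rintro rfl
    exact isInvariantUState_map_section_of_bwdGrowth hμ.invariant hM hs hline

theorem theorem3p7 {m d : ℕ} [NeZero d] (A : Fin m → Fin m → Prop)
    (hA : SFTCocycle.IsTransitive A)
    (μ : Measure (SFTCocycle.SFT A)) (hμ : SFTCocycle.IsGibbs μ)
    (M L : SFTCocycle.SFT A → SFTCocycle.GLd d) (hM : SFTCocycle.IsLocallyConstantIn M L)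
    (hirr : SFTCocycle.StronglyIrreducible M
      (SFTCocycle.trivHolonomy L) (SFTCocycle.trivHolonomy L))
    (lam : Fin d → ℝ) (hlam : SFTCocycle.IsLyapunovSpectrum μ M lam)
    (hsimple : ∀ j : Fin d, j ≠ 0 → lam j < lam 0) :
    ∃ (v₁ : SFTCocycle.SFT A → SFTCocycle.Vec d) (hv₁ : ∀ x, v₁ x ≠ 0),
      Measurable v₁ ∧
      (∀ᵐ x ∂μ, SFTCocycle.oseledets M (lam 0) x
        = (Submodule.span ℝ {v₁ x} : Submodule ℝ (SFTCocycle.Vec d))) ∧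
      ∀ ν : Measure (SFTCocycle.SFT A × SFTCocycle.Proj d),
        SFTCocycle.IsInvariantUState μ M (SFTCocycle.trivHolonomy L) ν ↔
          ν = μ.map (fun x => (x, Projectivization.mk ℝ (v₁ x) (hv₁ x))) :=
  theorem3p7_general A hA μ hμ.isQuasiBernoulli M L hM hirr lam hlam hsimple
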